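/- **Setting.** Let $V$ be a set of $n$ points, each with one color from a set $\chi$ of $k=|\chi|$ colors; for $S\subseteq V$ let $c_i(S)$ be the number of points of color $i$ in $S$. A clustering of $V$ is a partition of $V$ into nonempty clusters. It is *fair* if $c_1(F):\cdots:c_k(F)=c_1(V):\cdots:c_k(V)$ for each of its clusters $F$, that is, $c_i(F)\,c_j(V)=c_j(F)\,c_i(V)$ for all colors $i,j$. A correlation clustering instance $G$ is the complete graph on $V$ with every edge labelled $+$ or $-$; $\mathrm{cost}(\mathcal C)$ is the number of $+$ edges between different clusters of $\mathcal C$ plus the number of $-$ edges inside clusters of $\mathcal C$. For $\alpha\ge 0$, a clustering $\mathcal F$ is an *$\alpha$-approximate fair correlation clustering* if it is fair and $\mathrm{cost}(\mathcal F)\le\alpha\cdot\mathrm{cost}(\mathcal F')$ for every fair clustering $\mathcal F'$ (equivalently, for a fair $\mathcal F'$ of minimum cost). **Theorem.** There is a deterministic algorithm, running in time polynomial in $n$ (on a unit-cost random access machine with addition and truncated subtraction), and an absolute constant $c$, such that on every instance $G$ with coloring $V\to\chi$ the algorithm outputs a clustering $\mathcal F$ that * is a $c\,|\chi|^{3.81}$-approximate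 fair correlation clustering, whatever the proportions of the colors, and * is a $c\,|\chi|^{1.6}\,(\log_2|\chi|)^{2.81}$-approximate fair correlation clustering if $|\chi|\ge 2$ and all colors have the same number of points. -/

import Mathlib

namespace FairCC

/-! ### Clusterings, fairness and the correlation clustering cost

A correlation clustering instance on a vertex set `V` is a complete graph whose edges are labelled
`+` or `-`.  It is given by the simple graph `G` of the `+` edges; the `-` edges are those of `Gᶜ`.
A clustering of `V` is a partition of `V` into nonempty clusters. -/

/-- A clustering: a partition of the vertex set into nonempty clusters. -/
abbrev Clustering (V : Type) [Fintype V] [DecidableEq V] : Type :=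
  Finpartition (Finset.univ : Finset V)

section Clusterings

variable {V : Type} [Fintype V] [DecidableEq V]

/-- The number of points of color `i` in the set `S`. -/
def colorCount {k : ℕ} (χ : V → Fin k) (i : Fin k) (S : Finset V) : ℕ :=
  (S.filter fun v => χ v = i).card

/-- In every cluster the colors appear in the same proportion as in `V`:
`c₁(F) : ⋯ : cₖ(F) = c₁(V) : ⋯ : cₖ(V)` (an equality of ratios, cross-multiplied). -/
def IsFair {k : ℕ} (χ : V → Fin k) (P : Clustering V) : Prop :=
  ∀ F ∈ P.parts, ∀ i j : Fin k,
    colorCount χ i F * colorCount χ j Finset.univ = colorCount χ j F * colorCount χ i Finset.univ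

/-- All color groups have the same number of points. -/
def EqualGroups {k : ℕ} (χ : V → Fin k) : Prop :=
  ∀ i j : Fin k, colorCount χ i Finset.univ = colorCount χ j Finset.univ

/-- Edges of the complete graph with both endpoints in one cluster. -/
def intraEdges (P : Clustering V) : Set (Sym2 V) :=
  {e | ¬ e.IsDiag ∧ ∃ C ∈ P.parts, ∀ v ∈ e, v ∈ C}

/-- Edges of the complete graph with endpoints in two different clusters. -/
def interEdges (P : Clustering V) : Set (Sym2 V) :=
  {e | ¬ e.IsDiag ∧ ¬ ∃ C ∈ P.parts, ∀ v ∈ e, v ∈ C}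

/-- The number of `+` edges between clusters plus the number of `-` edges inside clusters. -/
noncomputable def cost (G : SimpleGraph V) (P : Clustering V) : ℕ :=
  (interEdges P ∩ G.edgeSet).ncard + (intraEdges P ∩ Gᶜ.edgeSet).ncard

/-- `P` is an `α`-approximate fair correlation clustering: it is fair, and its cost is at most
`α` times the cost of any fair clustering (equivalently, of an optimal one). -/
def IsApproxFair {k : ℕ} (α : ℝ) (G : SimpleGraph V) (χ : V → Fin k) (P : Clustering V) : Prop :=
  IsFair χ P ∧ ∀ Q : Clustering V, IsFair χ Q → (cost G P : ℝ) ≤ α * (cost G Q : ℝ)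

end Clusterings

/-! ### Algorithms: programs of a random access machine, with a step count

The machine has registers and arrays that hold natural numbers.  The arithmetic operations are
addition and truncated subtraction only, so that a number with more than polynomially many bits
cannot arise in polynomially many unit-cost steps. -/

/-- Arithmetic expressions. -/
inductive Expr : Type
  /-- a numeral -/
  | const (c : ℕ) : Expr
  /-- the content of a register -/
  | reg (r : ℕ) : Expr
  /-- `get a i` is the entry of array `a` at the index given by `i` -/
  | get (a : ℕ) (i : Expr) : Expr
  /-- addition -/
  | add (x y : Expr) : Expr
  /-- truncated subtraction -/
  | sub (x y : Expr) : Expr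

/-- Programs. -/
inductive Prog : Type
  /-- do nothing -/
  | skip : Prog
  /-- `assign r x` writes `x` to register `r` -/
  | assign (r : ℕ) (x : Expr) : Prog
  /-- `store a i x` writes `x` to array `a` at index `i` -/
  | store (a : ℕ) (i x : Expr) : Prog
  /-- sequential composition -/
  | seq (p q : Prog) : Prog
  /-- `cond x p q` runs `p` if `x ≠ 0`, and `q` otherwise -/
  | cond (x : Expr) (p q : Prog) : Prog
  /-- `loop x p` repeats `p` as long as `x ≠ 0` -/
  | loop (x : Expr) (p : Prog) : Prog

/-- Machine states: contents of the registers and of the arrays. -/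
@[ext] structure State : Type where
  reg : ℕ → ℕ
  arr : ℕ → ℕ → ℕ

/-- The value of an expression. -/
def Expr.val (s : State) : Expr → ℕ
  | .const c => c
  | .reg r => s.reg r
  | .get a i => s.arr a (i.val s)
  | .add x y => x.val s + y.val s
  | .sub x y => x.val s - y.val s

/-- The number of steps for evaluating an expression: one for each constant, each access to a
register or an array, and each arithmetic operation. -/
def Expr.steps : Expr → ℕ
  | .const _ => 1
  | .reg _ => 1
  | .get _ i => i.steps + 1
  | .add x y => x.steps + y.steps + 1
  | .sub x y => x.steps + y.steps + 1

/-- The state after writing `x` to register `r`. -/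
def State.setReg (s : State) (r x : ℕ) : State :=
  { s with reg := Function.update s.reg r x }

/-- The state after writing `x` to array `a` at index `i`. -/
def State.setArr (s : State) (a i x : ℕ) : State :=
  { s with arr := Function.update s.arr a (Function.update (s.arr a) i x) }

/-- `Exec p s t s'`: started in state `s`, the program `p` halts in state `s'` after exactly `t`
steps.  (The language is deterministic: `t` and `s'` are determined by `p` and `s`.) -/
inductive Exec : Prog → State → ℕ → State → Prop
  | skip (s : State) : Exec .skip s 1 s
  | assign (s : State) (r : ℕ) (x : Expr) :
      Exec (.assign r x) s (x.steps + 1) (s.setReg r (x.val s))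
  | store (s : State) (a : ℕ) (i x : Expr) :
      Exec (.store a i x) s (i.steps + x.steps + 1) (s.setArr a (i.val s) (x.val s))
  | seq {p q : Prog} {s s' s'' : State} {t t' : ℕ} :
      Exec p s t s' → Exec q s' t' s'' → Exec (.seq p q) s (t + t') s''
  | cond_true {x : Expr} {p q : Prog} {s s' : State} {t : ℕ} :
      x.val s ≠ 0 → Exec p s t s' → Exec (.cond x p q) s (x.steps + 1 + t) s'
  | cond_false {x : Expr} {p q : Prog} {s s' : State} {t : ℕ} :
      x.val s = 0 → Exec q s t s' → Exec (.cond x p q) s (x.steps + 1 + t) s'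
  | loop_stop {x : Expr} {p : Prog} {s : State} :
      x.val s = 0 → Exec (.loop x p) s (x.steps + 1) s
  | loop_step {x : Expr} {p : Prog} {s s' s'' : State} {t t' : ℕ} :
      x.val s ≠ 0 → Exec p s t s' → Exec (.loop x p) s' t' s'' →
        Exec (.loop x p) s (x.steps + 1 + t + t') s''

/-! ### Input and output conventions -/

open Classical in
/-- The input on `n` points with `k` colors: register 0 holds `n`, register 1 holds `k`, array 0
lists the colors of the points, and array 1 is the row-major `n × n` matrix with entry 1 for a `+`
edge and 0 otherwise.  Everything else is 0. -/
noncomputable def inputState (n k : ℕ) (G : SimpleGraph (Fin n)) (χ : Fin n → Fin k) : State where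
  reg := fun r => if r = 0 then n else if r = 1 then k else 0
  arr := fun a m =>
    if a = 0 then (if h : m < n then (χ ⟨m, h⟩ : ℕ) else 0)
    else if a = 1 then
      (if ∃ u v : Fin n, G.Adj u v ∧ m = (u : ℕ) * n + (v : ℕ) then 1 else 0)
    else 0

/-- The state `s` holds the clustering `P` as output: array 2 gives a cluster label to each point,
and two points have the same label exactly if they are in the same cluster. -/
def Outputs {n : ℕ} (s : State) (P : Clustering (Fin n)) : Prop :=
  ∀ u v : Fin n, s.arr 2 u = s.arr 2 v ↔ ∃ C ∈ P.parts, u ∈ C ∧ v ∈ C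

end FairCC

/-! The stated factors are at least 1 whenever there is a point to cluster, so it suffices to find a
fair clustering within an absolute constant of the optimum; the constant obtained is 116.

An unrestricted clustering `L` comes first. Take a maximal family of bad triangles (two `+` edges,
one `-` edge) that share no edge. Every clustering errs on an edge of each of them, so the number of
edges in the family is at most 3 times the cost of any clustering (`card_packing_step`). Flip these
edges. By maximality, every bad triangle of the flipped graph contains a flipped edge
(`marked_of_bad`). Averaging over the unlabelled points then gives a pivot whose cluster makes at
most 3 mistakes for each flipped edge charged to it (`exists_pivot`), and no flipped edge is charged
twice (`PivotState.step`). Hence `L` differs from the flipped graph on at most 3 times as many pairs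
as were flipped, and costs at most (3 + 1) · 3 = 12 times any clustering.

Next, `L` is replaced by a fair clustering that is closest to it up to a factor 8. Only the sizes of
the fair clusters built from the labels matter: given the sizes, each label keeps as many points of
each color as its quota allows, and the points that leave fill the gaps color by color (`newLabel`).
The price is at most twice a sum of weights that depend on one label and its size only
(`card_disagree_newLabel_le`), so dynamic programming minimizes this sum (`Distribution.step`).
Conversely, the clusters of any fair `M` can be assigned to labels with total weight at most 4 times
the distance from `L` to `M` (`exists_sizes`): a cluster goes to the label with which it shares a
majority in both directions, or else to a fresh label.

By the triangle inequality, the result costs at most 12 + 8 · (12 + 1) = 116 times any fair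
clustering. Polynomial running time follows from a small calculus of functions (`Computes`) and
memory transformations (`Executes`) that is closed under the operations used. -/

namespace FairCC

open Finset

/-! ### A library of computable functions and memory transformations

Variables live in the registers with even numbers, intermediate results in those with odd numbers.
Every loop runs over the numbers below `2 * n + 1`, where `n` is the content of register 0. -/

/-- The contents of the arrays. -/
abbrev Arr : Type := ℕ → ℕ → ℕ

/-- The registers of the variables below `l` have the same contents in `r` and `r'`. -/
def SameVars (l : ℕ) (r r' : ℕ → ℕ) : Prop :=
  ∀ v < l, r' (2 * v) = r (2 * v)

theorem SameVars.trans {l : ℕ} {r r' r'' : ℕ → ℕ} (h : SameVars l r r') (h' : SameVars l r' r'') :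
    SameVars l r r'' := fun v hv => (h' v hv).trans (h v hv)

theorem SameVars.mono {l l' : ℕ} {r r' : ℕ → ℕ} (h : SameVars l' r r') (hl : l ≤ l') :
    SameVars l r r' := fun v hv => h v (hv.trans_le hl)

/-- Types of lists of variables, the first of which is the size of the input.  `IsRead l ρ` says
that `ρ` reads the values from the registers of variables below `l`. -/
class Ctx (Γ : Type) where
  size : Γ → ℕ
  IsRead : ℕ → ((ℕ → ℕ) → Γ) → Prop
  pos {l : ℕ} {ρ : (ℕ → ℕ) → Γ} : IsRead l ρ → 0 < l
  size_read {l : ℕ} {ρ : (ℕ → ℕ) → Γ} : IsRead l ρ → ∀ r, size (ρ r) = r 0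
  congr {l : ℕ} {ρ : (ℕ → ℕ) → Γ} : IsRead l ρ → ∀ r r', SameVars l r r' → ρ r' = ρ r
  mono {l l' : ℕ} {ρ : (ℕ → ℕ) → Γ} : IsRead l ρ → l ≤ l' → IsRead l' ρ

/-- The base context holds only the input size. Requiring `0 < l` puts register 0, on which all time
bounds depend, among the preserved variables. -/
instance : Ctx ℕ where
  size := id
  IsRead l ρ := 0 < l ∧ ∀ r, ρ r = r 0
  pos h := h.1
  size_read h := h.2
  congr h r r' hr := by rw [h.2, h.2]; exact hr 0 h.1
  mono h hl := ⟨h.1.trans_le hl, h.2⟩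

/-- Each enclosing loop extends the context by its counter, so a loop body is a function of nested
pairs. -/
instance {Γ : Type} [Ctx Γ] : Ctx (Γ × ℕ) where
  size g := Ctx.size g.1
  IsRead l ρ := Ctx.IsRead l (fun r => (ρ r).1) ∧ ∃ v < l, ∀ r, (ρ r).2 = r (2 * v)
  pos h := Ctx.pos h.1
  size_read h := Ctx.size_read h.1
  congr := by
    rintro l ρ ⟨h, v, hv, h'⟩ r r' hr
    exact Prod.ext (Ctx.congr h r r' hr) (by rw [h', h', hr v hv])
  mono := by
    rintro l l' ρ ⟨h, v, hv, h'⟩ hl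
    exact ⟨Ctx.mono h hl, v, hv.trans_le hl, h'⟩

/-- The common bound of all loops. -/
def bound {Γ : Type} [Ctx Γ] (g : Γ) : ℕ := 2 * Ctx.size g + 1

@[simp] theorem bound_prod {Γ : Type} [Ctx Γ] (g : Γ × ℕ) : bound g = bound g.1 := rfl

section Library

variable {Γ : Type} [Ctx Γ]

/-- The function `f` of the variables and the arrays can be computed in polynomial time, for every
`d` by a program that leaves its result in the intermediate register `d` and preserves the arrays,
the variables and the intermediate registers below `d`. -/
def Computes (f : Γ → Arr → ℕ) : Prop :=
  ∀ (d l : ℕ) (ρ : (ℕ → ℕ) → Γ), Ctx.IsRead l ρ →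
    ∃ (p : Prog) (T : Polynomial ℕ), ∀ s : State, ∃ (t : ℕ) (s' : State),
      Exec p s t s' ∧ t ≤ T.eval (s.reg 0) ∧ s'.arr = s.arr ∧
      s'.reg (2 * d + 1) = f (ρ s.reg) s.arr ∧ SameVars l s.reg s'.reg ∧
      ∀ j < d, s'.reg (2 * j + 1) = s.reg (2 * j + 1)

/-- The memory transformation `F` can be carried out in polynomial time, by a program that
preserves the variables. -/
def Executes (F : Γ → Arr → Arr) : Prop :=
  ∀ (l : ℕ) (ρ : (ℕ → ℕ) → Γ), Ctx.IsRead l ρ →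
    ∃ (p : Prog) (T : Polynomial ℕ), ∀ s : State, ∃ (t : ℕ) (s' : State),
      Exec p s t s' ∧ t ≤ T.eval (s.reg 0) ∧ s'.arr = F (ρ s.reg) s.arr ∧
      SameVars l s.reg s'.reg

theorem State.setReg_reg (s : State) (r x r' : ℕ) :
    (s.setReg r x).reg r' = if r' = r then x else s.reg r' := by
  simp [State.setReg, Function.update_apply]

@[simp] theorem State.setReg_arr (s : State) (r x : ℕ) : (s.setReg r x).arr = s.arr := rfl

theorem sameVars_setReg_odd (l : ℕ) (s : State) (d x : ℕ) :
    SameVars l s.reg (s.setReg (2 * d + 1) x).reg := by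
  intro v _
  rw [State.setReg_reg, if_neg (by omega)]

theorem sameVars_setReg_even {l l' : ℕ} (h : l ≤ l') (s : State) (x : ℕ) :
    SameVars l s.reg (s.setReg (2 * l') x).reg := by
  intro v _
  rw [State.setReg_reg, if_neg (by omega)]

/-- A loop with a counter: `I i` holds after `i` rounds. -/
theorem exec_loop {x : Expr} {p : Prog} (I : ℕ → State → Prop) {N b : ℕ}
    (hx : ∀ i ≤ N, ∀ s, I i s → x.val s = N - i)
    (hp : ∀ i < N, ∀ s, I i s → ∃ t s', Exec p s t s' ∧ t ≤ b ∧ I (i + 1) s') {s : State}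
    (hs : I 0 s) :
    ∃ t s', Exec (.loop x p) s t s' ∧ t ≤ N * (b + x.steps + 1) + x.steps + 1 ∧ I N s' := by
  have key : ∀ m i, i + m = N → ∀ s, I i s → ∃ t s', Exec (.loop x p) s t s' ∧
      t ≤ m * (b + x.steps + 1) + x.steps + 1 ∧ I N s' := by
    intro m
    induction m with
    | zero =>
      intro i hi s hs
      obtain rfl : i = N := by omega
      exact ⟨_, _, Exec.loop_stop (by rw [hx i le_rfl s hs]; omega), by omega, hs⟩
    | succ m ih =>
      intro i hi s hs
      obtain ⟨t, s', h, ht, hs'⟩ := hp i (by omega) s hs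
      obtain ⟨t', s'', h', ht', hs''⟩ := ih (i + 1) (by omega) s' hs'
      refine ⟨_, _, .loop_step (by rw [hx i (by omega) s hs]; omega) h h', ?_, hs''⟩
      rw [Nat.succ_mul]
      omega
  exact key N 0 (by omega) s hs

/-- The machine expression for the remaining number of rounds, with the variable `l` counting. -/
def countdown (l : ℕ) : Expr :=
  .sub (.add (.add (.reg 0) (.reg 0)) (.const 1)) (.reg (2 * l))

/-! ### Closure properties of polynomial-time functions -/

namespace Computes

/-- A function that can be read off by a machine expression. -/
theorem of_expr {f : Γ → Arr → ℕ}
    (h : ∀ l (ρ : (ℕ → ℕ) → Γ), Ctx.IsRead l ρ → ∃ e : Expr, ∀ s : State,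
      e.val s = f (ρ s.reg) s.arr) : Computes f := by
  intro d l ρ hρ
  obtain ⟨e, he⟩ := h l ρ hρ
  refine ⟨.assign (2 * d + 1) e, Polynomial.C (e.steps + 1), fun s =>
    ⟨_, _, .assign s _ e, by simp, rfl, ?_, sameVars_setReg_odd l s d _, fun j hj => ?_⟩⟩
  · rw [State.setReg_reg, if_pos rfl, he]
  · rw [State.setReg_reg, if_neg (by omega)]

theorem const (c : ℕ) : Computes (fun (_ : Γ) _ => c) :=
  of_expr fun _ _ _ => ⟨.const c, fun _ => rfl⟩

theorem size : Computes (fun (g : Γ) _ => Ctx.size g) :=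
  of_expr fun _ _ hρ => ⟨.reg 0, fun s => (Ctx.size_read hρ s.reg).symm⟩

theorem last : Computes (fun (g : Γ × ℕ) _ => g.2) :=
  of_expr fun _ _ ⟨_, v, _, h⟩ => ⟨.reg (2 * v), fun s => (h s.reg).symm⟩

theorem weaken {f : Γ → Arr → ℕ} (hf : Computes f) : Computes (fun (g : Γ × ℕ) A => f g.1 A) :=
  fun d l _ hρ => hf d l _ hρ.1

/-- Apply a machine expression to a computed value. -/
theorem map {f : Γ → Arr → ℕ} (hf : Computes f) (op : Arr → ℕ → ℕ)
    (h : ∀ r : ℕ, ∃ e : Expr, ∀ s : State, e.val s = op s.arr (s.reg r)) :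
    Computes (fun g A => op A (f g A)) := by
  intro d l ρ hρ
  obtain ⟨p, T, hp⟩ := hf d l ρ hρ
  obtain ⟨e, he⟩ := h (2 * d + 1)
  refine ⟨.seq p (.assign (2 * d + 1) e), T + Polynomial.C (e.steps + 1), fun s => ?_⟩
  obtain ⟨t, s', h, ht, ha, hr, hv, hd⟩ := hp s
  refine ⟨_, _, .seq h (.assign _ _ _), by simpa using ht, by simpa using ha, ?_,
    hv.trans (sameVars_setReg_odd l s' d _), fun j hj => ?_⟩
  · rw [State.setReg_reg, if_pos rfl, he, hr, ha]
  · rw [State.setReg_reg, if_neg (by omega), hd j hj]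

theorem arr (a : ℕ) {f : Γ → Arr → ℕ} (hf : Computes f) : Computes (fun g A => A a (f g A)) :=
  hf.map (fun A x => A a x) fun r => ⟨.get a (.reg r), fun _ => rfl⟩

/-- Combine two computed values by a machine expression. -/
theorem map₂ {f f' : Γ → Arr → ℕ} (hf : Computes f) (hf' : Computes f') (op : ℕ → ℕ → ℕ)
    (h : ∀ r r' : ℕ, ∃ e : Expr, ∀ s : State, e.val s = op (s.reg r) (s.reg r')) :
    Computes (fun g A => op (f g A) (f' g A)) := by
  intro d l ρ hρ
  obtain ⟨p, T, hp⟩ := hf d l ρ hρ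
  -- One level higher, so that the first operand survives in register `2 * d + 1`.
  obtain ⟨p', T', hp'⟩ := hf' (d + 1) l ρ hρ
  obtain ⟨e, he⟩ := h (2 * d + 1) (2 * (d + 1) + 1)
  refine ⟨.seq p (.seq p' (.assign (2 * d + 1) e)), T + (T' + Polynomial.C (e.steps + 1)),
    fun s => ?_⟩
  obtain ⟨t, s', h, ht, ha, hr, hv, hd⟩ := hp s
  obtain ⟨t', s'', h', ht', ha', hr', hv', hd'⟩ := hp' s'
  rw [hv 0 (Ctx.pos hρ)] at ht'
  refine ⟨_, _, .seq h (.seq h' (.assign _ _ _)), ?_, by simp [ha, ha'], ?_,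
    hv.trans (hv'.trans (sameVars_setReg_odd l s'' d _)), fun j hj => ?_⟩
  · simp only [Polynomial.eval_add, Polynomial.eval_C]
    simp only [mul_zero] at ht'
    omega
  · rw [State.setReg_reg, if_pos rfl, he, hr', hd' d (by omega), hr, ha, Ctx.congr hρ _ _ hv]
  · rw [State.setReg_reg, if_neg (by omega), hd' j (by omega), hd j hj]

theorem add {f f' : Γ → Arr → ℕ} (hf : Computes f) (hf' : Computes f') :
    Computes (fun g A => f g A + f' g A) :=
  hf.map₂ hf' (· + ·) fun r r' => ⟨.add (.reg r) (.reg r'), fun _ => rfl⟩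

theorem sub {f f' : Γ → Arr → ℕ} (hf : Computes f) (hf' : Computes f') :
    Computes (fun g A => f g A - f' g A) :=
  hf.map₂ hf' (· - ·) fun r r' => ⟨.sub (.reg r) (.reg r'), fun _ => rfl⟩

theorem ite_ne_zero {c f f' : Γ → Arr → ℕ} (hc : Computes c) (hf : Computes f)
    (hf' : Computes f') : Computes (fun g A => if c g A ≠ 0 then f g A else f' g A) := by
  intro d l ρ hρ
  obtain ⟨p, T, hp⟩ := hf d l ρ hρ
  obtain ⟨p', T', hp'⟩ := hf' d l ρ hρ
  obtain ⟨q, S, hq⟩ := hc d l ρ hρ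
  refine ⟨.seq q (.cond (.reg (2 * d + 1)) p p'), S + (2 + T + T'), fun s => ?_⟩
  obtain ⟨t, s', h, ht, ha, hr, hv, hd⟩ := hq s
  have h0 := hv 0 (Ctx.pos hρ)
  simp only [mul_zero] at h0
  by_cases hcs : c (ρ s.reg) s.arr ≠ 0
  · obtain ⟨t', s'', h', ht', ha', hr', hv', hd'⟩ := hp s'
    refine ⟨_, _, .seq h (.cond_true (by simpa [Expr.val, hr] using hcs) h'), ?_, by simp [ha, ha'],
      ?_, hv.trans hv', fun j hj => (hd' j hj).trans (hd j hj)⟩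
    · rw [h0] at ht'
      simp only [Polynomial.eval_add, Polynomial.eval_ofNat, Expr.steps]
      omega
    · beta_reduce
      rw [if_pos hcs, hr', ha, Ctx.congr hρ _ _ hv]
  · obtain ⟨t', s'', h', ht', ha', hr', hv', hd'⟩ := hp' s'
    refine ⟨_, _, .seq h (.cond_false (by simpa [Expr.val, hr] using hcs) h'), ?_,
      by simp [ha, ha'], ?_, hv.trans hv', fun j hj => (hd' j hj).trans (hd j hj)⟩
    · rw [h0] at ht'
      simp only [Polynomial.eval_add, Polynomial.eval_ofNat, Expr.steps]
      omega
    · beta_reduce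
      rw [if_neg hcs, hr', ha, Ctx.congr hρ _ _ hv]

theorem sum {f : Γ × ℕ → Arr → ℕ} (hf : Computes f) :
    Computes (fun g A => ∑ i ∈ range (bound g), f (g, i) A) := by
  intro d l ρ hρ
  -- The fresh variable `l` is the counter, and intermediate register `d` accumulates the sum while
  -- the summand is computed at level `d + 1`.
  obtain ⟨p, T, hp⟩ := hf (d + 1) (l + 1) (fun r => (ρ r, r (2 * l)))
    ⟨Ctx.mono hρ (Nat.le_succ l), l, Nat.lt_succ_self l, fun _ => rfl⟩
  refine ⟨.seq (.assign (2 * d + 1) (.const 0)) (.seq (.assign (2 * l) (.const 0))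
    (.loop (countdown l) (.seq p
      (.seq (.assign (2 * d + 1) (.add (.reg (2 * d + 1)) (.reg (2 * (d + 1) + 1))))
        (.assign (2 * l) (.add (.reg (2 * l)) (.const 1))))))),
    -- Initialization takes 4 steps. A round takes the body, 8 steps for the two assignments and 8
    -- for the test; the final test takes 8 again.
    4 + ((2 * Polynomial.X + 1) * (T + 16) + 8), fun s => ?_⟩
  have hl := Ctx.pos hρ
  have hb : bound (ρ s.reg) = 2 * s.reg 0 + 1 := by rw [bound, Ctx.size_read hρ]
  let I : ℕ → State → Prop := fun i s' => s'.arr = s.arr ∧ SameVars l s.reg s'.reg ∧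
    s'.reg (2 * l) = i ∧ s'.reg (2 * d + 1) = ∑ k ∈ range i, f (ρ s.reg, k) s.arr ∧
    ∀ j < d, s'.reg (2 * j + 1) = s.reg (2 * j + 1)
  obtain ⟨t, s', h, ht, ha, hv, -, hr, hd⟩ := exec_loop (x := countdown l) (p := .seq p
      (.seq (.assign (2 * d + 1) (.add (.reg (2 * d + 1)) (.reg (2 * (d + 1) + 1))))
        (.assign (2 * l) (.add (.reg (2 * l)) (.const 1))))) I (N := 2 * s.reg 0 + 1)
      (b := T.eval (s.reg 0) + 8) (s := (s.setReg (2 * d + 1) 0).setReg (2 * l) 0)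
      (by
        rintro i hi s' ⟨-, hv, hi', -, -⟩
        have h0 := hv 0 hl
        simp only [mul_zero] at h0
        simp only [countdown, Expr.val, hi', h0]
        omega)
      (by
        rintro i hi s' ⟨ha, hv, hi', hr, hd⟩
        obtain ⟨t, s'', h, ht, ha', hr', hv', hd'⟩ := hp s'
        have h0 := hv 0 hl
        simp only [mul_zero] at h0
        rw [h0] at ht
        refine ⟨_, _, .seq h (.seq (.assign _ _ _) (.assign _ _ _)), ?_, ?_, ?_, ?_, ?_, ?_⟩
        · simp only [Expr.steps]
          omega
        · simp [ha, ha']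
        · exact hv.trans ((hv'.mono (Nat.le_succ l)).trans ((sameVars_setReg_odd _ _ _ _).trans
            (sameVars_setReg_even le_rfl _ _)))
        · rw [State.setReg_reg, if_pos rfl]
          simp only [Expr.val]
          rw [State.setReg_reg, if_neg (by omega), hv' l (Nat.lt_succ_self l), hi']
        · rw [State.setReg_reg, if_neg (by omega), State.setReg_reg, if_pos rfl]
          simp only [Expr.val]
          rw [hr', hd' d (Nat.lt_succ_self d), hr, Finset.sum_range_succ, ha, hi',
            Ctx.congr hρ _ _ hv]
        · intro j hj
          rw [State.setReg_reg, if_neg (by omega), State.setReg_reg, if_neg (by omega),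
            hd' j (by omega), hd j hj])
      (by
        refine ⟨rfl, (sameVars_setReg_odd l s d _).trans (sameVars_setReg_even le_rfl _ _), ?_, ?_,
          fun j hj => ?_⟩
        · rw [State.setReg_reg, if_pos rfl]
        · rw [State.setReg_reg, if_neg (by omega), State.setReg_reg, if_pos rfl]
          simp
        · rw [State.setReg_reg, if_neg (by omega), State.setReg_reg, if_neg (by omega)])
  refine ⟨_, _, .seq (.assign _ _ _) (.seq (.assign _ _ _) h), ?_, ha, by beta_reduce; rw [hr, hb], hv, hd⟩
  simp only [Expr.steps, countdown] at ht ⊢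
  simp only [Polynomial.eval_add, Polynomial.eval_mul, Polynomial.eval_ofNat, Polynomial.eval_X,
    Polynomial.eval_one]
  have : (2 * s.reg 0 + 1) * (T.eval (s.reg 0) + 8 + (1 + 1 + 1 + 1 + 1 + 1 + 1) + 1) ≤
    (2 * s.reg 0 + 1) * (T.eval (s.reg 0) + 16) := Nat.mul_le_mul_left _ (by omega)
  omega

end Computes

/-! ### Closure properties of polynomial-time memory transformations -/

namespace Executes

theorem store (a : ℕ) {i f : Γ → Arr → ℕ} (hi : Computes i) (hf : Computes f) :
    Executes (fun g A => Function.update A a (Function.update (A a) (i g A) (f g A))) := by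
  intro l ρ hρ
  obtain ⟨p, T, hp⟩ := hi 0 l ρ hρ
  obtain ⟨p', T', hp'⟩ := hf 1 l ρ hρ
  refine ⟨.seq p (.seq p' (.store a (.reg 1) (.reg 3))), T + (T' + 3), fun s => ?_⟩
  obtain ⟨t, s', h, ht, ha, hr, hv, hd⟩ := hp s
  obtain ⟨t', s'', h', ht', ha', hr', hv', hd'⟩ := hp' s'
  have h0 := hv 0 (Ctx.pos hρ)
  simp only [mul_zero] at h0
  rw [h0] at ht'
  have hd0 := hd' 0 one_pos
  simp only [mul_zero, zero_add, mul_one, Nat.reduceAdd] at hr hr' hd0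
  refine ⟨_, _, .seq h (.seq h' (.store _ _ _ _)), ?_, ?_, hv.trans hv'⟩
  · simp only [Polynomial.eval_add, Polynomial.eval_ofNat, Expr.steps]
    omega
  · simp only [State.setArr, Expr.val]
    rw [hr', hd0, hr, ha', ha, Ctx.congr hρ _ _ hv]

theorem seq {F F' : Γ → Arr → Arr} (hF : Executes F) (hF' : Executes F') :
    Executes (fun g A => F' g (F g A)) := by
  intro l ρ hρ
  obtain ⟨p, T, hp⟩ := hF l ρ hρ
  obtain ⟨p', T', hp'⟩ := hF' l ρ hρ
  refine ⟨.seq p p', T + T', fun s => ?_⟩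
  obtain ⟨t, s', h, ht, ha, hv⟩ := hp s
  obtain ⟨t', s'', h', ht', ha', hv'⟩ := hp' s'
  have h0 := hv 0 (Ctx.pos hρ)
  simp only [mul_zero] at h0
  rw [h0] at ht'
  refine ⟨_, _, .seq h h', ?_, ?_, hv.trans hv'⟩
  · simp only [Polynomial.eval_add]
    omega
  · rw [ha', ha, Ctx.congr hρ _ _ hv]

theorem ite_ne_zero {c : Γ → Arr → ℕ} {F : Γ → Arr → Arr} (hc : Computes c) (hF : Executes F) :
    Executes (fun g A => if c g A ≠ 0 then F g A else A) := by
  intro l ρ hρ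
  obtain ⟨q, S, hq⟩ := hc 0 l ρ hρ
  obtain ⟨p, T, hp⟩ := hF l ρ hρ
  refine ⟨.seq q (.cond (.reg 1) p .skip), S + (3 + T), fun s => ?_⟩
  obtain ⟨t, s', h, ht, ha, hr, hv, hd⟩ := hq s
  have h0 := hv 0 (Ctx.pos hρ)
  simp only [mul_zero, zero_add] at h0 hr
  by_cases hcs : c (ρ s.reg) s.arr ≠ 0
  · obtain ⟨t', s'', h', ht', ha', hv'⟩ := hp s'
    rw [h0] at ht'
    refine ⟨_, _, .seq h (.cond_true (by simpa [Expr.val, hr] using hcs) h'), ?_, ?_,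
      hv.trans hv'⟩
    · simp only [Polynomial.eval_add, Polynomial.eval_ofNat, Expr.steps]
      omega
    · beta_reduce
      rw [if_pos hcs, ha', ha, Ctx.congr hρ _ _ hv]
  · refine ⟨_, _, .seq h (.cond_false (by simpa [Expr.val, hr] using hcs) (.skip _)), ?_, ?_, hv⟩
    · simp only [Polynomial.eval_add, Polynomial.eval_ofNat, Expr.steps]
      omega
    · beta_reduce
      rw [if_neg hcs, ha]

end Executes

/-- The memory after the first `m` rounds of a loop. -/
def iter (F : ℕ → Arr → Arr) : ℕ → Arr → Arr
  | 0, A => A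
  | m + 1, A => F m (iter F m A)

theorem Executes.loop {F : Γ × ℕ → Arr → Arr} (hF : Executes F) :
    Executes (fun g A => iter (fun i => F (g, i)) (bound g) A) := by
  intro l ρ hρ
  obtain ⟨p, T, hp⟩ := hF (l + 1) (fun r => (ρ r, r (2 * l)))
    ⟨Ctx.mono hρ (Nat.le_succ l), l, Nat.lt_succ_self l, fun _ => rfl⟩
  refine ⟨.seq (.assign (2 * l) (.const 0))
    (.loop (countdown l) (.seq p (.assign (2 * l) (.add (.reg (2 * l)) (.const 1))))),
    2 + ((2 * Polynomial.X + 1) * (T + 12) + 8), fun s => ?_⟩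
  have hl := Ctx.pos hρ
  have hb : bound (ρ s.reg) = 2 * s.reg 0 + 1 := by rw [bound, Ctx.size_read hρ]
  let I : ℕ → State → Prop := fun i s' => s'.arr = iter (fun i => F (ρ s.reg, i)) i s.arr ∧
    SameVars l s.reg s'.reg ∧ s'.reg (2 * l) = i
  obtain ⟨t, s', h, ht, ha, hv, -⟩ := exec_loop (x := countdown l)
      (p := .seq p (.assign (2 * l) (.add (.reg (2 * l)) (.const 1)))) I (N := 2 * s.reg 0 + 1)
      (b := T.eval (s.reg 0) + 4) (s := s.setReg (2 * l) 0)
      (by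
        rintro i hi s' ⟨-, hv, hi'⟩
        have h0 := hv 0 hl
        simp only [mul_zero] at h0
        simp only [countdown, Expr.val, hi', h0]
        omega)
      (by
        rintro i hi s' ⟨ha, hv, hi'⟩
        obtain ⟨t, s'', h, ht, ha', hv'⟩ := hp s'
        have h0 := hv 0 hl
        simp only [mul_zero] at h0
        rw [h0] at ht
        refine ⟨_, _, .seq h (.assign _ _ _), ?_, ?_, ?_, ?_⟩
        · simp only [Expr.steps]
          omega
        · rw [State.setReg_arr, ha', iter, ha, hi', Ctx.congr hρ _ _ hv]
        · exact hv.trans ((hv'.mono (Nat.le_succ l)).trans (sameVars_setReg_even le_rfl _ _))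
        · rw [State.setReg_reg, if_pos rfl]
          simp only [Expr.val]
          rw [hv' l (Nat.lt_succ_self l), hi'])
      ⟨rfl, sameVars_setReg_even le_rfl _ _, by rw [State.setReg_reg, if_pos rfl]⟩
  refine ⟨_, _, .seq (.assign _ _ _) h, ?_, by beta_reduce; rw [ha, hb], hv⟩
  simp only [Expr.steps, countdown] at ht ⊢
  simp only [Polynomial.eval_add, Polynomial.eval_mul, Polynomial.eval_ofNat, Polynomial.eval_X,
    Polynomial.eval_one]
  have : (2 * s.reg 0 + 1) * (T.eval (s.reg 0) + 4 + (1 + 1 + 1 + 1 + 1 + 1 + 1) + 1) ≤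
    (2 * s.reg 0 + 1) * (T.eval (s.reg 0) + 12) := Nat.mul_le_mul_left _ (by omega)
  omega

end Library

end FairCC

namespace FairCC

open Finset
open scoped Classical

/-! ### Decidable predicates, counting, multiplication and bounded search -/

section Derived

variable {Γ : Type} [Ctx Γ]

/-- The predicate `P` can be decided in polynomial time. -/
def Decides (P : Γ → Arr → Prop) : Prop :=
  Computes (fun g A => if P g A then 1 else 0)

theorem Decides.ite {P : Γ → Arr → Prop} {f f' : Γ → Arr → ℕ} (hP : Decides P)
    (hf : Computes f) (hf' : Computes f') :
    Computes (fun g A => if P g A then f g A else f' g A) := by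
  convert hP.ite_ne_zero hf hf' using 4 with g A
  by_cases h : P g A <;> simp [h]

/-- The decision procedure is left arbitrary, to match conditionals that were elaborated with a
non-classical instance. -/
theorem Decides.ite' {P : Γ → Arr → Prop} {inst : ∀ g A, Decidable (P g A)} {f f' : Γ → Arr → ℕ}
    (hP : Decides P) (hf : Computes f) (hf' : Computes f') :
    Computes (fun g A => @_root_.ite ℕ (P g A) (inst g A) (f g A) (f' g A)) := by
  convert hP.ite hf hf'

namespace Decides

theorem of_ne_zero {f : Γ → Arr → ℕ} (hf : Computes f) : Decides (fun g A => f g A ≠ 0) := by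
  unfold Decides
  convert hf.ite_ne_zero (.const 1) (.const 0)

theorem congr {P Q : Γ → Arr → Prop} (hP : Decides P) (h : ∀ g A, P g A ↔ Q g A) : Decides Q := by
  rwa [show Q = P from funext fun g => funext fun A => propext (h g A).symm]

theorem not {P : Γ → Arr → Prop} (hP : Decides P) : Decides (fun g A => ¬ P g A) :=
  (of_ne_zero (hP.ite (.const 0) (.const 1))).congr fun g A => by by_cases h : P g A <;> simp [h]

theorem and {P Q : Γ → Arr → Prop} (hP : Decides P) (hQ : Decides Q) :
    Decides (fun g A => P g A ∧ Q g A) :=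
  (of_ne_zero (hP.ite (hQ.ite (.const 1) (.const 0)) (.const 0))).congr fun g A => by
    by_cases h : P g A <;> simp [h]

theorem or {P Q : Γ → Arr → Prop} (hP : Decides P) (hQ : Decides Q) :
    Decides (fun g A => P g A ∨ Q g A) :=
  (hP.not.and hQ.not).not.congr fun g A => by tauto

theorem imp {P Q : Γ → Arr → Prop} (hP : Decides P) (hQ : Decides Q) :
    Decides (fun g A => P g A → Q g A) :=
  (hP.not.or hQ).congr fun g A => by tauto

theorem iff {P Q : Γ → Arr → Prop} (hP : Decides P) (hQ : Decides Q) :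
    Decides (fun g A => (P g A ↔ Q g A)) :=
  ((hP.imp hQ).and (hQ.imp hP)).congr fun g A => by tauto

theorem lt {f f' : Γ → Arr → ℕ} (hf : Computes f) (hf' : Computes f') :
    Decides (fun g A => f g A < f' g A) :=
  (of_ne_zero (hf'.sub hf)).congr fun g A => by omega

theorem le {f f' : Γ → Arr → ℕ} (hf : Computes f) (hf' : Computes f') :
    Decides (fun g A => f g A ≤ f' g A) :=
  (lt hf' hf).not.congr fun g A => by omega

theorem eq {f f' : Γ → Arr → ℕ} (hf : Computes f) (hf' : Computes f') :
    Decides (fun g A => f g A = f' g A) :=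
  ((le hf hf').and (le hf' hf)).congr fun g A => by omega

theorem ne {f f' : Γ → Arr → ℕ} (hf : Computes f) (hf' : Computes f') :
    Decides (fun g A => f g A ≠ f' g A) :=
  (eq hf hf').not

/-- A bounded quantifier holds exactly if the number of counterexamples, a computable sum, is zero.
-/
theorem all {P : Γ × ℕ → Arr → Prop} (hP : Decides P) :
    Decides (fun g A => ∀ i < bound g, P (g, i) A) :=
  (eq (Computes.sum (hP.ite (.const 0) (.const 1))) (.const 0)).congr fun g A => by
    simp [Finset.sum_eq_zero_iff]

end Decides

theorem Executes.ite {P : Γ → Arr → Prop} {inst : ∀ g A, Decidable (P g A)} {F : Γ → Arr → Arr}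
    (hP : Decides P) (hF : Executes F) :
    Executes (fun g A => @_root_.ite Arr (P g A) (inst g A) (F g A) A) := by
  convert Executes.ite_ne_zero hP hF using 4 with g A
  by_cases h : P g A <;> simp [h]

namespace Computes

theorem count {P : Γ × ℕ → Arr → Prop} (hP : Decides P) :
    Computes (fun g A => #{i ∈ range (bound g) | P (g, i) A}) := by
  simpa only [card_filter] using Computes.sum hP

/-- The number of `i < n` with a property, `n` being the size of the input. -/
theorem count_size {P : Γ × ℕ → Arr → Prop} (hP : Decides P) :
    Computes (fun g A => #{i ∈ range (Ctx.size g) | P (g, i) A}) := by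
  have := count (P := fun g A => g.2 < Ctx.size g.1 ∧ P g A) ((Decides.lt last size.weaken).and hP)
  convert this using 4 with g A
  ext i
  simp only [mem_filter, mem_range, bound]
  constructor
  · rintro ⟨h, h'⟩
    exact ⟨by omega, h, h'⟩
  · rintro ⟨_, h, h'⟩
    exact ⟨h, h'⟩

theorem count' {P : Γ × ℕ → Arr → Prop} {inst : ∀ g A i, Decidable (P (g, i) A)}
    (hP : Decides P) :
    Computes (fun g A => #(@filter ℕ (fun i => P (g, i) A) (fun i => inst g A i)
      (range (bound g)))) := by
  convert count hP

/-- The number of `i < n` with a property, for any decision procedure. -/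
theorem count_size' {P : Γ × ℕ → Arr → Prop} {inst : ∀ g A i, Decidable (P (g, i) A)}
    (hP : Decides P) :
    Computes (fun g A => #(@filter ℕ (fun i => P (g, i) A) (fun i => inst g A i)
      (range (Ctx.size g)))) := by
  convert count_size hP

/-- Multiplication, if one of the factors is not too large. -/
theorem mul_min {f f' : Γ → Arr → ℕ} (hf : Computes f) (hf' : Computes f') :
    Computes (fun g A => f g A * min (f' g A) (bound g)) := by
  have := Computes.sum ((Decides.lt last hf'.weaken).ite hf.weaken (const 0))
  convert this using 3 with g A
  have h : {i ∈ range (bound g) | i < f' g A} = range (min (f' g A) (bound g)) := by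
    ext i
    simp [and_comm]
  simp only [sum_ite, sum_const_zero, sum_const, h, card_range, smul_eq_mul, add_zero, mul_comm]

theorem mul {f f' : Γ → Arr → ℕ} (hf : Computes f) (hf' : Computes f')
    (h : ∀ g A, f' g A ≤ bound g) : Computes (fun g A => f g A * f' g A) := by
  convert hf.mul_min hf' using 4 with g A
  rw [min_eq_left (h g A)]

theorem mul_bound {f : Γ → Arr → ℕ} (hf : Computes f) :
    Computes (fun g A => f g A * bound g) := by
  have : Computes (fun (g : Γ) _ => bound g) := by
    simpa only [bound, two_mul] using (size.add size).add (const 1)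
  exact hf.mul this fun _ _ => le_rfl

theorem mul_size {f : Γ → Arr → ℕ} (hf : Computes f) :
    Computes (fun g A => f g A * Ctx.size g) :=
  hf.mul size fun g _ => by rw [bound]; omega

/-- Access to an array as to a matrix in row-major order. -/
theorem entry (a : ℕ) {f f' : Γ → Arr → ℕ} (hf : Computes f) (hf' : Computes f') :
    Computes (fun g A => A a (f g A * bound g + f' g A)) :=
  (hf.mul_bound.add hf').arr a

end Computes

/-- The first number below `N` with the property `P`. -/
noncomputable def first (N : ℕ) (P : ℕ → Prop) : ℕ :=
  #{i ∈ range N | ∀ j < N, j ≤ i → ¬ P j}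

/-- The indices counted by `first` are exactly those below the least witness, so their number is
that witness. -/
theorem first_spec {N : ℕ} {P : ℕ → Prop} (h : ∃ i < N, P i) : first N P < N ∧ P (first N P) := by
  have hi := (Nat.find_spec h)
  have : first N P = Nat.find h := by
    rw [first, show {i ∈ range N | ∀ j < N, j ≤ i → ¬ P j} = range (Nat.find h) from ?_, card_range]
    ext i
    simp only [mem_filter, mem_range, Nat.lt_find_iff]
    constructor
    · rintro ⟨_, h'⟩ m hm ⟨hmN, hP⟩
      exact h' m hmN hm hP
    · intro h'
      refine ⟨?_, fun j hj hji hP => h' j hji ⟨hj, hP⟩⟩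
      by_contra hN
      exact h' _ (by omega) hi
  rw [this]
  exact hi

theorem Computes.first {P : Γ × ℕ → Arr → Prop} (hP : Decides P) :
    Computes (fun g A => first (bound g) fun i => P (g, i) A) := by
  have h : Decides (fun (g : Γ × ℕ) A => ∀ j < bound g, j ≤ g.2 → ¬ P (g.1, j) A) := by
    refine Decides.all (P := fun (g : (Γ × ℕ) × ℕ) A => g.2 ≤ g.1.2 → ¬ P (g.1.1, g.2) A)
      ((Decides.le last last.weaken).imp (Decides.not ?_))
    -- `P` is read in the context that forgets the middle variable; the program is the same, only
    -- the way to read the registers changes.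
    intro d l ρ hρ
    exact hP d l (fun r => ((ρ r).1.1, (ρ r).2)) ⟨hρ.1.1, hρ.2⟩
  convert Computes.count h using 4 with g A
  simp only [FairCC.first, bound_prod]
  congr

/-! ### Filling an array -/

/-- The memory with the first `N` entries of the array `a` replaced by the values of `f`. -/
def fill (a N : ℕ) (f : ℕ → ℕ) (A : Arr) : Arr :=
  Function.update A a fun m => if m < N then f m else A a m

theorem fill_of_ne {a b : ℕ} (h : b ≠ a) (N : ℕ) (f : ℕ → ℕ) (A : Arr) : fill a N f A b = A b := by
  simp [fill, h]

theorem fill_self {a N : ℕ} {f : ℕ → ℕ} {A : Arr} {m : ℕ} (h : m < N) : fill a N f A a m = f m := by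
  simp [fill, h]

/-- The memory with the array `a` replaced by the `N × N` matrix `f`, in row-major order. -/
def fillMatrix (a N : ℕ) (f : ℕ → ℕ → ℕ) (A : Arr) : Arr :=
  fill a (N * N) (fun m => f (m / N) (m % N)) A

theorem fillMatrix_of_ne {a b : ℕ} (h : b ≠ a) (N : ℕ) (f : ℕ → ℕ → ℕ) (A : Arr) :
    fillMatrix a N f A b = A b := fill_of_ne h _ _ _

theorem entry_lt {N i j : ℕ} (hi : i < N) (hj : j < N) : i * N + j < N * N := by
  nlinarith [Nat.mul_le_mul_right N (Nat.succ_le_of_lt hi)]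

theorem entry_inj {N i j i' j' : ℕ} (hj : j < N) (hj' : j' < N) :
    i * N + j = i' * N + j' ↔ i = i' ∧ j = j' := by
  constructor
  · intro h
    have h1 : (i * N + j) % N = (i' * N + j') % N := by rw [h]
    rw [mul_comm i, mul_comm i', Nat.mul_add_mod, Nat.mul_add_mod, Nat.mod_eq_of_lt hj,
      Nat.mod_eq_of_lt hj'] at h1
    subst h1
    exact ⟨Nat.eq_of_mul_eq_mul_right (by omega : 0 < N) (by omega), rfl⟩
  · rintro ⟨rfl, rfl⟩
    rfl

theorem fillMatrix_self {a N : ℕ} {f : ℕ → ℕ → ℕ} {A : Arr} {i j : ℕ} (hi : i < N) (hj : j < N) :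
    fillMatrix a N f A a (i * N + j) = f i j := by
  rw [fillMatrix, fill_self (entry_lt hi hj), mul_comm, Nat.mul_add_div (by omega),
    Nat.mul_add_mod, Nat.div_eq_of_lt hj, Nat.mod_eq_of_lt hj, add_zero]

/-- The value of `f` does not depend on the array `a`. -/
def Ignores (a : ℕ) (f : Γ → Arr → ℕ) : Prop :=
  ∀ g A B, (∀ b, b ≠ a → A b = B b) → f g A = f g B

/-- The loop evaluates `f` on a partially overwritten memory; `Ignores` makes these values those of
the original memory. -/
theorem Executes.fill (a : ℕ) {f : Γ × ℕ → Arr → ℕ} (hf : Computes f) (ha : Ignores a f) :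
    Executes (fun g A => fill a (bound g) (fun i => f (g, i) A) A) := by
  convert Executes.loop (Executes.store a .last hf) using 3 with g A
  have key : ∀ m, iter (fun i A => Function.update A a (Function.update (A a) i (f (g, i) A))) m A
      = FairCC.fill a m (fun i => f (g, i) A) A := by
    intro m
    induction m with
    | zero => simp [iter, FairCC.fill]
    | succ m ih =>
      rw [iter, ih, ha (g, m) _ A fun b hb => fill_of_ne hb _ _ _]
      funext b
      by_cases hb : b = a
      · subst hb
        funext i
        simp only [FairCC.fill, Function.update_self, Function.update_apply]
        split_ifs with h1 h2 h3 h3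
        · rw [h1]
        · omega
        · rfl
        · omega
        · omega
        · rfl
      · simp [FairCC.fill, hb]
  exact (key _).symm

theorem Executes.fillMatrix (a : ℕ) {f : (Γ × ℕ) × ℕ → Arr → ℕ} (hf : Computes f)
    (ha : Ignores a f) :
    Executes (fun g A => fillMatrix a (bound g) (fun i j => f ((g, i), j) A) A) := by
  convert Executes.loop (Executes.loop
    (Executes.store a (Computes.last.weaken.mul_bound.add Computes.last) hf)) using 3 with g A
  have row : ∀ (i : ℕ) (A : Arr) (m : ℕ), iter (fun j A => Function.update A a
      (Function.update (A a) (i * bound g + j) (f ((g, i), j) A))) m A =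
      Function.update A a fun k => if i * bound g ≤ k ∧ k < i * bound g + m then
        f ((g, i), k - i * bound g) A else A a k := by
    intro i A m
    induction m with
    | zero =>
      simp only [iter, add_zero]
      rw [eq_comm, Function.update_eq_self_iff]
      funext k
      rw [if_neg (by omega)]
    | succ m ih =>
      rw [iter, ih, ha ((g, i), m) _ A fun b hb => Function.update_of_ne hb _ _]
      funext b
      by_cases hb : b = a
      · subst hb
        funext k
        simp only [Function.update_self, Function.update_apply]
        split_ifs with h1 h2 h3 h3
        · rw [h1, Nat.add_sub_cancel_left]
        · omega
        · rfl
        · omega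
        · omega
        · rfl
      · simp [hb]
  have hN : 0 < bound g := by rw [bound]; omega
  -- After `m` rows exactly the entries below `m * bound g` are replaced, and division with
  -- remainder recovers row and column.
  have key : ∀ m, iter (fun i A => iter (fun j A => Function.update A a
      (Function.update (A a) (i * bound g + j) (f ((g, i), j) A))) (bound g) A) m A
      = Function.update A a fun k => if k < m * bound g then
        f ((g, k / bound g), k % bound g) A else A a k := by
    intro m
    induction m with
    | zero => simp [iter]
    | succ m ih =>
      rw [iter, ih, row]
      funext b
      by_cases hb : b = a
      · subst hb
        funext k
        simp only [Function.update_self, Nat.succ_mul]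
        by_cases h1 : k < m * bound g
        · rw [if_neg (by omega), if_pos h1, if_pos (by omega)]
        · by_cases h2 : k < m * bound g + bound g
          · rw [if_pos (by omega), if_pos h2]
            have hk : k / bound g = m :=
              Nat.div_eq_of_lt_le (by omega) (by rw [Nat.succ_mul]; omega)
            have hk' : k % bound g = k - m * bound g := by
              rw [← hk, mul_comm, Nat.mod_def]
            rw [hk, hk']
            exact ha _ _ _ fun b hb => Function.update_of_ne hb _ _
          · rw [if_neg (by omega), if_neg h1, if_neg h2]
      · simp [hb]
  exact (key _).symm

end Derived

/-! ### Invariants of loops -/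

/-- A loop that preserves `I`, whose rounds relate the memory before and after by `R` and establish
properties `P` that `R` preserves. -/
theorem iter_spec {F : ℕ → Arr → Arr} (I : Arr → Prop) (R : Arr → Arr → Prop)
    (P : ℕ → Arr → Prop) (hrefl : ∀ A, R A A) (htrans : ∀ A B C, R A B → R B C → R A C)
    (hP : ∀ i A B, P i A → R A B → P i B) {m : ℕ}
    (hF : ∀ i < m, ∀ A, I A → I (F i A) ∧ R A (F i A) ∧ P i (F i A)) {A : Arr} (hA : I A) :
    I (iter F m A) ∧ R A (iter F m A) ∧ ∀ i < m, P i (iter F m A) := by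
  induction m with
  | zero => exact ⟨hA, hrefl _, fun i hi => absurd hi (Nat.not_lt_zero i)⟩
  | succ m ih =>
    obtain ⟨h1, h2, h3⟩ := ih fun i hi => hF i (hi.trans (Nat.lt_succ_self m))
    obtain ⟨h4, h5, h6⟩ := hF m (Nat.lt_succ_self m) _ h1
    refine ⟨h4, htrans _ _ _ h2 h5, fun i hi => ?_⟩
    rcases Nat.lt_succ_iff_lt_or_eq.mp hi with h | rfl
    · exact hP _ _ _ (h3 i h) h5
    · exact h6

/-- A loop with an invariant. -/
theorem iter_induction {F : ℕ → Arr → Arr} (I : ℕ → Arr → Prop) {m : ℕ}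
    (hF : ∀ i < m, ∀ A, I i A → I (i + 1) (F i A)) {A : Arr} (hA : I 0 A) : I m (iter F m A) := by
  induction m with
  | zero => exact hA
  | succ m ih => exact hF m (Nat.lt_succ_self m) _ (ih fun i hi => hF i (hi.trans (Nat.lt_succ_self m)))

end FairCC

namespace FairCC

open Finset
open scoped Classical

/-! ### Correlation clustering: a maximal packing of bad triangles, then pivots -/

/-- The ordered pairs of different points below `n` on which two relations disagree. -/
noncomputable def disagree (n : ℕ) (r r' : ℕ → ℕ → Prop) : Finset (ℕ × ℕ) :=
  {q ∈ range n ×ˢ range n | q.1 ≠ q.2 ∧ ¬ (r q.1 q.2 ↔ r' q.1 q.2)}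

theorem mem_disagree {n : ℕ} {r r' : ℕ → ℕ → Prop} {q : ℕ × ℕ} :
    q ∈ disagree n r r' ↔ (q.1 < n ∧ q.2 < n) ∧ q.1 ≠ q.2 ∧ ¬ (r q.1 q.2 ↔ r' q.1 q.2) := by
  simp [disagree]

theorem disagree_comm (n : ℕ) (r r' : ℕ → ℕ → Prop) : disagree n r r' = disagree n r' r := by
  ext q
  simp only [mem_disagree]
  tauto

/-- Disagreement is a symmetric difference; this triangle inequality links graph, flipped graph and
clusterings. -/
theorem card_disagree_triangle (n : ℕ) (r r' r'' : ℕ → ℕ → Prop) :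
    #(disagree n r r'') ≤ #(disagree n r r') + #(disagree n r' r'') := by
  refine (card_le_card fun q hq => ?_).trans (card_union_le _ _)
  simp only [mem_union, mem_disagree] at hq ⊢
  tauto

/-- Two points have the same label. -/
def SameLabel (L : ℕ → ℕ) (u v : ℕ) : Prop := L u = L v

/-- Exactly two of the three pairs in a triangle are related. -/
def Bad (r : ℕ → ℕ → Prop) (x y z : ℕ) : Prop :=
  (x ≠ y ∧ x ≠ z ∧ y ≠ z) ∧
    ((r x y ∧ r x z ∧ ¬ r y z) ∨ (r x y ∧ ¬ r x z ∧ r y z) ∨ (¬ r x y ∧ r x z ∧ r y z))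

theorem Bad.swap {r : ℕ → ℕ → Prop} (hr : ∀ x y, r x y → r y x) {x y z : ℕ} (h : Bad r x y z) :
    Bad r y x z := by
  have := hr x y
  have := hr y x
  unfold Bad at *
  tauto

theorem Bad.swap' {r : ℕ → ℕ → Prop} (hr : ∀ x y, r x y → r y x) {x y z : ℕ} (h : Bad r x y z) :
    Bad r x z y := by
  have := hr z y
  have := hr y z
  unfold Bad at *
  tauto

theorem card_filter_product (S T : Finset ℕ) (P : ℕ → ℕ → Prop)
    [∀ x y, Decidable (P x y)] : #{q ∈ S ×ˢ T | P q.1 q.2} = ∑ x ∈ S, #{y ∈ T | P x y} := by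
  simp only [card_filter, sum_product]

/-- If every bad triangle meets `D`, there is a pivot whose bad triangles are paid for by the
opposite edges in `D`. -/
theorem exists_pivot {R : Finset ℕ} (hR : R.Nonempty) {r D : ℕ → ℕ → Prop}
    (hr : ∀ x y, r x y → r y x)
    (hD : ∀ x ∈ R, ∀ y ∈ R, ∀ z ∈ R, Bad r x y z → D x y ∨ D x z ∨ D y z) :
    ∃ p ∈ R, #{q ∈ R ×ˢ R | Bad r p q.1 q.2} ≤
      3 * #{q ∈ R ×ˢ R | Bad r p q.1 q.2 ∧ D q.1 q.2} := by
  -- Averaging: it is enough to compare the sums over all candidate pivots.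
  refine exists_le_of_sum_le hR ?_
  rw [← mul_sum]
  let S : Finset ((ℕ × ℕ) × ℕ) := {q ∈ (R ×ˢ R) ×ˢ R | Bad r q.1.1 q.1.2 q.2}
  let b : ℕ → ℕ → ℕ → ℕ := fun x y z => if Bad r x y z ∧ D y z then 1 else 0
  -- Each bad triple has an edge in `D`, and is charged to the vertex opposite to it. The three
  -- kinds of charges have equal sums by renaming variables, whence the factor 3.
  have h1 : ∀ x ∈ R, ∀ y ∈ R, ∀ z ∈ R,
      (if Bad r x y z then 1 else 0) ≤ b x y z + (b y x z + b z x y) := by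
    intro x hx y hy z hz
    by_cases h : Bad r x y z
    · rw [if_pos h]
      have h' := h.swap hr
      have h'' := (h.swap' hr).swap hr
      rcases hD x hx y hy z hz h with hd | hd | hd
      · have : b z x y = 1 := if_pos ⟨h'', hd⟩
        omega
      · have : b y x z = 1 := if_pos ⟨h', hd⟩
        omega
      · have : b x y z = 1 := if_pos ⟨h, hd⟩
        omega
    · rw [if_neg h]
      exact Nat.zero_le _
  simp only [card_filter, sum_product]
  calc ∑ x ∈ R, ∑ y ∈ R, ∑ z ∈ R, (if Bad r x y z then 1 else 0)
      ≤ ∑ x ∈ R, ∑ y ∈ R, ∑ z ∈ R, (b x y z + (b y x z + b z x y)) :=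
        sum_le_sum fun x hx => sum_le_sum fun y hy => sum_le_sum fun z hz => h1 x hx y hy z hz
    _ = ∑ x ∈ R, ∑ y ∈ R, ∑ z ∈ R, b x y z + (∑ x ∈ R, ∑ y ∈ R, ∑ z ∈ R, b y x z +
          ∑ x ∈ R, ∑ y ∈ R, ∑ z ∈ R, b z x y) := by simp only [sum_add_distrib]
    _ = 3 * ∑ x ∈ R, ∑ y ∈ R, ∑ z ∈ R, b x y z := by
        have e1 : ∑ x ∈ R, ∑ y ∈ R, ∑ z ∈ R, b y x z = ∑ x ∈ R, ∑ y ∈ R, ∑ z ∈ R, b x y z :=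
          sum_comm
        have e2 : ∑ x ∈ R, ∑ y ∈ R, ∑ z ∈ R, b z x y = ∑ x ∈ R, ∑ y ∈ R, ∑ z ∈ R, b x y z :=
          (sum_congr rfl fun x _ => sum_comm).trans sum_comm
        rw [e1, e2]
        ring

/-- The state of the pivot algorithm: `L` labels the points in the clusters found so far, with 1
more than the pivot, and the others with 0. -/
structure PivotState (n : ℕ) (r D : ℕ → ℕ → Prop) (L : ℕ → ℕ) : Prop where
  label : ∀ x < n, L x ≠ 0 → ∃ p < n, L x = p + 1 ∧ L p ≠ 0
  count : #{q ∈ range n ×ˢ range n | q.1 ≠ q.2 ∧ ¬ (r q.1 q.2 ↔ L q.1 = L q.2) ∧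
      ¬ (L q.1 = 0 ∧ L q.2 = 0)} ≤
    3 * #{q ∈ range n ×ˢ range n | D q.1 q.2 ∧ ¬ (L q.1 = 0 ∧ L q.2 = 0)}

/-- A mistake that is new in this round is on a pair of formerly unlabelled points that form a bad
triangle with `p`. The `D` pairs in such triangles get decided in this round and were not counted
before, so the bound on the pivot adds to the invariant. -/
theorem PivotState.step {n : ℕ} {r D : ℕ → ℕ → Prop} {L L' : ℕ → ℕ} (h : PivotState n r D L)
    (hr : ∀ x y, r x y → r y x) {p : ℕ} (hp : p < n) (hLp : L p = 0)
    (hcount : #{q ∈ {x ∈ range n | L x = 0} ×ˢ {x ∈ range n | L x = 0} | Bad r p q.1 q.2} ≤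
      3 * #{q ∈ {x ∈ range n | L x = 0} ×ˢ {x ∈ range n | L x = 0} |
        Bad r p q.1 q.2 ∧ D q.1 q.2})
    (hL' : ∀ u < n, L' u = if L u ≠ 0 then L u else if u = p ∨ r p u then p + 1 else 0) :
    PivotState n r D L' := by
  have hLp' : L' p = p + 1 := by rw [hL' p hp, if_neg (by simpa using hLp), if_pos (Or.inl rfl)]
  -- The label `p + 1` is fresh: a point that carried it would have `p` as its pivot, and pivots are
  -- labelled.
  have hnew : ∀ x < n, L x ≠ p + 1 := by
    intro x hx hxp
    obtain ⟨p', _, h1, h2⟩ := h.label x hx (by omega)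
    obtain rfl : p' = p := by omega
    exact h2 hLp
  have hold : ∀ x < n, L x ≠ 0 → L' x = L x := fun x hx h0 => by rw [hL' x hx, if_pos h0]
  have hcase : ∀ x < n, L x = 0 →
      (L' x = p + 1 ∧ (x = p ∨ r p x)) ∨ (L' x = 0 ∧ ¬ (x = p ∨ r p x)) := by
    intro x hx h0
    by_cases hB : x = p ∨ r p x
    · exact Or.inl ⟨by rw [hL' x hx, if_neg (by simpa using h0), if_pos hB], hB⟩
    · exact Or.inr ⟨by rw [hL' x hx, if_neg (by simpa using h0), if_neg hB], hB⟩
  refine ⟨?_, ?_⟩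
  · intro x hx hx'
    by_cases h0 : L x = 0
    · rcases hcase x hx h0 with ⟨h1, _⟩ | ⟨h1, _⟩
      · exact ⟨p, hp, h1, by omega⟩
      · exact absurd h1 hx'
    · obtain ⟨p', hp', h1, h2⟩ := h.label x hx h0
      exact ⟨p', hp', by rw [hold x hx h0, h1], by rw [hold p' hp' h2]; exact h2⟩
  · have hsub : {q ∈ range n ×ˢ range n | q.1 ≠ q.2 ∧ ¬ (r q.1 q.2 ↔ L' q.1 = L' q.2) ∧
        ¬ (L' q.1 = 0 ∧ L' q.2 = 0)} ⊆
        {q ∈ range n ×ˢ range n | q.1 ≠ q.2 ∧ ¬ (r q.1 q.2 ↔ L q.1 = L q.2) ∧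
          ¬ (L q.1 = 0 ∧ L q.2 = 0)} ∪
        {q ∈ {x ∈ range n | L x = 0} ×ˢ {x ∈ range n | L x = 0} | Bad r p q.1 q.2} := by
      rintro ⟨x, y⟩ hq
      simp only [mem_union, mem_filter, mem_product, mem_range] at hq ⊢
      obtain ⟨⟨hx, hy⟩, hxy, hw, h0⟩ := hq
      by_cases hx0 : L x = 0 <;> by_cases hy0 : L y = 0
      · refine Or.inr ⟨⟨⟨hx, hx0⟩, hy, hy0⟩, ?_⟩
        have hyx := hr y x
        have hxy' := hr x y
        rcases hcase x hx hx0 with ⟨h1, h2⟩ | ⟨h1, h2⟩ <;>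
          rcases hcase y hy hy0 with ⟨h3, h4⟩ | ⟨h3, h4⟩
        · have hxy2 : ¬ r x y := fun hh => hw (by simp [hh, h1, h3])
          have hxp : p ≠ x := by
            rintro rfl
            exact h4.elim (fun h => hxy h.symm) hxy2
          have hyp : p ≠ y := by
            rintro rfl
            exact h2.elim hxy fun h => hxy2 (hyx h)
          exact ⟨⟨hxp, hyp, hxy⟩, Or.inl ⟨h2.resolve_left hxp.symm, h4.resolve_left hyp.symm, hxy2⟩⟩
        · have hxy2 : r x y := by
            by_contra hh
            exact hw (by simp [hh, h1, h3])
          have hyp : p ≠ y := fun h => h4 (Or.inl h.symm)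
          have hxp : p ≠ x := by
            rintro rfl
            exact h4 (Or.inr hxy2)
          exact ⟨⟨hxp, hyp, hxy⟩, Or.inr (Or.inl ⟨h2.resolve_left hxp.symm,
            fun h => h4 (Or.inr h), hxy2⟩)⟩
        · have hxy2 : r x y := by
            by_contra hh
            exact hw (by simp [hh, h1, h3])
          have hxp : p ≠ x := fun h => h2 (Or.inl h.symm)
          have hyp : p ≠ y := by
            rintro rfl
            exact h2 (Or.inr (hxy' hxy2))
          exact ⟨⟨hxp, hyp, hxy⟩, Or.inr (Or.inr ⟨fun h => h2 (Or.inr h),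
            h4.resolve_left hyp.symm, hxy2⟩)⟩
        · exact absurd ⟨h1, h3⟩ h0
      -- With one point labelled earlier, the two labels differ before and after the round, so the
      -- mistake is an old one.
      · refine Or.inl ⟨⟨hx, hy⟩, hxy, ?_, by tauto⟩
        have := hnew y hy
        rw [hold y hy hy0] at hw
        rcases hcase x hx hx0 with ⟨h1, h2⟩ | ⟨h1, h2⟩ <;>
         (rw [h1] at hw
          rw [hx0]
          exact fun h => hw (h.trans (by omega)))
      · refine Or.inl ⟨⟨hx, hy⟩, hxy, ?_, by tauto⟩
        have := hnew x hx
        rw [hold x hx hx0] at hw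
        rcases hcase y hy hy0 with ⟨h1, h2⟩ | ⟨h1, h2⟩ <;>
         (rw [h1] at hw
          rw [hy0]
          exact fun h => hw (h.trans (by omega)))
      · refine Or.inl ⟨⟨hx, hy⟩, hxy, ?_, by tauto⟩
        rwa [hold x hx hx0, hold y hy hy0] at hw
    have hsup : {q ∈ range n ×ˢ range n | D q.1 q.2 ∧ ¬ (L q.1 = 0 ∧ L q.2 = 0)} ∪
        {q ∈ {x ∈ range n | L x = 0} ×ˢ {x ∈ range n | L x = 0} |
          Bad r p q.1 q.2 ∧ D q.1 q.2} ⊆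
        {q ∈ range n ×ˢ range n | D q.1 q.2 ∧ ¬ (L' q.1 = 0 ∧ L' q.2 = 0)} := by
      rintro ⟨x, y⟩ hq
      simp only [mem_union, mem_filter, mem_product, mem_range] at hq ⊢
      rcases hq with ⟨⟨hx, hy⟩, hd, h0⟩ | ⟨⟨⟨hx, hx0⟩, hy, hy0⟩, hb, hd⟩
      · refine ⟨⟨hx, hy⟩, hd, fun ⟨h1, h2⟩ => h0 ⟨?_, ?_⟩⟩
        · by_contra h
          exact h ((hold x hx h).symm.trans h1)
        · by_contra h
          exact h ((hold y hy h).symm.trans h2)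
      · refine ⟨⟨hx, hy⟩, hd, fun ⟨h1, h2⟩ => ?_⟩
        -- In a bad triangle at `p`, at least one other vertex is related to `p`, so it is labelled
        -- now.
        have h3 : ¬ r p x := fun h => by
          rcases hcase x hx hx0 with ⟨h5, _⟩ | ⟨_, h5⟩
          · omega
          · exact h5 (Or.inr h)
        have h4 : ¬ r p y := fun h => by
          rcases hcase y hy hy0 with ⟨h5, _⟩ | ⟨_, h5⟩
          · omega
          · exact h5 (Or.inr h)
        unfold Bad at hb
        tauto
    have hdisj : Disjoint {q ∈ range n ×ˢ range n | D q.1 q.2 ∧ ¬ (L q.1 = 0 ∧ L q.2 = 0)}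
        {q ∈ {x ∈ range n | L x = 0} ×ˢ {x ∈ range n | L x = 0} |
          Bad r p q.1 q.2 ∧ D q.1 q.2} := by
      rw [disjoint_left]
      rintro ⟨x, y⟩ h1 h2
      simp only [mem_filter, mem_product, mem_range] at h1 h2
      tauto
    have h1 := card_le_card hsub
    have h2 := card_le_card hsup
    have h3 := card_union_le {q ∈ range n ×ˢ range n | q.1 ≠ q.2 ∧
      ¬ (r q.1 q.2 ↔ L q.1 = L q.2) ∧ ¬ (L q.1 = 0 ∧ L q.2 = 0)}
      {q ∈ {x ∈ range n | L x = 0} ×ˢ {x ∈ range n | L x = 0} | Bad r p q.1 q.2}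
    have h4 := h.count
    rw [card_union_of_disjoint hdisj] at h2
    omega

/-- When all points are labelled, the clustering is nearly as good as the modified graph. -/
theorem PivotState.card_disagree_le {n : ℕ} {r D : ℕ → ℕ → Prop} {L : ℕ → ℕ}
    (h : PivotState n r D L) (hL : ∀ x < n, L x ≠ 0) :
    #(disagree n r (SameLabel L)) ≤ 3 * #{q ∈ range n ×ˢ range n | D q.1 q.2} := by
  refine le_trans (card_le_card ?_) (h.count.trans (Nat.mul_le_mul_left 3 (card_le_card ?_)))
  · intro q hq
    simp only [mem_disagree, SameLabel] at hq
    simp only [mem_filter, mem_product, mem_range]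
    exact ⟨hq.1, hq.2.1, hq.2.2, fun h0 => hL _ hq.1.1 h0.1⟩
  · exact fun q hq => by
      simp only [mem_filter] at hq ⊢
      exact ⟨hq.1, hq.2.1⟩

/-- The six ordered pairs in a triangle. -/
def trianglePairs (u v w : ℕ) : Finset (ℕ × ℕ) :=
  {(u, v), (v, u), (u, w), (w, u), (v, w), (w, v)}

theorem card_trianglePairs {u v w : ℕ} (h1 : u ≠ v) (h2 : u ≠ w) (h3 : v ≠ w) :
    #(trianglePairs u v w) = 6 := by
  have h1' := h1.symm
  have h2' := h2.symm
  have h3' := h3.symm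
  unfold trianglePairs
  repeat rw [card_insert_of_notMem (by simp [*])]
  simp

/-- Adding a bad triangle to a packing. -/
theorem card_packing_step {n : ℕ} {r : ℕ → ℕ → Prop} (hr : ∀ x y, r x y → r y x)
    {D : Finset (ℕ × ℕ)} {M : ℕ → ℕ} (hD : #D ≤ 3 * #(D ∩ disagree n r (SameLabel M)))
    {u v w : ℕ} (hu : u < n) (hv : v < n) (hw : w < n) (huv : r u v) (huw : r u w)
    (hvw : ¬ r v w) (h1 : u ≠ v) (h2 : u ≠ w) (h3 : v ≠ w)
    (hdisj : Disjoint D (trianglePairs u v w)) :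
    #(D ∪ trianglePairs u v w) ≤
      3 * #((D ∪ trianglePairs u v w) ∩ disagree n r (SameLabel M)) := by
  have hwv : ¬ r w v := fun h => hvw (hr _ _ h)
  -- No clustering agrees with a bad triangle: `u v` or `u w` is cut, or else `v w` are together.
  -- The wrong edge counts in both orders, hence 2 of the 6 pairs.
  have two : 2 ≤ #(trianglePairs u v w ∩ disagree n r (SameLabel M)) := by
    have pair : ∀ x y, x ≠ y → (x, y) ∈ trianglePairs u v w ∩ disagree n r (SameLabel M) →
        (y, x) ∈ trianglePairs u v w ∩ disagree n r (SameLabel M) →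
        2 ≤ #(trianglePairs u v w ∩ disagree n r (SameLabel M)) := by
      intro x y hxy hx hy
      rw [← card_pair (show (x, y) ≠ (y, x) by simp [hxy])]
      exact card_le_card (by simp only [insert_subset_iff, singleton_subset_iff]; exact ⟨hx, hy⟩)
    by_cases e1 : M u = M v
    · by_cases e2 : M u = M w
      · have e3 : M v = M w := e1.symm.trans e2
        apply pair v w h3 <;>
          simp [trianglePairs, mem_disagree, SameLabel, *, Ne.symm h3]
      · have e2' := Ne.symm e2
        have huw' := hr _ _ huw
        apply pair u w h2 <;>
          simp [trianglePairs, mem_disagree, SameLabel, hu, hw, huw, huw', e2, h2, h2.symm, e2']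
    · have e1' := Ne.symm e1
      have huv' := hr _ _ huv
      apply pair u v h1 <;>
        simp [trianglePairs, mem_disagree, SameLabel, hu, hv, huv, huv', e1, h1, h1.symm, e1']
  have h4 : Disjoint (D ∩ disagree n r (SameLabel M))
      (trianglePairs u v w ∩ disagree n r (SameLabel M)) :=
    hdisj.mono inter_subset_left inter_subset_left
  rw [union_inter_distrib_right, card_union_of_disjoint hdisj, card_union_of_disjoint h4,
    card_trianglePairs h1 h2 h3]
  omega

end FairCC

namespace FairCC

open Finset
open scoped Classical

/-! ### The closest fair clustering

Points are numbers below `n`, colored by `χ` and labelled by `L`. -/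

section Fair

variable (n : ℕ) (χ L : ℕ → ℕ)

/-- The number of points with the color of `v`. -/
noncomputable def colorSize (v : ℕ) : ℕ := #{u ∈ range n | χ u = χ v}

/-- The number of points with label `b`. -/
noncomputable def clusterSize (b : ℕ) : ℕ := #{u ∈ range n | L u = b}

/-- The number of points with label `b` and the color of `v`. -/
noncomputable def colorInCluster (b v : ℕ) : ℕ := #{u ∈ range n | L u = b ∧ χ u = χ v}

/-- The position of `v` among the points with its color and its label. -/
noncomputable def rank (v : ℕ) : ℕ := #{u ∈ range n | u < v ∧ L u = L v ∧ χ u = χ v}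

/-- The number of points with the color of `v` in a fair cluster of size `s`. -/
noncomputable def quota (s v : ℕ) : ℕ := s * colorSize n χ v / n

/-- There can be fair clusters of size `s`. -/
def Admissible (s : ℕ) : Prop := ∀ v < n, quota n χ s v * n = s * colorSize n χ v

/-- The number of points that keep the label `b` when a fair cluster of size `s` is built. -/
noncomputable def keep (b s : ℕ) : ℕ := #{v ∈ range n | L v = b ∧ rank n χ L v < quota n χ s v}

/-- A bound for the cost of turning cluster `b` into a fair cluster of size `s`. -/
noncomputable def weight (b s : ℕ) : ℕ :=
  if Admissible n χ s then
    (clusterSize n L b - keep n χ L b s) * clusterSize n L b + (s - keep n χ L b s) * s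
  else (2 * n + 1) * (2 * n + 1)

/-- The colors have the same proportions for each label as for all points. -/
def FairLabel : Prop :=
  ∀ b, ∀ v < n, colorInCluster n χ L b v * n = clusterSize n L b * colorSize n χ v

variable {n χ L}

/-- The ranks of the elements of `S` are the numbers below `#S`, each once. The induction removes
the maximum, which does not affect the other ranks. -/
theorem card_filter_rank_lt (S : Finset ℕ) (a : ℕ) :
    #{v ∈ S | #{u ∈ S | u < v} < a} = min a #S := by
  induction S using Finset.induction_on_max with
  | empty => simp
  | insert m S hm ih =>
    have hmS : m ∉ S := fun h => lt_irrefl m (hm m h)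
    have h1 : {u ∈ insert m S | u < m} = S := by
      ext u
      simp only [mem_filter, mem_insert]
      exact ⟨fun ⟨h, h'⟩ => h.resolve_left h'.ne, fun h => ⟨Or.inr h, hm u h⟩⟩
    have h2 : ∀ v ∈ S, {u ∈ insert m S | u < v} = {u ∈ S | u < v} := by
      intro v hv
      ext u
      simp only [mem_filter, mem_insert]
      refine ⟨fun ⟨h, h'⟩ => ⟨h.resolve_left ?_, h'⟩, fun ⟨h, h'⟩ => ⟨Or.inr h, h'⟩⟩
      rintro rfl
      exact absurd (hm v hv) h'.not_gt
    rw [filter_insert, h1, filter_congr fun v hv => by rw [h2 v hv], card_insert_of_notMem hmS]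
    split_ifs with h
    · rw [card_insert_of_notMem (fun h => hmS (mem_filter.mp h).1), ih]
      omega
    · rw [ih]
      omega

theorem colorSize_congr {u v : ℕ} (h : χ u = χ v) : colorSize n χ u = colorSize n χ v := by
  rw [colorSize, colorSize, h]

theorem quota_congr {s u v : ℕ} (h : χ u = χ v) : quota n χ s u = quota n χ s v := by
  rw [quota, quota, colorSize_congr h]

/-- Within a label and a color the quota is constant, so keeping the ranks below it keeps as many
points as quota and supply allow. -/
theorem card_keep_color (b s v : ℕ) :
    #{u ∈ range n | L u = b ∧ χ u = χ v ∧ rank n χ L u < quota n χ s u} =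
      min (quota n χ s v) (colorInCluster n χ L b v) := by
  rw [colorInCluster, ← card_filter_rank_lt, filter_filter]
  congr 1
  ext u
  simp only [mem_filter, mem_range, and_assoc]
  refine and_congr_right fun _ => and_congr_right fun hb => and_congr_right fun hc => ?_
  rw [quota_congr hc, rank, filter_filter, hb, hc]
  simp only [and_comm, and_assoc]

theorem card_eq_sum_color (n : ℕ) (χ : ℕ → ℕ) (P : ℕ → Prop) [DecidablePred P] :
    #{v ∈ range n | P v} = ∑ c ∈ (range n).image χ, #{v ∈ range n | P v ∧ χ v = c} := by
  rw [card_eq_sum_card_fiberwise (f := χ) (t := (range n).image χ)]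
  · simp only [filter_filter]
  · intro v hv
    simp only [coe_filter, Set.mem_ofPred_eq] at hv
    exact mem_coe.mpr (mem_image_of_mem χ hv.1)

theorem FairLabel.quota {M : ℕ → ℕ} (hM : FairLabel n χ M) (j : ℕ) {v : ℕ} (hv : v < n) :
    quota n χ (clusterSize n M j) v = colorInCluster n χ M j v := by
  rw [FairCC.quota, ← hM j v hv, Nat.mul_div_cancel _ (by omega)]

theorem FairLabel.admissible {M : ℕ → ℕ} (hM : FairLabel n χ M) (j : ℕ) :
    Admissible n χ (clusterSize n M j) := fun v hv => by rw [hM.quota j hv, hM j v hv]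

/-- Color by color, the intersection is bounded both by the supply in `b` and by the number of
points in `j`, which is the quota since `M` is fair. Thus keeping points greedily retains at least
as many as `M` does. -/
theorem FairLabel.card_inter_le_keep {M : ℕ → ℕ} (hM : FairLabel n χ M) (b j : ℕ) :
    #{v ∈ range n | L v = b ∧ M v = j} ≤ keep n χ L b (clusterSize n M j) := by
  rw [keep, card_eq_sum_color n χ, card_eq_sum_color n χ]
  refine sum_le_sum fun c hc => ?_
  obtain ⟨v, hv, rfl⟩ := mem_image.mp hc
  have h := card_keep_color (n := n) (χ := χ) (L := L) b (clusterSize n M j) v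
  rw [hM.quota j (mem_range.mp hv)] at h
  have e : {u ∈ range n | (L u = b ∧ rank n χ L u < FairCC.quota n χ (clusterSize n M j) u) ∧
      χ u = χ v} = {u ∈ range n | L u = b ∧ χ u = χ v ∧
        rank n χ L u < FairCC.quota n χ (clusterSize n M j) u} :=
    filter_congr fun u _ => by tauto
  rw [e, h]
  refine le_min (card_le_card fun u hu => ?_) (card_le_card fun u hu => ?_) <;>
    simp only [mem_filter] at hu ⊢ <;> tauto

/-- The weight decreases in the number of kept points, so an overlap with a fair cluster can stand
in for `keep`. -/
theorem weight_le {b s x : ℕ} (hs : Admissible n χ s) (hx : x ≤ keep n χ L b s) :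
    weight n χ L b s ≤ (clusterSize n L b - x) * clusterSize n L b + (s - x) * s := by
  rw [weight, if_pos hs]
  exact Nat.add_le_add (Nat.mul_le_mul_right _ (by omega)) (Nat.mul_le_mul_right _ (by omega))

/-! #### The lower bound -/

/-- The number of points that have label `b` in one clustering and `j` in the other. -/
noncomputable def overlap (n : ℕ) (L M : ℕ → ℕ) (b j : ℕ) : ℕ :=
  #{v ∈ range n | L v = b ∧ M v = j}

theorem overlap_le_left (n : ℕ) (L M : ℕ → ℕ) (b j : ℕ) : overlap n L M b j ≤ clusterSize n L b :=
  card_le_card fun v hv => by simp only [mem_filter] at hv ⊢; tauto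

theorem overlap_le_right (n : ℕ) (L M : ℕ → ℕ) (b j : ℕ) : overlap n L M b j ≤ clusterSize n M j :=
  card_le_card fun v hv => by simp only [mem_filter] at hv ⊢; tauto

/-- The number of points that are together with `v` in one of two clusterings only. -/
noncomputable def deviation (n : ℕ) (L M : ℕ → ℕ) (v : ℕ) : ℕ :=
  (clusterSize n L (L v) - overlap n L M (L v) (M v)) +
    (clusterSize n M (M v) - overlap n L M (L v) (M v))

/-- Disagreements are counted by their first point: its companions in one clustering only form the
two differences in `deviation`. -/
theorem sum_deviation_le (n : ℕ) (L M : ℕ → ℕ) :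
    ∑ v ∈ range n, deviation n L M v ≤ #(disagree n (SameLabel L) (SameLabel M)) := by
  have : disagree n (SameLabel L) (SameLabel M) = {q ∈ range n ×ˢ range n |
      (L q.2 = L q.1 ∧ M q.2 ≠ M q.1) ∨ (M q.2 = M q.1 ∧ L q.2 ≠ L q.1)} := by
    ext ⟨x, y⟩
    simp only [mem_disagree, mem_filter, mem_product, mem_range, SameLabel, eq_comm (a := L y),
      eq_comm (a := M y), ne_eq]
    refine and_congr_right fun _ => ?_
    have : x = y → L x = L y ∧ M x = M y := by
      rintro rfl
      exact ⟨rfl, rfl⟩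
    tauto
  rw [this, card_filter_product _ _ fun x y => (L y = L x ∧ M y ≠ M x) ∨ (M y = M x ∧ L y ≠ L x)]
  refine sum_le_sum fun v _ => ?_
  have h1 : #{u ∈ range n | L u = L v ∧ M u ≠ M v} =
      clusterSize n L (L v) - overlap n L M (L v) (M v) := by
    rw [clusterSize, ← card_filter_add_card_filter_not (s := {u ∈ range n | L u = L v})
      (fun u => M u = M v), filter_filter, filter_filter, overlap, Nat.add_sub_cancel_left]
  have h2 : #{u ∈ range n | M u = M v ∧ L u ≠ L v} =
      clusterSize n M (M v) - overlap n L M (L v) (M v) := by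
    rw [clusterSize, ← card_filter_add_card_filter_not (s := {u ∈ range n | M u = M v})
      (fun u => L u = L v), filter_filter, filter_filter, overlap]
    simp only [and_comm (a := M _ = M v) (b := L _ = L v), Nat.add_sub_cancel_left]
  rw [deviation, ← h1, ← h2, filter_or, card_union_of_disjoint]
  rw [disjoint_left]
  intro u hu hu'
  simp only [mem_filter] at hu hu'
  exact hu'.2.2 hu.2.1

/-- More than half of cluster `b` is in cluster `j` of the other clustering, and conversely. -/
def Matched (n : ℕ) (L M : ℕ → ℕ) (b j : ℕ) : Prop :=
  clusterSize n L b < 2 * overlap n L M b j ∧ clusterSize n M j < 2 * overlap n L M b j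

/-- Two disjoint parts cannot both contain more than half of a cluster. -/
theorem Matched.right_unique {M : ℕ → ℕ} {b j j' : ℕ} (h : Matched n L M b j)
    (h' : Matched n L M b j') : j = j' := by
  by_contra hj
  have : overlap n L M b j + overlap n L M b j' ≤ clusterSize n L b := by
    rw [overlap, overlap, clusterSize, ← card_union_of_disjoint]
    · exact card_le_card fun v hv => by simp only [mem_union, mem_filter] at hv ⊢; tauto
    · rw [disjoint_left]
      intro v hv hv'
      simp only [mem_filter] at hv hv'
      exact hj (hv.2.2.symm.trans hv'.2.2)
  have := h.1
  have := h'.1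
  omega

theorem Matched.left_unique {M : ℕ → ℕ} {b b' j : ℕ} (h : Matched n L M b j)
    (h' : Matched n L M b' j) : b = b' := by
  by_contra hj
  have : overlap n L M b j + overlap n L M b' j ≤ clusterSize n M j := by
    rw [overlap, overlap, clusterSize, ← card_union_of_disjoint]
    · exact card_le_card fun v hv => by simp only [mem_union, mem_filter] at hv ⊢; tauto
    · rw [disjoint_left]
      intro v hv hv'
      simp only [mem_filter] at hv hv'
      exact hj (hv.2.1.symm.trans hv'.2.1)
  have := h.2
  have := h'.2
  omega

/-- If the overlap is at most half of one of the clusters, that cluster is at most twice its part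
outside the overlap, and the other one is at most the sum of the two outside parts. -/
theorem le_two_mul_deviation {M : ℕ → ℕ} {v : ℕ} (h : ¬ Matched n L M (L v) (M v)) :
    clusterSize n L (L v) ≤ 2 * deviation n L M v ∧ clusterSize n M (M v) ≤ 2 * deviation n L M v := by
  have h1 := overlap_le_left n L M (L v) (M v)
  have h2 := overlap_le_right n L M (L v) (M v)
  unfold Matched at h
  unfold deviation
  omega

/-- The sizes of the clusters of a fair clustering can be assigned to labels at bounded weight. -/
theorem exists_sizes {M : ℕ → ℕ} (hM : FairLabel n χ M) (hMn : ∀ v < n, M v < n)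
    (hL : ∀ v < n, L v ≤ n) : ∃ sz : ℕ → ℕ, ∑ b ∈ range (2 * n + 1), sz b = n ∧
      ∑ b ∈ range (2 * n + 1), weight n χ L b (sz b) ≤
        4 * #(disagree n (SameLabel L) (SameLabel M)) := by
  -- The labels in `L` are at most `n`, so `n + 1 + j` is a fresh label; this is why `2 * n + 1`
  -- labels are provided.
  let target : ℕ → ℕ := fun j => if h : ∃ b ≤ n, Matched n L M b j then h.choose else n + 1 + j
  have htM : ∀ b ≤ n, ∀ j, Matched n L M b j → target j = b := by
    intro b hb j h
    have he : ∃ b ≤ n, Matched n L M b j := ⟨b, hb, h⟩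
    simp only [target, dif_pos he]
    exact he.choose_spec.2.left_unique h
  have htN : ∀ j, (∀ b ≤ n, ¬ Matched n L M b j) → target j = n + 1 + j := by
    intro j h
    exact dif_neg fun ⟨b, hb, h'⟩ => h b hb h'
  have hlt : ∀ j < n, target j < 2 * n + 1 := by
    intro j hj
    by_cases h : ∃ b ≤ n, Matched n L M b j
    · obtain ⟨b, hb, h'⟩ := h
      rw [htM b hb j h']
      omega
    · rw [htN j (by push Not at h; exact h)]
      omega
  have hinj : ∀ j j', target j = target j' → j = j' := by
    intro j j' h
    by_cases h1 : ∃ b ≤ n, Matched n L M b j <;> by_cases h2 : ∃ b ≤ n, Matched n L M b j'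
    · obtain ⟨b, hb, h1⟩ := h1
      obtain ⟨b', hb', h2⟩ := h2
      rw [htM b hb j h1, htM b' hb' j' h2] at h
      subst h
      exact h1.right_unique h2
    · obtain ⟨b, hb, h1⟩ := h1
      rw [htM b hb j h1, htN j' (by push Not at h2; exact h2)] at h
      omega
    · obtain ⟨b, hb, h2⟩ := h2
      rw [htM b hb j' h2, htN j (by push Not at h1; exact h1)] at h
      omega
    · rw [htN j (by push Not at h1; exact h1), htN j' (by push Not at h2; exact h2)] at h
      omega
  refine ⟨fun b => ∑ j ∈ range n with target j = b, clusterSize n M j, ?_, ?_⟩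
  · rw [sum_fiberwise_of_maps_to fun j hj => mem_range.mpr (hlt j (mem_range.mp hj))]
    have := card_eq_sum_card_fiberwise (f := M) (s := range n) (t := range n) fun v hv =>
      mem_coe.mpr (mem_range.mpr (hMn v (mem_range.mp (mem_coe.mp hv))))
    rw [card_range] at this
    exact this.symm
  -- Each point's deviation is charged twice, at its label and at the target of its fair cluster;
  -- with the factor 2 this gives 4 in total.
  · have key : ∀ b ∈ range (2 * n + 1),
        weight n χ L b (∑ j ∈ range n with target j = b, clusterSize n M j) ≤
          2 * (∑ v ∈ range n with L v = b, deviation n L M v +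
            ∑ v ∈ range n with target (M v) = b, deviation n L M v) := by
      intro b _
      by_cases hj : ∃ j < n, target j = b
      · obtain ⟨j, hjn, hjb⟩ := hj
        have hs : ∑ j ∈ range n with target j = b, clusterSize n M j = clusterSize n M j := by
          rw [show {j ∈ range n | target j = b} = {j} from ?_, sum_singleton]
          ext j'
          simp only [mem_filter, mem_range, mem_singleton]
          refine ⟨fun h => hinj _ _ (h.2.trans hjb.symm), ?_⟩
          rintro rfl
          exact ⟨hjn, hjb⟩
        rw [hs]
        have hw := weight_le (hM.admissible j) (hM.card_inter_le_keep (L := L) b j)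
        change _ ≤ (clusterSize n L b - overlap n L M b j) * clusterSize n L b +
          (clusterSize n M j - overlap n L M b j) * clusterSize n M j at hw
        by_cases hm : ∃ b ≤ n, Matched n L M b j
        · obtain ⟨b', hb', hm⟩ := hm
          obtain rfl : b' = b := (htM b' hb' j hm).symm.trans hjb
          -- For a matched pair, all points of the overlap have the same deviation, and the overlap
          -- exceeds half of either cluster, so the weight is at most twice their total deviation.
          have h1 : ∑ v ∈ range n with L v = b' ∧ M v = j, deviation n L M v =
              overlap n L M b' j * ((clusterSize n L b' - overlap n L M b' j) +
                (clusterSize n M j - overlap n L M b' j)) := by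
            rw [sum_congr rfl (g := fun _ => (clusterSize n L b' - overlap n L M b' j) +
              (clusterSize n M j - overlap n L M b' j)), sum_const, smul_eq_mul, overlap]
            intro v hv
            obtain ⟨_, rfl, rfl⟩ := mem_filter.mp hv
            rfl
          have h2 : ∑ v ∈ range n with L v = b' ∧ M v = j, deviation n L M v ≤
              ∑ v ∈ range n with L v = b', deviation n L M v :=
            sum_le_sum_of_subset fun v hv => by simp only [mem_filter] at hv ⊢; tauto
          have h3 := Nat.mul_le_mul_left (clusterSize n L b' - overlap n L M b' j) hm.1.le
          have h4 := Nat.mul_le_mul_left (clusterSize n M j - overlap n L M b' j) hm.2.le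
          rw [mul_add] at h1
          linarith [Nat.zero_le (∑ v ∈ range n with target (M v) = b', deviation n L M v),
            mul_comm (clusterSize n L b' - overlap n L M b' j) (overlap n L M b' j),
            mul_comm (clusterSize n M j - overlap n L M b' j) (overlap n L M b' j)]
        · push Not at hm
          have hb := htN j hm
          -- A fresh label starts empty: the fair cluster is built from nothing, at a weight equal
          -- to its size squared.
          have h0 : clusterSize n L b = 0 := by
            rw [clusterSize, card_eq_zero, filter_eq_empty_iff]
            intro v hv hv'
            have := hL v (mem_range.mp hv)
            omega
          have h0' : overlap n L M b j = 0 := by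
            have := overlap_le_left n L M b j
            omega
          rw [h0, h0', Nat.mul_zero, Nat.zero_add, Nat.sub_zero] at hw
          have h1 : clusterSize n M j * clusterSize n M j ≤
              ∑ v ∈ range n with M v = j, 2 * deviation n L M v := by
            conv_lhs => rw [clusterSize]
            rw [← smul_eq_mul]
            refine card_nsmul_le_sum _ _ _ fun v hv => ?_
            have hv' := mem_filter.mp hv
            have h := le_two_mul_deviation (hv'.2 ▸ hm _ (hL v (mem_range.mp hv'.1)))
            exact hv'.2 ▸ h.2
          rw [← mul_sum] at h1
          have h2 : ∑ v ∈ range n with M v = j, deviation n L M v ≤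
              ∑ v ∈ range n with target (M v) = b, deviation n L M v :=
            sum_le_sum_of_subset fun v hv => by
              simp only [mem_filter] at hv ⊢
              exact ⟨hv.1, by rw [hv.2, hjb]⟩
          omega
      · push Not at hj
        have hs : ∑ j ∈ range n with target j = b, clusterSize n M j = 0 := by
          rw [filter_eq_empty_iff.mpr fun j hj' => hj j (mem_range.mp hj'), sum_empty]
        rw [hs]
        -- No fair cluster is assigned to this label, so it is dissolved. None of its points is in a
        -- matched pair, and each pays for half the cluster.
        have hw := weight_le (n := n) (χ := χ) (L := L) (b := b) (s := 0) (x := 0)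
          (fun v _ => by simp [quota]) (Nat.zero_le _)
        rw [Nat.sub_zero, Nat.mul_zero, Nat.add_zero] at hw
        have h1 : clusterSize n L b * clusterSize n L b ≤
            ∑ v ∈ range n with L v = b, 2 * deviation n L M v := by
          conv_lhs => rw [clusterSize]
          rw [← smul_eq_mul]
          refine card_nsmul_le_sum _ _ _ fun v hv => ?_
          have hv' := mem_filter.mp hv
          have hvn := mem_range.mp hv'.1
          have h := le_two_mul_deviation (n := n) (L := L) (M := M) (v := v) fun h =>
            hj _ (hMn v hvn) ((htM _ (hL v hvn) _ h).trans hv'.2)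
          exact hv'.2 ▸ h.1
        rw [← mul_sum] at h1
        omega
    refine (sum_le_sum key).trans ?_
    rw [← mul_sum, sum_add_distrib, sum_fiberwise_of_maps_to fun v hv => mem_range.mpr
      ((hL v (mem_range.mp hv)).trans_lt (by omega)), sum_fiberwise_of_maps_to fun v hv =>
      mem_range.mpr (hlt _ (hMn v (mem_range.mp hv)))]
    have := sum_deviation_le n L M
    omega

end Fair

end FairCC

namespace FairCC

open Finset
open scoped Classical

/-! ### Building fair clusters of prescribed sizes -/

section Reassign

variable (n : ℕ) (χ L sz : ℕ → ℕ)

/-- The point `v` has to leave its cluster. -/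
def Excess (v : ℕ) : Prop := quota n χ (sz (L v)) v ≤ rank n χ L v

/-- The position of `v` among the points of its color that have to leave their clusters. -/
noncomputable def excessRank (v : ℕ) : ℕ :=
  #{u ∈ range n | u < v ∧ χ u = χ v ∧ Excess n χ L sz u}

/-- The number of points with the color of `v` that cluster `b` lacks. -/
noncomputable def deficit (b v : ℕ) : ℕ := quota n χ (sz b) v - colorInCluster n χ L b v

/-- The new label of a point: the points of each color that have to leave their clusters fill up
the clusters in order. -/
noncomputable def newLabel (v : ℕ) : ℕ :=
  if Excess n χ L sz v then
    #{b ∈ range (2 * n + 1) |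
      ∑ b' ∈ range (2 * n + 1), (if b' ≤ b then deficit n χ L sz b' v else 0) ≤
        excessRank n χ L sz v}
  else L v

variable {n χ L sz}

theorem card_filter_rank_mem (S : Finset ℕ) {a b : ℕ} (hab : a ≤ b) (hb : b ≤ #S) :
    #{v ∈ S | a ≤ #{u ∈ S | u < v} ∧ #{u ∈ S | u < v} < b} = b - a := by
  have h1 := card_filter_rank_lt S a
  have h2 := card_filter_rank_lt S b
  rw [min_eq_left (hab.trans hb)] at h1
  rw [min_eq_left hb] at h2
  have h3 : {v ∈ S | #{u ∈ S | u < v} < b} = {v ∈ S | #{u ∈ S | u < v} < a} ∪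
      {v ∈ S | a ≤ #{u ∈ S | u < v} ∧ #{u ∈ S | u < v} < b} := by
    ext v
    simp only [mem_union, mem_filter]
    by_cases hv : v ∈ S
    · simp only [hv, true_and]
      omega
    · simp [hv]
  rw [h3, card_union_of_disjoint, h1] at h2
  · omega
  · rw [disjoint_left]
    intro v hv hv'
    simp only [mem_filter] at hv hv'
    omega

/-- The segment that contains `x`, if the lengths of the segments are given by `f`. -/
theorem card_prefix_le_eq_iff {N x b : ℕ} (f : ℕ → ℕ) (hb : b < N) (hx : x < ∑ i ∈ range N, f i) :
    #{i ∈ range N | ∑ j ∈ range N, (if j ≤ i then f j else 0) ≤ x} = b ↔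
      ∑ i ∈ range b, f i ≤ x ∧ x < ∑ i ∈ range (b + 1), f i := by
  have hpre : ∀ i ∈ range N, (∑ j ∈ range N, if j ≤ i then f j else 0) =
      ∑ j ∈ range (i + 1), f j := by
    intro i hi
    rw [← sum_filter]
    congr 1
    ext j
    simp only [mem_filter, mem_range] at hi ⊢
    omega
  have hmono : Monotone fun i => ∑ j ∈ range i, f j := fun i j hij =>
    sum_le_sum_of_subset (range_mono hij)
  have hex : ∃ i, x < ∑ j ∈ range (i + 1), f j :=
    ⟨N, hx.trans_le (hmono (Nat.le_succ N))⟩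
  have hset : {i ∈ range N | ∑ j ∈ range N, (if j ≤ i then f j else 0) ≤ x} =
      range (Nat.find hex) := by
    have hlt : Nat.find hex < N := by
      obtain ⟨m, rfl⟩ : ∃ m, N = m + 1 := ⟨N - 1, by omega⟩
      exact Nat.lt_succ_of_le (Nat.find_min' hex hx)
    ext i
    rw [mem_filter, mem_range, mem_range, Nat.lt_find_iff]
    constructor
    · rintro ⟨hi, h⟩ m hm
      rw [hpre i (mem_range.mpr hi)] at h
      exact ((hmono (Nat.succ_le_succ hm)).trans h).not_gt
    · intro h
      have hi : i < N := by
        by_contra hi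
        exact h _ (by omega) (Nat.find_spec hex)
      refine ⟨hi, ?_⟩
      rw [hpre i (mem_range.mpr hi)]
      exact not_lt.mp (h i le_rfl)
  rw [hset, card_range]
  constructor
  · rintro rfl
    refine ⟨?_, Nat.find_spec hex⟩
    rcases Nat.eq_zero_or_pos (Nat.find hex) with h | h
    · rw [h]
      simp
    · have := Nat.find_min hex (m := Nat.find hex - 1) (by omega)
      rw [Nat.sub_add_cancel h] at this
      exact not_lt.mp this
  · rintro ⟨h1, h2⟩
    refine le_antisymm (Nat.find_min' hex h2) ?_
    by_contra h
    exact absurd (Nat.find_spec hex) ((hmono (show Nat.find hex + 1 ≤ b by omega)).trans h1).not_gt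

/-- The points of the color of `v` that have to leave their clusters. -/
noncomputable def excessColor (n : ℕ) (χ L sz : ℕ → ℕ) (v : ℕ) : Finset ℕ :=
  {u ∈ range n | χ u = χ v ∧ Excess n χ L sz u}

theorem card_stay (b v : ℕ) :
    #{u ∈ range n | (L u = b ∧ χ u = χ v) ∧ ¬ Excess n χ L sz u} =
      min (quota n χ (sz b) v) (colorInCluster n χ L b v) := by
  rw [← card_keep_color]
  congr 1
  refine filter_congr fun u _ => ?_
  rw [and_assoc]
  refine and_congr_right fun hb => and_congr_right fun _ => ?_
  rw [Excess, not_le, hb]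

theorem sum_colorInCluster (hL : ∀ v < n, L v ≤ n) (v : ℕ) :
    ∑ b ∈ range (2 * n + 1), colorInCluster n χ L b v = colorSize n χ v := by
  rw [colorSize, card_eq_sum_card_fiberwise (f := L) (t := range (2 * n + 1))]
  · refine sum_congr rfl fun b _ => ?_
    rw [colorInCluster, filter_filter]
    simp only [and_comm]
  · intro u hu
    have := hL u (mem_range.mp (mem_filter.mp (mem_coe.mp hu)).1)
    exact mem_coe.mpr (mem_range.mpr (by omega))

/-- Supply meets demand: the sizes add up to `n`, so the quotas of a color add up to its number of
points. Subtracting the points that stay leaves the leaving points on one side and the deficits on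
the other. -/
theorem card_excessColor (hL : ∀ v < n, L v ≤ n) (hn : ∑ b ∈ range (2 * n + 1), sz b = n)
    (ha : ∀ b < 2 * n + 1, Admissible n χ (sz b)) {v : ℕ} (hv : v < n) :
    #(excessColor n χ L sz v) = ∑ b ∈ range (2 * n + 1), deficit n χ L sz b v := by
  have h1 : ∑ b ∈ range (2 * n + 1), quota n χ (sz b) v = colorSize n χ v := by
    have h : (∑ b ∈ range (2 * n + 1), quota n χ (sz b) v) * n = colorSize n χ v * n := by
      rw [sum_mul, sum_congr rfl fun b hb => ha b (mem_range.mp hb) v hv, ← sum_mul, hn, mul_comm]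
    exact Nat.eq_of_mul_eq_mul_right (by omega) h
  have h2 := sum_colorInCluster (χ := χ) hL v
  have h3 : #(excessColor n χ L sz v) + ∑ b ∈ range (2 * n + 1),
      min (quota n χ (sz b) v) (colorInCluster n χ L b v) = colorSize n χ v := by
    rw [colorSize, ← card_filter_add_card_filter_not (s := {u ∈ range n | χ u = χ v})
      (fun u => Excess n χ L sz u), filter_filter, filter_filter, excessColor]
    congr 1
    rw [card_eq_sum_card_fiberwise (f := L) (t := range (2 * n + 1))]
    · refine sum_congr rfl fun b _ => ?_
      rw [← card_stay, filter_filter]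
      congr 1
      exact filter_congr fun u _ => by tauto
    · intro u hu
      have := hL u (mem_range.mp (mem_filter.mp (mem_coe.mp hu)).1)
      exact mem_coe.mpr (mem_range.mpr (by omega))
  have h4 : ∑ b ∈ range (2 * n + 1), deficit n χ L sz b v + ∑ b ∈ range (2 * n + 1),
      min (quota n χ (sz b) v) (colorInCluster n χ L b v) =
        ∑ b ∈ range (2 * n + 1), quota n χ (sz b) v := by
    rw [← sum_add_distrib]
    refine sum_congr rfl fun b _ => ?_
    rw [deficit]
    omega
  omega

theorem excessRank_eq {u v : ℕ} (h : χ u = χ v) :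
    excessRank n χ L sz u = #{x ∈ excessColor n χ L sz v | x < u} := by
  rw [excessRank, excessColor, filter_filter, h]
  congr 1
  exact filter_congr fun x _ => by tauto

theorem excessRank_lt {u v : ℕ} (hu : u ∈ excessColor n χ L sz v) :
    excessRank n χ L sz u < #(excessColor n χ L sz v) := by
  rw [excessRank_eq (mem_filter.mp hu).2.1]
  exact card_lt_card (filter_ssubset.mpr ⟨u, hu, lt_irrefl u⟩)

theorem deficit_congr {b u v : ℕ} (h : χ u = χ v) :
    deficit n χ L sz b u = deficit n χ L sz b v := by
  rw [deficit, deficit, quota_congr h, colorInCluster, colorInCluster, h]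

/-- The deficits cut the leaving points of a color into consecutive segments, one for each label. -/
theorem newLabel_eq_iff (hL : ∀ v < n, L v ≤ n) (hn : ∑ b ∈ range (2 * n + 1), sz b = n)
    (ha : ∀ b < 2 * n + 1, Admissible n χ (sz b)) {v u b : ℕ} (hv : v < n)
    (hu : u ∈ excessColor n χ L sz v) (hb : b < 2 * n + 1) :
    newLabel n χ L sz u = b ↔
      ∑ b' ∈ range b, deficit n χ L sz b' v ≤ #{x ∈ excessColor n χ L sz v | x < u} ∧
      #{x ∈ excessColor n χ L sz v | x < u} < ∑ b' ∈ range (b + 1), deficit n χ L sz b' v := by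
  obtain ⟨-, hc, he⟩ := mem_filter.mp hu
  rw [newLabel, if_pos he]
  simp only [deficit_congr hc]
  rw [← excessRank_eq hc]
  refine card_prefix_le_eq_iff (fun b => deficit n χ L sz b v) hb ?_
  rw [← card_excessColor hL hn ha hv]
  exact excessRank_lt hu

theorem newLabel_lt (hL : ∀ v < n, L v ≤ n) (hn : ∑ b ∈ range (2 * n + 1), sz b = n)
    (ha : ∀ b < 2 * n + 1, Admissible n χ (sz b)) {v : ℕ} (hv : v < n) :
    newLabel n χ L sz v < 2 * n + 1 := by
  by_cases he : Excess n χ L sz v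
  · by_contra hlt
    have hmem : v ∈ excessColor n χ L sz v := mem_filter.mpr ⟨mem_range.mpr hv, rfl, he⟩
    have hle : newLabel n χ L sz v ≤ 2 * n + 1 := by
      rw [newLabel, if_pos he]
      exact (card_filter_le _ _).trans (card_range _).le
    have heq : newLabel n χ L sz v = 2 * n + 1 := by omega
    rw [newLabel, if_pos he] at heq
    -- Otherwise even the last prefix sum, the total deficit, would be at most the rank of a leaving
    -- point.
    have h2 := filter_card_eq (heq.trans (card_range _).symm) (2 * n) (by simp)
    have h3 := excessRank_lt hmem
    rw [card_excessColor hL hn ha hv] at h3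
    rw [sum_congr rfl (g := fun b => deficit n χ L sz b v)] at h2
    · omega
    · intro b hb
      rw [if_pos (by have := mem_range.mp hb; omega)]
  · rw [newLabel, if_neg he]
    have := hL v hv
    omega

/-- The points that stay number the minimum of quota and supply, and the arriving segment has the
length of the deficit. -/
theorem colorInCluster_newLabel (hL : ∀ v < n, L v ≤ n) (hn : ∑ b ∈ range (2 * n + 1), sz b = n)
    (ha : ∀ b < 2 * n + 1, Admissible n χ (sz b)) {v b : ℕ} (hv : v < n) (hb : b < 2 * n + 1) :
    colorInCluster n χ (newLabel n χ L sz) b v = quota n χ (sz b) v := by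
  rw [colorInCluster, ← card_filter_add_card_filter_not
    (s := {u ∈ range n | newLabel n χ L sz u = b ∧ χ u = χ v}) (fun u => Excess n χ L sz u),
    filter_filter, filter_filter]
  have h1 : {u ∈ range n | (newLabel n χ L sz u = b ∧ χ u = χ v) ∧ ¬ Excess n χ L sz u} =
      {u ∈ range n | (L u = b ∧ χ u = χ v) ∧ ¬ Excess n χ L sz u} := by
    refine filter_congr fun u _ => and_congr_left fun he => ?_
    rw [newLabel, if_neg he]
  have h2 : {u ∈ range n | (newLabel n χ L sz u = b ∧ χ u = χ v) ∧ Excess n χ L sz u} =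
      {u ∈ excessColor n χ L sz v |
        ∑ b' ∈ range b, deficit n χ L sz b' v ≤ #{x ∈ excessColor n χ L sz v | x < u} ∧
        #{x ∈ excessColor n χ L sz v | x < u} < ∑ b' ∈ range (b + 1), deficit n χ L sz b' v} := by
    ext u
    rw [mem_filter, mem_filter]
    constructor
    · rintro ⟨hu, ⟨h, hc⟩, he⟩
      have hmem : u ∈ excessColor n χ L sz v := mem_filter.mpr ⟨hu, hc, he⟩
      exact ⟨hmem, (newLabel_eq_iff hL hn ha hv hmem hb).mp h⟩
    · rintro ⟨hmem, h⟩
      obtain ⟨hu, hc, he⟩ := mem_filter.mp hmem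
      exact ⟨hu, ⟨(newLabel_eq_iff hL hn ha hv hmem hb).mpr h, hc⟩, he⟩
  rw [h1, h2, card_stay, card_filter_rank_mem, sum_range_succ, Nat.add_sub_cancel_left, deficit]
  · omega
  · exact sum_le_sum_of_subset (range_mono (Nat.le_succ b))
  · rw [card_excessColor hL hn ha hv]
    exact sum_le_sum_of_subset (range_mono hb)

theorem sum_color_eq (n : ℕ) (χ : ℕ → ℕ) :
    ∑ c ∈ (range n).image χ, #{u ∈ range n | χ u = c} = n := by
  have := card_eq_sum_color n χ fun _ => True
  simpa using this.symm

theorem clusterSize_newLabel (hL : ∀ v < n, L v ≤ n) (hn : ∑ b ∈ range (2 * n + 1), sz b = n)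
    (ha : ∀ b < 2 * n + 1, Admissible n χ (sz b)) {b : ℕ} (hb : b < 2 * n + 1) :
    clusterSize n (newLabel n χ L sz) b = sz b := by
  rcases Nat.eq_zero_or_pos n with rfl | hpos
  · have : sz 0 = 0 := by simpa using hn
    obtain rfl : b = 0 := by omega
    simp [clusterSize, this]
  · refine Nat.eq_of_mul_eq_mul_right hpos ?_
    rw [clusterSize, card_eq_sum_color n χ, sum_mul]
    conv_rhs => rw [← sum_color_eq n χ, mul_sum]
    refine sum_congr rfl fun c hc => ?_
    obtain ⟨v, hv, rfl⟩ := mem_image.mp hc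
    have hv := mem_range.mp hv
    have h := colorInCluster_newLabel hL hn ha hv hb
    rw [colorInCluster] at h
    rw [h, ha b hb v hv, colorSize]

theorem fairLabel_newLabel (hL : ∀ v < n, L v ≤ n) (hn : ∑ b ∈ range (2 * n + 1), sz b = n)
    (ha : ∀ b < 2 * n + 1, Admissible n χ (sz b)) : FairLabel n χ (newLabel n χ L sz) := by
  intro b v hv
  by_cases hb : b < 2 * n + 1
  · rw [colorInCluster_newLabel hL hn ha hv hb, clusterSize_newLabel hL hn ha hb, ha b hb v hv]
  · have h : ∀ u ∈ range n, newLabel n χ L sz u ≠ b := by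
      rintro u hu rfl
      exact hb (newLabel_lt hL hn ha (mem_range.mp hu))
    have h1 : clusterSize n (newLabel n χ L sz) b = 0 := by
      rw [clusterSize, card_eq_zero, filter_eq_empty_iff]
      exact fun {u} hu => h u hu
    have h2 : colorInCluster n χ (newLabel n χ L sz) b v = 0 := by
      rw [colorInCluster, card_eq_zero, filter_eq_empty_iff]
      exact fun {u} hu h' => h u hu h'.1
    rw [h1, h2, zero_mul, zero_mul]

/-- A pair can change only if one of its points moves, and then the other is in the old or the new
cluster of that point. Summing these cluster sizes over the moving points gives exactly the weights;
the factor 2 is for which of the two points moves. -/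
theorem card_disagree_newLabel_le (hL : ∀ v < n, L v ≤ n)
    (hn : ∑ b ∈ range (2 * n + 1), sz b = n) (ha : ∀ b < 2 * n + 1, Admissible n χ (sz b)) :
    #(disagree n (SameLabel L) (SameLabel (newLabel n χ L sz))) ≤
      2 * ∑ b ∈ range (2 * n + 1), weight n χ L b (sz b) := by
  set L' := newLabel n χ L sz with hL'
  have hstay : ∀ u, ¬ Excess n χ L sz u → L' u = L u := fun u h => by
    rw [hL', newLabel, if_neg h]
  let P : ℕ → ℕ → Prop := fun u v => Excess n χ L sz u ∧ (L v = L u ∨ L' v = L' u)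
  have hsub : disagree n (SameLabel L) (SameLabel L') ⊆
      {q ∈ range n ×ˢ range n | P q.1 q.2} ∪ {q ∈ range n ×ˢ range n | P q.2 q.1} := by
    rintro ⟨u, v⟩ hq
    simp only [mem_disagree, SameLabel] at hq
    simp only [mem_union, mem_filter, mem_product, mem_range, P]
    obtain ⟨hlt, -, h⟩ := hq
    have hu := hstay u
    have hv := hstay v
    by_cases h1 : Excess n χ L sz u
    · exact Or.inl ⟨hlt, h1, by tauto⟩
    · by_cases h2 : Excess n χ L sz v
      · exact Or.inr ⟨hlt, h2, by tauto⟩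
      · rw [hu h1, hv h2] at h
        exact absurd Iff.rfl h
  have hswap : #{q ∈ range n ×ˢ range n | P q.2 q.1} = #{q ∈ range n ×ˢ range n | P q.1 q.2} := by
    refine card_bij (fun q _ => q.swap) ?_ (fun _ _ _ _ h => Prod.swap_injective h) ?_
    · intro q hq
      simp only [mem_filter, mem_product, Prod.fst_swap, Prod.snd_swap] at hq ⊢
      exact ⟨hq.1.symm, hq.2⟩
    · intro q hq
      simp only [mem_filter, mem_product] at hq
      exact ⟨q.swap, by simpa [and_comm] using hq, Prod.swap_swap q⟩
  have hcount : #{q ∈ range n ×ˢ range n | P q.1 q.2} ≤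
      ∑ b ∈ range (2 * n + 1), weight n χ L b (sz b) := by
    rw [card_filter_product _ _ P]
    have h1 : ∀ u ∈ range n, #{v ∈ range n | P u v} ≤ if Excess n χ L sz u then
        clusterSize n L (L u) + clusterSize n L' (L' u) else 0 := by
      intro u _
      split_ifs with he
      · rw [clusterSize, clusterSize]
        refine (card_le_card fun v hv => ?_).trans (card_union_le _ _)
        simp only [mem_union, mem_filter, P] at hv ⊢
        tauto
      · simp [P, he]
    refine (sum_le_sum h1).trans ?_
    rw [← sum_filter, sum_add_distrib,
      ← sum_fiberwise_of_maps_to (s := {u ∈ range n | Excess n χ L sz u}) (t := range (2 * n + 1))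
        (g := L) (fun u hu => mem_range.mpr (by
          have := hL u (mem_range.mp (mem_filter.mp hu).1)
          omega)),
      ← sum_fiberwise_of_maps_to (s := {u ∈ range n | Excess n χ L sz u}) (t := range (2 * n + 1))
        (g := L') (fun u hu => mem_range.mpr
          (newLabel_lt hL hn ha (mem_range.mp (mem_filter.mp hu).1))), ← sum_add_distrib]
    refine sum_le_sum fun b hb => ?_
    have hb := mem_range.mp hb
    have hk : #{u ∈ range n | L u = b ∧ ¬ Excess n χ L sz u} = keep n χ L b (sz b) := by
      rw [keep]
      congr 1
      refine filter_congr fun u _ => and_congr_right fun h => ?_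
      rw [Excess, not_le, h]
    have e1 : #{u ∈ range n | Excess n χ L sz u ∧ L u = b} =
        clusterSize n L b - keep n χ L b (sz b) := by
      rw [clusterSize, ← card_filter_add_card_filter_not (s := {u ∈ range n | L u = b})
        (fun u => Excess n χ L sz u), filter_filter, filter_filter, hk, Nat.add_sub_cancel]
      simp only [and_comm]
    have e2 : #{u ∈ range n | Excess n χ L sz u ∧ L' u = b} = sz b - keep n χ L b (sz b) := by
      have hk' : #{u ∈ range n | L' u = b ∧ ¬ Excess n χ L sz u} = keep n χ L b (sz b) := by
        rw [← hk]
        congr 1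
        exact filter_congr fun u _ => and_congr_left fun h => by rw [hstay u h]
      have hs : clusterSize n L' b = sz b := clusterSize_newLabel hL hn ha hb
      rw [clusterSize, ← card_filter_add_card_filter_not (s := {u ∈ range n | L' u = b})
        (fun u => Excess n χ L sz u), filter_filter, filter_filter, hk'] at hs
      simp only [and_comm (a := Excess n χ L sz _)]
      omega
    have s1 : ∑ u ∈ range n with Excess n χ L sz u ∧ L u = b, clusterSize n L (L u) =
        (clusterSize n L b - keep n χ L b (sz b)) * clusterSize n L b := by
      rw [← e1, ← smul_eq_mul, ← sum_const]
      exact sum_congr rfl fun u hu => by rw [(mem_filter.mp hu).2.2]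
    have s2 : ∑ u ∈ range n with Excess n χ L sz u ∧ L' u = b, clusterSize n L' (L' u) =
        (sz b - keep n χ L b (sz b)) * sz b := by
      rw [← e2, ← smul_eq_mul, ← sum_const]
      exact sum_congr rfl fun u hu => by
        rw [(mem_filter.mp hu).2.2, clusterSize_newLabel hL hn ha hb]
    rw [filter_filter, filter_filter, s1, s2, weight, if_pos (ha b hb)]
  have := (card_le_card hsub).trans (card_union_le _ _)
  omega

/-- If the sizes of the clusters minimize the total weight, then the new clustering is fair, and
closest to the old one up to a constant factor. -/
theorem newLabel_spec (hL : ∀ v < n, L v ≤ n) (hn : ∑ b ∈ range (2 * n + 1), sz b = n)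
    (hmin : ∀ sz' : ℕ → ℕ, ∑ b ∈ range (2 * n + 1), sz' b = n →
      ∑ b ∈ range (2 * n + 1), weight n χ L b (sz b) ≤
        ∑ b ∈ range (2 * n + 1), weight n χ L b (sz' b)) :
    FairLabel n χ (newLabel n χ L sz) ∧ ∀ M : ℕ → ℕ, FairLabel n χ M → (∀ v < n, M v < n) →
      #(disagree n (SameLabel L) (SameLabel (newLabel n χ L sz))) ≤
        8 * #(disagree n (SameLabel L) (SameLabel M)) := by
  have hbound : ∀ M : ℕ → ℕ, FairLabel n χ M → (∀ v < n, M v < n) →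
      ∑ b ∈ range (2 * n + 1), weight n χ L b (sz b) ≤
        4 * #(disagree n (SameLabel L) (SameLabel M)) := by
    intro M hM hMn
    obtain ⟨sz', h1, h2⟩ := exists_sizes hM hMn hL
    exact (hmin sz' h1).trans h2
  have ha : ∀ b < 2 * n + 1, Admissible n χ (sz b) := by
    intro b hb
    by_contra h
    -- A single cluster is fair, so the minimum weight is at most `4 * (n * n)`. This is below `(2 *
    -- n + 1) * (2 * n + 1)`, the weight of an inadmissible size.
    have h0 : FairLabel n χ fun _ => 0 := by
      intro b' v _
      by_cases hb' : b' = 0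
      · subst hb'
        simp [colorInCluster, clusterSize, colorSize, mul_comm]
      · simp [colorInCluster, clusterSize, Ne.symm hb']
    have h1 := hbound _ h0 fun v hv => by omega
    have h2 : #(disagree n (SameLabel L) (SameLabel fun _ => 0)) ≤ n * n := by
      refine (card_filter_le _ _).trans ?_
      rw [card_product, card_range]
    have h3 := single_le_sum (f := fun b => weight n χ L b (sz b)) (fun _ _ => Nat.zero_le _)
      (mem_range.mpr hb)
    simp only [weight] at h3
    rw [if_neg h] at h3
    simp only [weight] at h1
    nlinarith
  refine ⟨fairLabel_newLabel hL hn ha, fun M hM hMn => ?_⟩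
  have h1 := card_disagree_newLabel_le hL hn ha
  have h2 := hbound M hM hMn
  omega

end Reassign

end FairCC

namespace FairCC

open Finset
open scoped Classical

/-! ### Distributing the points over the labels by dynamic programming -/

/-- After `j` labels: `sol m` distributes `m` points over the labels below `j`, at least weight. -/
structure Distribution (N n : ℕ) (w : ℕ → ℕ → ℕ) (j : ℕ) (sol : ℕ → ℕ → ℕ) : Prop where
  supp : ∀ m ≤ n, (j = 0 → m = 0) → ∀ b < N, j ≤ b → sol m b = 0
  sum : ∀ m ≤ n, (j = 0 → m = 0) → ∑ b ∈ range N, sol m b = m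
  opt : ∀ m ≤ n, (j = 0 → m = 0) → ∀ f : ℕ → ℕ, (∀ b < N, j ≤ b → f b = 0) →
    ∑ b ∈ range N, f b = m → ∑ b ∈ range N, w b (sol m b) ≤ ∑ b ∈ range N, w b (f b)

/-- The weight if `s` of `m` points get the label `j`. -/
def splitWeight (N : ℕ) (w : ℕ → ℕ → ℕ) (j : ℕ) (sol : ℕ → ℕ → ℕ) (m s : ℕ) : ℕ :=
  ∑ b ∈ range N, w b (if b = j then s else sol (m - s) b)

/-- The best number of points with label `j`, out of `m`. -/
noncomputable def bestSplit (N : ℕ) (w : ℕ → ℕ → ℕ) (j : ℕ) (sol : ℕ → ℕ → ℕ) (m : ℕ) : ℕ :=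
  first N fun s => (s ≤ m ∧ (j = 0 → s = m)) ∧
    ∀ s' < N, (s' ≤ m ∧ (j = 0 → s' = m)) →
      splitWeight N w j sol m s ≤ splitWeight N w j sol m s'

theorem bestSplit_spec {N : ℕ} (w : ℕ → ℕ → ℕ) (j : ℕ) (sol : ℕ → ℕ → ℕ) {m : ℕ} (hm : m < N) :
    (bestSplit N w j sol m ≤ m ∧ (j = 0 → bestSplit N w j sol m = m)) ∧
    ∀ s < N, (s ≤ m ∧ (j = 0 → s = m)) →
      splitWeight N w j sol m (bestSplit N w j sol m) ≤ splitWeight N w j sol m s := by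
  refine (first_spec (N := N) (P := fun s => (s ≤ m ∧ (j = 0 → s = m)) ∧
    ∀ s' < N, (s' ≤ m ∧ (j = 0 → s' = m)) →
      splitWeight N w j sol m s ≤ splitWeight N w j sol m s') ?_).2
  obtain ⟨s, hs, hmin⟩ := exists_min_image {s ∈ range N | s ≤ m ∧ (j = 0 → s = m)}
    (splitWeight N w j sol m) ⟨m, by simp [hm]⟩
  simp only [mem_filter, mem_range] at hs hmin
  exact ⟨s, hs.1, hs.2, fun s' h h' => hmin s' ⟨h, h'⟩⟩

theorem distribution_zero (N n : ℕ) (w : ℕ → ℕ → ℕ) : Distribution N n w 0 fun _ _ => 0 where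
  supp _ _ _ _ _ _ := rfl
  sum m _ h := by simp [h rfl]
  opt m _ _ f hf _ := le_of_eq <| sum_congr rfl fun b hb => by
    rw [hf b (mem_range.mp hb) (Nat.zero_le b)]

/-- Optimal substructure: apart from the share of label `j`, a competitor distributes the remaining
points over the labels below `j`. The clauses with `j = 0` reflect that without labels only 0 points
can be distributed, so the first label must take all. -/
theorem Distribution.step {N n : ℕ} {w : ℕ → ℕ → ℕ} {j : ℕ} {sol sol' : ℕ → ℕ → ℕ}
    (h : Distribution N n w j sol) (hn : n < N) (hj : j < N)
    (hsol' : ∀ m ≤ n, ∀ b < N, sol' m b =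
      if b = j then bestSplit N w j sol m else sol (m - bestSplit N w j sol m) b) :
    Distribution N n w (j + 1) sol' := by
  have hjN : j ∈ range N := mem_range.mpr hj
  have split : ∀ (f : ℕ → ℕ), ∑ b ∈ range N, f b = f j + ∑ b ∈ (range N).erase j, f b :=
    fun f => (add_sum_erase _ _ hjN).symm
  have rest : ∀ (f f' : ℕ → ℕ), (∀ b < N, b ≠ j → f b = f' b) →
      ∑ b ∈ (range N).erase j, f b = ∑ b ∈ (range N).erase j, f' b := fun f f' hf =>
    sum_congr rfl fun b hb => hf b (mem_range.mp (mem_of_mem_erase hb)) (ne_of_mem_erase hb)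
  refine ⟨?_, ?_, ?_⟩
  · intro m hm _ b hb hjb
    obtain ⟨⟨h1, h2⟩, -⟩ := bestSplit_spec w j sol (hm.trans_lt hn)
    rw [hsol' m hm b hb, if_neg (by omega)]
    exact h.supp _ (by omega) (fun h0 => by rw [h2 h0, Nat.sub_self]) b hb (by omega)
  · intro m hm _
    obtain ⟨⟨h1, h2⟩, -⟩ := bestSplit_spec w j sol (hm.trans_lt hn)
    have h3 : j = 0 → m - bestSplit N w j sol m = 0 := fun h0 => by rw [h2 h0, Nat.sub_self]
    have h4 := h.sum (m - bestSplit N w j sol m) (by omega) h3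
    rw [split, h.supp _ (by omega) h3 j hj le_rfl] at h4
    rw [split, hsol' m hm j hj, if_pos rfl, rest _ (sol (m - bestSplit N w j sol m))
      fun b hb hbj => by rw [hsol' m hm b hb, if_neg hbj]]
    omega
  · intro m hm _ f hf hfm
    obtain ⟨-, h2⟩ := bestSplit_spec w j sol (hm.trans_lt hn)
    have hfj : f j ≤ m := by
      rw [← hfm]
      exact single_le_sum (f := f) (fun _ _ => Nat.zero_le _) hjN
    have hf0 : j = 0 → f j = m := by
      intro h0
      rw [← hfm, split, left_eq_add]
      exact sum_eq_zero fun b hb => hf b (mem_range.mp (mem_of_mem_erase hb)) (by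
        have := ne_of_mem_erase hb
        omega)
    have h3 := h2 (f j) (by omega) ⟨hfj, hf0⟩
    have h4 : ∑ b ∈ range N, w b (sol' m b) = splitWeight N w j sol m (bestSplit N w j sol m) :=
      sum_congr rfl fun b hb => by rw [hsol' m hm b (mem_range.mp hb)]
    rw [h4]
    refine h3.trans ?_
    have h5 : j = 0 → m - f j = 0 := fun h0 => by rw [hf0 h0, Nat.sub_self]
    -- The competitor without its share at `j`; both sides of the comparison have weight `w j 0`
    -- there, which cancels.
    have h6 := h.opt (m - f j) (by omega) h5 (Function.update f j 0) (by
        intro b hb hjb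
        by_cases hbj : b = j
        · rw [hbj, Function.update_self]
        · rw [Function.update_of_ne hbj]
          exact hf b hb (by omega)) (by
        rw [split, Function.update_self,
          rest _ f fun b _ hbj => Function.update_of_ne hbj _ _]
        rw [split] at hfm
        omega)
    rw [split, split fun b => w b (Function.update f j 0 b),
      h.supp _ (by omega) h5 j hj le_rfl, Function.update_self, Nat.add_le_add_iff_left,
      rest (fun b => w b (Function.update f j 0 b)) (fun b => w b (f b))
        fun b _ hbj => by rw [Function.update_of_ne hbj]] at h6
    rw [splitWeight, split, split fun b => w b (f b), if_pos rfl,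
      rest _ (fun b => w b (sol (m - f j) b)) fun b _ hbj => by rw [if_neg hbj]]
    omega

/-! ### The program -/

section Program

variable {Γ : Type} [Ctx Γ]

/-- The `+` edges, given by the input matrix. -/
def Plus (n : ℕ) (a : ℕ → ℕ) (u v : ℕ) : Prop := (u < n ∧ v < n) ∧ a (u * n + v) ≠ 0

/-- The pairs marked in a matrix. -/
def Marked (n : ℕ) (a : ℕ → ℕ) (u v : ℕ) : Prop := (u < n ∧ v < n) ∧ a (u * (2 * n + 1) + v) ≠ 0

/-- The `+` edges after flipping the marked edges. -/
def Flipped (n : ℕ) (A : Arr) (u v : ℕ) : Prop :=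
  u ≠ v ∧ ¬ (Plus n (A 1) u v ↔ Marked n (A 3) u v)

/-- Mark an ordered pair. -/
def mark (n x y : ℕ) (A : Arr) : Arr :=
  Function.update A 3 (Function.update (A 3) (x * (2 * n + 1) + y) 1)

/-- A bad triangle, disjoint from the marked edges. -/
def Addable (n u v w : ℕ) (A : Arr) : Prop :=
  ((Plus n (A 1) u v ∧ Plus n (A 1) u w) ∧ (¬ Plus n (A 1) v w ∧ v ≠ w)) ∧
    (¬ Marked n (A 3) u v ∧ ¬ Marked n (A 3) u w) ∧ ¬ Marked n (A 3) v w

/-- Mark the edges of a bad triangle that is disjoint from the marked edges. -/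
noncomputable def addTriangle (n u v w : ℕ) (A : Arr) : Arr :=
  if Addable n u v w A then
    mark n w v (mark n v w (mark n w u (mark n u w (mark n v u (mark n u v A)))))
  else A

/-- Mark a maximal packing of bad triangles. -/
noncomputable def packing (n : ℕ) (A : Arr) : Arr :=
  iter (fun u => iter (fun v => iter (fun w => addTriangle n u v w) (2 * n + 1)) (2 * n + 1))
    (2 * n + 1) A

/-- The number of ordered pairs of unlabelled points that form a bad triangle with `p` and
satisfy `Q`. -/
noncomputable def pivotCount (n : ℕ) (A : Arr) (p : ℕ) (Q : ℕ → ℕ → Prop) : ℕ :=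
  ∑ x ∈ range (2 * n + 1), #{y ∈ range n | ((x < n ∧ A 5 x = 0) ∧ A 5 y = 0) ∧
    Bad (Flipped n A) p x y ∧ Q x y}

/-- The next pivot. -/
noncomputable def pivot (n : ℕ) (A : Arr) : ℕ :=
  first (2 * n + 1) fun p => (p < n ∧ A 5 p = 0) ∧
    pivotCount n A p (fun _ _ => True) ≤ pivotCount n A p (Marked n (A 3)) +
      (pivotCount n A p (Marked n (A 3)) + pivotCount n A p (Marked n (A 3)))

/-- Find a pivot, and label its cluster. -/
noncomputable def pivotRound (n : ℕ) (A : Arr) : Arr :=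
  -- The pivot is saved before the labels change. The new labels go to array 13 first, since filling
  -- an array must not read that array.
  let B := Function.update A 6 (Function.update (A 6) 0 (pivot n A))
  let C := fill 13 (2 * n + 1) (fun u => if B 5 u ≠ 0 then B 5 u else
    if u = B 6 0 ∨ Flipped n B (B 6 0) u then B 6 0 + 1 else 0) B
  fill 5 (2 * n + 1) (C 13) C

/-- Write the weights to an array. -/
noncomputable def weights (n : ℕ) (A : Arr) : Arr :=
  -- The minimum changes no entry, since `s < 2 * n + 1` in the matrix; it supplies the bound needed
  -- for multiplication.
  fillMatrix 7 (2 * n + 1) (fun b s => weight n (A 0) (A 5) b (min s (2 * n + 1))) A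

/-- A matrix in row-major order. -/
def matrix (n : ℕ) (a : ℕ → ℕ) (i j : ℕ) : ℕ := a (i * (2 * n + 1) + j)

/-- One round of dynamic programming. -/
noncomputable def distributeRound (n j : ℕ) (A : Arr) : Arr :=
  let B := fill 12 (2 * n + 1) (bestSplit (2 * n + 1) (matrix n (A 7)) j (matrix n (A 10))) A
  let C := fillMatrix 11 (2 * n + 1)
    (fun m b => if b = j then B 12 m else matrix n (B 10) (m - B 12 m) b) B
  fillMatrix 10 (2 * n + 1) (fun m b => matrix n (C 11) m b) C

/-- The sizes of the clusters, made to be small. -/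
def sizes (n : ℕ) (A : Arr) (b : ℕ) : ℕ := min (A 10 (n * (2 * n + 1) + b)) (2 * n + 1)

/-- The whole computation. -/
noncomputable def fairClustering (n : ℕ) (A : Arr) : Arr :=
  let B := weights n (iter (fun _ => pivotRound n) (2 * n + 1) (packing n A))
  let C := iter (distributeRound n) (2 * n + 1) B
  fill 2 (2 * n + 1) (newLabel n (C 0) (C 5) (sizes n C)) C

/-! ### Polynomial running time of the packing and of the choice of pivots -/

theorem decides_plus {f f' : Γ → Arr → ℕ} (hf : Computes f) (hf' : Computes f') :
    Decides (fun g A => Plus (Ctx.size g) (A 1) (f g A) (f' g A)) :=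
  ((Decides.lt hf .size).and (.lt hf' .size)).and
    (.ne ((hf.mul_size.add hf').arr 1) (.const 0))

theorem decides_marked {f f' : Γ → Arr → ℕ} (hf : Computes f) (hf' : Computes f') :
    Decides (fun g A => Marked (Ctx.size g) (A 3) (f g A) (f' g A)) :=
  ((Decides.lt hf .size).and (.lt hf' .size)).and (.ne (hf.entry 3 hf') (.const 0))

theorem decides_flipped {f f' : Γ → Arr → ℕ} (hf : Computes f) (hf' : Computes f') :
    Decides (fun g A => Flipped (Ctx.size g) A (f g A) (f' g A)) :=
  (Decides.ne hf hf').and ((decides_plus hf hf').iff (decides_marked hf hf')).not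

theorem decides_bad {f f' f'' : Γ → Arr → ℕ} (hf : Computes f) (hf' : Computes f')
    (hf'' : Computes f'') :
    Decides (fun g A => Bad (Flipped (Ctx.size g) A) (f g A) (f' g A) (f'' g A)) := by
  have h1 := decides_flipped hf hf'
  have h2 := decides_flipped hf hf''
  have h3 := decides_flipped hf' hf''
  exact ((Decides.ne hf hf').and ((Decides.ne hf hf'').and (.ne hf' hf''))).and
    ((h1.and (h2.and h3.not)).or ((h1.and (h2.not.and h3)).or (h1.not.and (h2.and h3))))

theorem executes_mark {f f' : Γ → ℕ} (hf : Computes fun g _ => f g)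
    (hf' : Computes fun g _ => f' g) :
    Executes (fun g A => mark (Ctx.size g) (f g) (f' g) A) :=
  Executes.store 3 (hf.mul_bound.add hf') (.const 1)

theorem executes_packing : Executes packing := by
  have v0 : Computes fun (g : ((ℕ × ℕ) × ℕ) × ℕ) _ => g.1.1.2 := Computes.last.weaken.weaken
  have v1 : Computes fun (g : ((ℕ × ℕ) × ℕ) × ℕ) _ => g.1.2 := Computes.last.weaken
  have v2 : Computes fun (g : ((ℕ × ℕ) × ℕ) × ℕ) _ => g.2 := Computes.last
  have c : Decides fun (g : ((ℕ × ℕ) × ℕ) × ℕ) A => Addable (Ctx.size g) g.1.1.2 g.1.2 g.2 A :=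
    (((decides_plus v0 v1).and (decides_plus v0 v2)).and
      ((decides_plus v1 v2).not.and (.ne v1 v2))).and
      (((decides_marked v0 v1).not.and (decides_marked v0 v2).not).and (decides_marked v1 v2).not)
  have h : Executes fun (g : ((ℕ × ℕ) × ℕ) × ℕ) A =>
      addTriangle (Ctx.size g) g.1.1.2 g.1.2 g.2 A :=
    Executes.ite c ((((((executes_mark v0 v1).seq (executes_mark v1 v0)).seq
      (executes_mark v0 v2)).seq (executes_mark v2 v0)).seq (executes_mark v1 v2)).seq
      (executes_mark v2 v1))
  exact h.loop.loop.loop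

theorem computes_pivotCount {f : Γ → Arr → ℕ} (hf : Computes f)
    {Q : ℕ → Arr → ℕ → ℕ → Prop}
    (hQ : Decides fun (g : (Γ × ℕ) × ℕ) A => Q (Ctx.size g) A g.1.2 g.2) :
    Computes (fun g A => pivotCount (Ctx.size g) A (f g A) (Q (Ctx.size g) A)) := by
  have x : Computes fun (g : (Γ × ℕ) × ℕ) _ => g.1.2 := Computes.last.weaken
  have y : Computes fun (g : (Γ × ℕ) × ℕ) _ => g.2 := Computes.last
  exact Computes.sum (Computes.count_size'
    ((((Decides.lt x .size).and (.eq (x.arr 5) (.const 0))).and (.eq (y.arr 5) (.const 0))).and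
      ((decides_bad hf.weaken.weaken x y).and hQ)))

theorem computes_pivot : Computes (fun (g : Γ) A => pivot (Ctx.size g) A) := by
  have p : Computes fun (g : Γ × ℕ) _ => g.2 := Computes.last
  have h1 := computes_pivotCount p (Q := fun _ _ _ _ => True)
    ((Decides.eq (.const 0) (.const 0)).congr fun _ _ => by simp)
  have h2 := computes_pivotCount p (Q := fun n A => Marked n (A 3))
    (decides_marked Computes.last.weaken Computes.last)
  exact Computes.first (((Decides.lt p .size).and (.eq (p.arr 5) (.const 0))).and
    (.le h1 (h2.add (h2.add h2))))

end Program

end FairCC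

namespace FairCC

open Finset
open scoped Classical

/-! ### Polynomial running time of the pivot rounds and of the fair reassignment -/

section Program

variable {Γ : Type} [Ctx Γ]

theorem executes_pivotRound : Executes (fun (g : Γ) A => pivotRound (Ctx.size g) A) := by
  have u : Computes fun (g : Γ × ℕ) _ => g.2 := Computes.last
  have p : Computes fun (_ : Γ × ℕ) A => A 6 0 := (Computes.const 0).arr 6
  refine ((Executes.store 6 (.const 0) computes_pivot).seq (Executes.fill 13
    (Decides.ite' (.ne (u.arr 5) (.const 0)) (u.arr 5)
      (Decides.ite' ((Decides.eq u p).or (decides_flipped p u)) (p.add (.const 1)) (.const 0)))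
    ?_)).seq (Executes.fill 5 (u.arr 13) ?_)
  · intro g A B h
    have hF : Flipped (Ctx.size g) A = Flipped (Ctx.size g) B := by
      funext x y
      simp only [Flipped, h 1 (by decide), h 3 (by decide)]
    simp only [hF, h 5 (by decide), h 6 (by decide)]
  · intro g A B h
    simp only [h 13 (by decide)]

theorem colorSize_le (n : ℕ) (χ : ℕ → ℕ) (v : ℕ) : colorSize n χ v ≤ n :=
  (card_filter_le _ _).trans (card_range n).le

theorem clusterSize_le (n : ℕ) (L : ℕ → ℕ) (b : ℕ) : clusterSize n L b ≤ n :=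
  (card_filter_le _ _).trans (card_range n).le

theorem computes_colorSize {f : Γ → Arr → ℕ} (hf : Computes f) :
    Computes (fun g A => colorSize (Ctx.size g) (A 0) (f g A)) :=
  Computes.count_size' (.eq (Computes.last.arr 0) (hf.weaken.arr 0))

theorem computes_clusterSize {f : Γ → Arr → ℕ} (hf : Computes f) :
    Computes (fun g A => clusterSize (Ctx.size g) (A 5) (f g A)) :=
  Computes.count_size' (.eq (Computes.last.arr 5) hf.weaken)

theorem computes_colorInCluster {f f' : Γ → Arr → ℕ} (hf : Computes f) (hf' : Computes f') :
    Computes (fun g A => colorInCluster (Ctx.size g) (A 0) (A 5) (f g A) (f' g A)) :=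
  Computes.count_size' ((Decides.eq (Computes.last.arr 5) hf.weaken).and
    (.eq (Computes.last.arr 0) (hf'.weaken.arr 0)))

theorem computes_rank {f : Γ → Arr → ℕ} (hf : Computes f) :
    Computes (fun g A => rank (Ctx.size g) (A 0) (A 5) (f g A)) :=
  Computes.count_size' ((Decides.lt Computes.last hf.weaken).and
    ((Decides.eq (Computes.last.arr 5) (hf.weaken.arr 5)).and
      (.eq (Computes.last.arr 0) (hf.weaken.arr 0))))

/-- Division, if divisor and quotient are not too large. -/
theorem Computes.div {f f' : Γ → Arr → ℕ} (hf : Computes f) (hf' : Computes f')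
    (h' : ∀ g A, f' g A ≤ bound g) (h : ∀ g A, f g A / f' g A ≤ bound g) :
    Computes (fun g A => f g A / f' g A) := by
  have hc : Decides fun (g : Γ × ℕ) A => (g.2 + 1) * f' g.1 A ≤ f g.1 A :=
    Decides.le ((Computes.last.add (.const 1)).mul hf'.weaken fun g A => h' g.1 A) hf.weaken
  have := Decides.ite' (inst := fun _ _ => Classical.propDecidable _) (.eq hf' (.const 0)) (.const 0)
    (Computes.count hc)
  convert this using 3 with g A
  split_ifs with h0
  · rw [h0, Nat.div_zero]
  · have hs : {i ∈ range (bound g) | (i + 1) * f' g A ≤ f g A} = range (f g A / f' g A) := by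
      ext i
      rw [mem_filter, mem_range, mem_range, ← Nat.le_div_iff_mul_le (Nat.pos_of_ne_zero h0)]
      have := h g A
      omega
    simp only [hs, card_range]

/-- Division by bounded search applies because a color has at most `n` points, so the quota is at
most the size of the cluster. -/
theorem computes_quota {f f' : Γ → Arr → ℕ} (hf : Computes f) (hf' : Computes f')
    (h : ∀ g A, f g A ≤ bound g) :
    Computes (fun g A => quota (Ctx.size g) (A 0) (f g A) (f' g A)) := by
  have hs : ∀ g : Γ, Ctx.size g ≤ bound g := fun g => by rw [bound]; omega
  refine (hf.mul (computes_colorSize hf') fun g A => (colorSize_le _ _ _).trans (hs g)).div .size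
    (fun g _ => hs g) fun g A => le_trans ?_ (h g A)
  exact Nat.div_le_of_le_mul (by
    rw [mul_comm]
    exact Nat.mul_le_mul_right _ (colorSize_le _ _ _))

theorem decides_admissible {f : Γ → Arr → ℕ} (hf : Computes f) (h : ∀ g A, f g A ≤ bound g) :
    Decides (fun g A => Admissible (Ctx.size g) (A 0) (f g A)) := by
  have hs : ∀ g : Γ, Ctx.size g ≤ bound g := fun g => by rw [bound]; omega
  have v : Computes fun (g : Γ × ℕ) _ => g.2 := Computes.last
  refine (Decides.all ((Decides.lt v .size).imp (.eq (computes_quota hf.weaken v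
    fun g A => h g.1 A).mul_size (hf.weaken.mul (computes_colorSize v)
      fun g A => (colorSize_le _ _ _).trans (hs g.1))))).congr fun g A => ?_
  exact ⟨fun h v hv => h v (hv.trans_le (hs g)) hv, fun h v _ hv => h v hv⟩

theorem computes_keep {f f' : Γ → Arr → ℕ} (hf : Computes f) (hf' : Computes f')
    (h : ∀ g A, f' g A ≤ bound g) :
    Computes (fun g A => keep (Ctx.size g) (A 0) (A 5) (f g A) (f' g A)) :=
  Computes.count_size' ((Decides.eq (Computes.last.arr 5) hf.weaken).and
    (.lt (computes_rank Computes.last) (computes_quota hf'.weaken .last fun g A => h g.1 A)))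

theorem Computes.bound : Computes (fun (g : Γ) _ => bound g) := by
  simpa only [FairCC.bound, two_mul] using (Computes.size.add Computes.size).add (const 1)

theorem computes_weight {f f' : Γ → Arr → ℕ} (hf : Computes f) (hf' : Computes f')
    (h : ∀ g A, f' g A ≤ bound g) :
    Computes (fun g A => weight (Ctx.size g) (A 0) (A 5) (f g A) (f' g A)) := by
  have hs : ∀ g : Γ, Ctx.size g ≤ FairCC.bound g := fun g => by rw [FairCC.bound]; omega
  have hk := computes_keep hf hf' h
  exact Decides.ite' (decides_admissible hf' h)
    ((((computes_clusterSize hf).sub hk).mul (computes_clusterSize hf)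
      fun g A => (clusterSize_le _ _ _).trans (hs g)).add ((hf'.sub hk).mul hf' h))
    Computes.bound.mul_bound

theorem Computes.min {f f' : Γ → Arr → ℕ} (hf : Computes f) (hf' : Computes f') :
    Computes (fun g A => min (f g A) (f' g A)) := by
  convert hf.sub (hf.sub hf') using 3 with g A
  omega

theorem executes_weights : Executes (fun (g : Γ) A => weights (Ctx.size g) A) := by
  refine Executes.fillMatrix 7 (computes_weight Computes.last.weaken
    (Computes.last.min .bound) fun g A => min_le_right _ _) ?_
  intro g A B h
  simp only [h 0 (by decide), h 5 (by decide)]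

theorem computes_matrix (a : ℕ) {f f' : Γ → Arr → ℕ} (hf : Computes f) (hf' : Computes f') :
    Computes (fun g A => matrix (Ctx.size g) (A a) (f g A) (f' g A)) :=
  hf.entry a hf'

theorem computes_splitWeight {j m s : Γ → Arr → ℕ} (hj : Computes j) (hm : Computes m)
    (hs : Computes s) : Computes (fun g A => splitWeight (2 * Ctx.size g + 1)
      (matrix (Ctx.size g) (A 7)) (j g A) (matrix (Ctx.size g) (A 10)) (m g A) (s g A)) :=
  Computes.sum (computes_matrix 7 .last (Decides.ite' (.eq .last hj.weaken) hs.weaken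
    (computes_matrix 10 (hm.weaken.sub hs.weaken) .last)))

theorem computes_bestSplit {j m : Γ → Arr → ℕ} (hj : Computes j) (hm : Computes m) :
    Computes (fun g A => bestSplit (2 * Ctx.size g + 1)
      (matrix (Ctx.size g) (A 7)) (j g A) (matrix (Ctx.size g) (A 10)) (m g A)) := by
  have s : Computes fun (g : (Γ × ℕ) × ℕ) _ => g.1.2 := Computes.last.weaken
  have s' : Computes fun (g : (Γ × ℕ) × ℕ) _ => g.2 := Computes.last
  have hj' := hj.weaken.weaken
  have hm' := hm.weaken.weaken
  exact Computes.first (((Decides.le .last hm.weaken).and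
    ((Decides.eq hj.weaken (.const 0)).imp (.eq .last hm.weaken))).and
    (Decides.all (((Decides.le s' hm').and ((Decides.eq hj' (.const 0)).imp (.eq s' hm'))).imp
      (.le (computes_splitWeight hj' hm' s) (computes_splitWeight hj' hm' s')))))

theorem executes_distributeRound :
    Executes (fun (g : Γ × ℕ) A => distributeRound (Ctx.size g) g.2 A) := by
  have j : Computes fun (g : (Γ × ℕ) × ℕ) _ => g.1.2 := Computes.last.weaken
  have j' : Computes fun (g : ((Γ × ℕ) × ℕ) × ℕ) _ => g.1.1.2 := Computes.last.weaken.weaken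
  have m : Computes fun (g : ((Γ × ℕ) × ℕ) × ℕ) _ => g.1.2 := Computes.last.weaken
  have b : Computes fun (g : ((Γ × ℕ) × ℕ) × ℕ) _ => g.2 := Computes.last
  refine ((Executes.fill 12 (computes_bestSplit j .last) ?_).seq
    (Executes.fillMatrix 11 (Decides.ite' (.eq b j') (m.arr 12)
      (computes_matrix 10 (m.sub (m.arr 12)) b)) ?_)).seq
    (Executes.fillMatrix 10 (computes_matrix 11 m b) ?_)
  · intro g A B h
    simp only [h 7 (by decide), h 10 (by decide)]
  · intro g A B h
    simp only [h 10 (by decide), h 12 (by decide)]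
  · intro g A B h
    simp only [h 11 (by decide)]

theorem computes_sizes {f : Γ → Arr → ℕ} (hf : Computes f) :
    Computes (fun g A => sizes (Ctx.size g) A (f g A)) :=
  (Computes.size.entry 10 hf).min .bound

theorem sizes_le (n : ℕ) (A : Arr) (b : ℕ) : sizes n A b ≤ 2 * n + 1 := min_le_right _ _

theorem decides_excess {f : Γ → Arr → ℕ} (hf : Computes f) :
    Decides (fun g A => Excess (Ctx.size g) (A 0) (A 5) (sizes (Ctx.size g) A) (f g A)) :=
  Decides.le (computes_quota (computes_sizes (hf.arr 5)) hf fun _ _ => sizes_le _ _ _)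
    (computes_rank hf)

theorem computes_newLabel {f : Γ → Arr → ℕ} (hf : Computes f) :
    Computes (fun g A => newLabel (Ctx.size g) (A 0) (A 5) (sizes (Ctx.size g) A) (f g A)) := by
  have hr : Computes (fun (g : Γ × ℕ) A =>
      excessRank (Ctx.size g) (A 0) (A 5) (sizes (Ctx.size g) A) (f g.1 A)) :=
    Computes.count_size' ((Decides.lt .last hf.weaken.weaken).and
      ((Decides.eq (Computes.last.arr 0) (hf.weaken.weaken.arr 0)).and (decides_excess .last)))
  have hd : Computes (fun (g : (Γ × ℕ) × ℕ) A =>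
      deficit (Ctx.size g) (A 0) (A 5) (sizes (Ctx.size g) A) g.2 (f g.1.1 A)) :=
    (computes_quota (computes_sizes .last) hf.weaken.weaken fun _ _ => sizes_le _ _ _).sub
      (computes_colorInCluster .last hf.weaken.weaken)
  exact Decides.ite' (decides_excess hf)
    (Computes.count' (.le (Computes.sum (Decides.ite' (.le .last Computes.last.weaken) hd
      (.const 0))) hr)) (hf.arr 5)

theorem executes_fairClustering : Executes fairClustering := by
  have h1 : Executes fun (n : ℕ) A => weights n
      (iter (fun _ => pivotRound n) (2 * n + 1) (packing n A)) :=
    (executes_packing.seq (Executes.loop (Γ := ℕ) executes_pivotRound)).seq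
      (executes_weights (Γ := ℕ))
  have h2 : Executes fun (n : ℕ) A => fill 2 (2 * n + 1) (newLabel n (A 0) (A 5) (sizes n A)) A := by
    refine Executes.fill (Γ := ℕ) 2 (computes_newLabel .last) ?_
    intro g A B h
    have hs : sizes (Ctx.size g) A = sizes (Ctx.size g) B := funext fun b => by
      simp only [sizes, h 10 (by decide)]
    simp only [h 0 (by decide), h 5 (by decide), hs]
  exact (h1.seq (Executes.loop (Γ := ℕ) executes_distributeRound)).seq h2

end Program

end FairCC

namespace FairCC

open Finset
open scoped Classical

/-! ### Correctness of the program -/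

/-- The marked pairs. -/
noncomputable def markedPairs (n : ℕ) (A : Arr) : Finset (ℕ × ℕ) :=
  {q ∈ range n ×ˢ range n | Marked n (A 3) q.1 q.2}

theorem mem_markedPairs {n : ℕ} {A : Arr} {q : ℕ × ℕ} :
    q ∈ markedPairs n A ↔ Marked n (A 3) q.1 q.2 := by
  rw [markedPairs, mem_filter, mem_product, mem_range, mem_range]
  exact ⟨fun h => h.2, fun h => ⟨h.1, h⟩⟩

/-- The marked pairs are the edges of a packing of bad triangles. -/
structure Packing (n : ℕ) (A : Arr) : Prop where
  symm : ∀ u v, Marked n (A 3) u v → Marked n (A 3) v u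
  card_le : ∀ M : ℕ → ℕ, #(markedPairs n A) ≤
    3 * #(markedPairs n A ∩ disagree n (Plus n (A 1)) (SameLabel M))

/-- A bad triangle has a marked edge. -/
def Covered (n : ℕ) (A : Arr) (u v w : ℕ) : Prop :=
  Plus n (A 1) u v → Plus n (A 1) u w → ¬ Plus n (A 1) v w → v ≠ w →
    Marked n (A 3) u v ∨ Marked n (A 3) u w ∨ Marked n (A 3) v w

theorem mark_of_ne {n x y b : ℕ} {A : Arr} (hb : b ≠ 3) : mark n x y A b = A b :=
  Function.update_of_ne hb _ _

theorem marked_mark {n x y u v : ℕ} {A : Arr} (hx : x < n) (hy : y < n) :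
    Marked n (mark n x y A 3) u v ↔ Marked n (A 3) u v ∨ (u = x ∧ v = y) := by
  rw [Marked, Marked, mark, Function.update_self, Function.update_apply]
  by_cases h : u < n ∧ v < n
  · simp only [entry_inj (show v < 2 * n + 1 by omega) (show y < 2 * n + 1 by omega)]
    by_cases h' : u = x ∧ v = y <;> simp [h, h', hx, hy]
  · have : ¬ (u = x ∧ v = y) := by
      rintro ⟨rfl, rfl⟩
      exact h ⟨hx, hy⟩
    tauto

/-- The memory grows: `B` agrees with `A` but for array 3, where it has more marks. -/
def MoreMarks (n : ℕ) (A B : Arr) : Prop :=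
  (∀ b, b ≠ 3 → B b = A b) ∧ ∀ u v, Marked n (A 3) u v → Marked n (B 3) u v

theorem MoreMarks.refl (n : ℕ) (A : Arr) : MoreMarks n A A := ⟨fun _ _ => rfl, fun _ _ h => h⟩

theorem MoreMarks.trans {n : ℕ} {A B C : Arr} (h : MoreMarks n A B) (h' : MoreMarks n B C) :
    MoreMarks n A C :=
  ⟨fun b hb => (h'.1 b hb).trans (h.1 b hb), fun u v hm => h'.2 u v (h.2 u v hm)⟩

theorem Covered.mono {n u v w : ℕ} {A B : Arr} (h : Covered n A u v w) (h' : MoreMarks n A B) :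
    Covered n B u v w := by
  unfold Covered at *
  rw [h'.1 1 (by decide)]
  have h1 := h'.2 u v
  have h2 := h'.2 u w
  have h3 := h'.2 v w
  tauto

theorem trianglePairs_symm {u v w x y : ℕ} (h : (x, y) ∈ trianglePairs u v w) :
    (y, x) ∈ trianglePairs u v w := by
  simp only [trianglePairs, mem_insert, mem_singleton, Prod.mk.injEq] at h ⊢
  omega

/-- If the test succeeds, six new pairs are marked, disjoint from the old ones; if it fails, the
triangle is not bad or already has a marked edge. It is covered in both cases. -/
theorem addTriangle_spec {n : ℕ} {A : Arr} (hs : ∀ u v, Plus n (A 1) u v → Plus n (A 1) v u)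
    (hi : ∀ u, ¬ Plus n (A 1) u u) (hA : Packing n A) (u v w : ℕ) :
    Packing n (addTriangle n u v w A) ∧ MoreMarks n A (addTriangle n u v w A) ∧
      Covered n (addTriangle n u v w A) u v w := by
  by_cases h : Addable n u v w A
  · have h' := h
    obtain ⟨⟨⟨huv, huw⟩, hvw, hne⟩, ⟨m1, m2⟩, m3⟩ := h'
    obtain ⟨⟨hu, hv⟩, -⟩ := huv
    obtain ⟨⟨-, hw⟩, -⟩ := huw
    have hmarked : ∀ x y, Marked n (addTriangle n u v w A 3) x y ↔
        Marked n (A 3) x y ∨ (x, y) ∈ trianglePairs u v w := by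
      intro x y
      rw [addTriangle, if_pos h, marked_mark hw hv, marked_mark hv hw, marked_mark hw hu,
        marked_mark hu hw, marked_mark hv hu, marked_mark hu hv]
      simp only [trianglePairs, mem_insert, mem_singleton, Prod.mk.injEq, or_assoc]
    have hother : ∀ b, b ≠ 3 → addTriangle n u v w A b = A b := by
      intro b hb
      rw [addTriangle, if_pos h]
      simp only [mark_of_ne hb]
    have hset : markedPairs n (addTriangle n u v w A) = markedPairs n A ∪ trianglePairs u v w := by
      ext ⟨x, y⟩
      rw [mem_markedPairs, hmarked, mem_union, mem_markedPairs]
    have ne1 : u ≠ v := by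
      rintro rfl
      exact hi _ h.1.1.1
    have ne2 : u ≠ w := by
      rintro rfl
      exact hi _ h.1.1.2
    refine ⟨⟨?_, fun M => ?_⟩, ⟨hother, fun x y hm => (hmarked x y).mpr (Or.inl hm)⟩, ?_⟩
    · intro x y hm
      rw [hmarked] at hm ⊢
      exact hm.imp (hA.symm x y) trianglePairs_symm
    · rw [hset, hother 1 (by decide)]
      refine card_packing_step hs (hA.card_le M) hu hv hw h.1.1.1 h.1.1.2 hvw ne1 ne2 hne ?_
      rw [disjoint_right]
      rintro ⟨x, y⟩ hm hm'
      rw [mem_markedPairs] at hm'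
      simp only [trianglePairs, mem_insert, mem_singleton, Prod.mk.injEq] at hm
      rcases hm with ⟨h1, h2⟩ | ⟨h1, h2⟩ | ⟨h1, h2⟩ | ⟨h1, h2⟩ | ⟨h1, h2⟩ | ⟨h1, h2⟩ <;>
        rw [h1, h2] at hm'
      exacts [m1 hm', m1 (hA.symm _ _ hm'), m2 hm', m2 (hA.symm _ _ hm'), m3 hm',
        m3 (hA.symm _ _ hm')]
    · intro _ _ _ _
      exact Or.inl ((hmarked u v).mpr (Or.inr (by simp [trianglePairs])))
  · have h' := h
    rw [addTriangle, if_neg h]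
    refine ⟨hA, MoreMarks.refl n A, ?_⟩
    unfold Addable at h'
    unfold Covered
    tauto

theorem packing_spec {n : ℕ} {A : Arr} (hs : ∀ u v, Plus n (A 1) u v → Plus n (A 1) v u)
    (hi : ∀ u, ¬ Plus n (A 1) u u) (hA : ∀ u v, ¬ Marked n (A 3) u v) :
    Packing n (packing n A) ∧ MoreMarks n A (packing n A) ∧
      ∀ u < 2 * n + 1, ∀ v < 2 * n + 1, ∀ w < 2 * n + 1, Covered n (packing n A) u v w := by
  have h0 : Packing n A := by
    refine ⟨fun u v h => absurd h (hA u v), fun M => ?_⟩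
    rw [show markedPairs n A = ∅ from eq_empty_of_forall_notMem fun q hq =>
      hA _ _ (mem_markedPairs.mp hq)]
    simp
  -- One loop of the three. Marks are never removed, so triangles stay covered in later rounds, and
  -- one pass suffices for maximality.
  have key : ∀ (P : ℕ → Arr → Prop), (∀ i B C, P i B → MoreMarks n B C → P i C) →
      ∀ (F : ℕ → Arr → Arr), (∀ i < 2 * n + 1, ∀ B, Packing n B ∧ B 1 = A 1 →
        Packing n (F i B) ∧ MoreMarks n B (F i B) ∧ P i (F i B)) →
      ∀ B, Packing n B ∧ B 1 = A 1 → Packing n (iter F (2 * n + 1) B) ∧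
        MoreMarks n B (iter F (2 * n + 1) B) ∧ ∀ i < 2 * n + 1, P i (iter F (2 * n + 1) B) := by
    intro P hP F hF B hB
    obtain ⟨h1, h2, h3⟩ := iter_spec (F := F) (m := 2 * n + 1) (fun B => Packing n B ∧ B 1 = A 1)
      (MoreMarks n) P (MoreMarks.refl n) (fun _ _ _ => MoreMarks.trans) hP
      (fun i hi B hB => by
        obtain ⟨h1, h2, h3⟩ := hF i hi B hB
        exact ⟨⟨h1, (h2.1 1 (by decide)).trans hB.2⟩, h2, h3⟩) hB
    exact ⟨h1.1, h2, h3⟩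
  refine key (fun u B => ∀ v < 2 * n + 1, ∀ w < 2 * n + 1, Covered n B u v w)
    (fun u B C h h' v hv w hw => (h v hv w hw).mono h') _ (fun u _ => ?_) A ⟨h0, rfl⟩
  refine key (fun v B => ∀ w < 2 * n + 1, Covered n B u v w)
    (fun v B C h h' w hw => (h w hw).mono h') _ (fun v _ => ?_)
  refine key (fun w B => Covered n B u v w) (fun w B C h h' => h.mono h') _ (fun w _ => ?_)
  rintro B ⟨hB, hB1⟩
  exact addTriangle_spec (by rwa [hB1]) (by rwa [hB1]) hB u v w

/-- Every bad triangle of the modified graph has a marked edge. -/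
theorem marked_of_bad {n : ℕ} {A : Arr} (hs : ∀ u v, Plus n (A 1) u v → Plus n (A 1) v u)
    (hA : Packing n A) (hc : ∀ u < 2 * n + 1, ∀ v < 2 * n + 1, ∀ w < 2 * n + 1, Covered n A u v w)
    {x y z : ℕ} (h : Bad (Flipped n A) x y z) :
    Marked n (A 3) x y ∨ Marked n (A 3) x z ∨ Marked n (A 3) y z := by
  by_contra hm
  push Not at hm
  obtain ⟨m1, m2, m3⟩ := hm
  obtain ⟨⟨n1, n2, n3⟩, h⟩ := h
  have cov : ∀ u v w, Plus n (A 1) u v → Plus n (A 1) u w → ¬ Plus n (A 1) v w → v ≠ w →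
      Marked n (A 3) u v ∨ Marked n (A 3) u w ∨ Marked n (A 3) v w := by
    intro u v w huv huw
    have h1 := huv.1
    have h2 := huw.1
    exact hc u (by omega) v (by omega) w (by omega) huv huw
  -- Unmarked edges are not flipped, so the triangle is bad in the original graph and hence covered.
  simp only [Flipped, m1, m2, m3, n1, n2, n3, ne_eq, not_false_eq_true, true_and, iff_false,
    not_not] at h
  rcases h with ⟨h1, h2, h3⟩ | ⟨h1, h2, h3⟩ | ⟨h1, h2, h3⟩
  · rcases cov x y z h1 h2 h3 n3 with h | h | h
    exacts [m1 h, m2 h, m3 h]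
  · rcases cov y x z (hs _ _ h1) h3 h2 n2 with h | h | h
    exacts [m1 (hA.symm _ _ h), m3 h, m2 h]
  · rcases cov z x y (hs _ _ h2) (hs _ _ h3) h1 n1 with h | h | h
    exacts [m2 (hA.symm _ _ h), m3 (hA.symm _ _ h), m1 h]

theorem flipped_symm {n : ℕ} {A : Arr} (hs : ∀ u v, Plus n (A 1) u v → Plus n (A 1) v u)
    (hA : Packing n A) (u v : ℕ) (h : Flipped n A u v) : Flipped n A v u := by
  have h1 := hs u v
  have h2 := hs v u
  have h3 := hA.symm u v
  have h4 := hA.symm v u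
  have h5 : u = v ↔ v = u := eq_comm
  unfold Flipped at *
  tauto

theorem pivotCount_eq (n : ℕ) (A : Arr) (p : ℕ) (Q : ℕ → ℕ → Prop) :
    pivotCount n A p Q =
      #{q ∈ {x ∈ range n | A 5 x = 0} ×ˢ {x ∈ range n | A 5 x = 0} |
        Bad (Flipped n A) p q.1 q.2 ∧ Q q.1 q.2} := by
  rw [card_filter_product _ _ fun x y => Bad (Flipped n A) p x y ∧ Q x y, pivotCount]
  have h : {x ∈ range n | A 5 x = 0} ⊆ range (2 * n + 1) := fun x hx => by
    have := mem_range.mp (mem_filter.mp hx).1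
    exact mem_range.mpr (by omega)
  rw [← sum_subset h fun x _ hx => card_eq_zero.mpr (filter_eq_empty_iff.mpr fun y _ hy =>
    hx (mem_filter.mpr ⟨mem_range.mpr hy.1.1.1, hy.1.1.2⟩))]
  refine sum_congr rfl fun x hx => ?_
  obtain ⟨hx, hx'⟩ := mem_filter.mp hx
  rw [filter_filter]
  refine congrArg card (filter_congr fun y _ => ?_)
  simp only [mem_range.mp hx, hx', and_self, true_and]

theorem PivotState.congr {n : ℕ} {r D : ℕ → ℕ → Prop} {L L' : ℕ → ℕ} (h : PivotState n r D L)
    (hL : ∀ u < n, L' u = L u) : PivotState n r D L' := by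
  refine ⟨fun x hx h0 => ?_, ?_⟩
  · rw [hL x hx] at h0
    obtain ⟨p, hp, h1, h2⟩ := h.label x hx h0
    exact ⟨p, hp, by rw [hL x hx, h1], by rwa [hL p hp]⟩
  · have hq : ∀ q ∈ range n ×ˢ range n, L' q.1 = L q.1 ∧ L' q.2 = L q.2 := fun q hq => by
      simp only [mem_product, mem_range] at hq
      exact ⟨hL _ hq.1, hL _ hq.2⟩
    refine le_of_eq_of_le (congrArg card (filter_congr fun q h => ?_)) (h.count.trans_eq
      (congrArg (3 * card ·) (filter_congr fun q h => ?_))) <;>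
      rw [(hq q h).1, (hq q h).2]

theorem pivotRound_of_ne {n b : ℕ} {A : Arr} (h5 : b ≠ 5) (h6 : b ≠ 6) (h13 : b ≠ 13) :
    pivotRound n A b = A b := by
  simp only [pivotRound]
  rw [fill_of_ne h5, fill_of_ne h13, Function.update_of_ne h6]

theorem pivotRound_label {n u : ℕ} {A : Arr} (hu : u < 2 * n + 1) : pivotRound n A 5 u =
    if A 5 u ≠ 0 then A 5 u else
      if u = pivot n A ∨ Flipped n A (pivot n A) u then pivot n A + 1 else 0 := by
  have hF : ∀ f, Flipped n (Function.update A 6 f) = Flipped n A := fun f => by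
    funext x y
    simp only [Flipped, Function.update_of_ne (show (1 : ℕ) ≠ 6 by decide),
      Function.update_of_ne (show (3 : ℕ) ≠ 6 by decide)]
  simp only [pivotRound]
  rw [fill_self hu, fill_self hu]
  simp only [hF, Function.update_self, Function.update_of_ne (show (5 : ℕ) ≠ 6 by decide)]

/-- While points are unlabelled, averaging guarantees that the search finds a pivot, which becomes
labelled itself. Afterwards the rounds change no label, whatever the search returns. -/
theorem pivotRound_spec {n : ℕ} {A : Arr} (hr : ∀ u v, Flipped n A u v → Flipped n A v u)
    (hD : ∀ x y z, Bad (Flipped n A) x y z →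
      Marked n (A 3) x y ∨ Marked n (A 3) x z ∨ Marked n (A 3) y z)
    (h : PivotState n (Flipped n A) (Marked n (A 3)) (A 5)) :
    PivotState n (Flipped n A) (Marked n (A 3)) (pivotRound n A 5) ∧
      #{x ∈ range n | pivotRound n A 5 x = 0} ≤ #{x ∈ range n | A 5 x = 0} - 1 := by
  rcases eq_empty_or_nonempty {x ∈ range n | A 5 x = 0} with hR | hR
  · have hall : ∀ u < n, pivotRound n A 5 u = A 5 u := by
      intro u hu
      have h0 := filter_eq_empty_iff.mp hR (mem_range.mpr hu)
      rw [pivotRound_label (by omega), if_pos h0]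
    refine ⟨h.congr hall, ?_⟩
    rw [filter_congr fun u hu => by rw [hall u (mem_range.mp hu)]]
    simp [hR]
  · obtain ⟨p, hp, hcount⟩ := exists_pivot hR hr fun x _ y _ z _ => hD x y z
    simp only [mem_filter, mem_range] at hp
    have hspec := first_spec (N := 2 * n + 1) (P := fun p => (p < n ∧ A 5 p = 0) ∧
      pivotCount n A p (fun _ _ => True) ≤ pivotCount n A p (Marked n (A 3)) +
        (pivotCount n A p (Marked n (A 3)) + pivotCount n A p (Marked n (A 3))))
      ⟨p, by omega, hp, by
        rw [pivotCount_eq, pivotCount_eq]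
        simp only [and_true]
        omega⟩
    obtain ⟨-, ⟨h1, h2⟩, h3⟩ := hspec
    change pivot n A < n at h1
    change A 5 (pivot n A) = 0 at h2
    change pivotCount n A (pivot n A) (fun _ _ => True) ≤
      pivotCount n A (pivot n A) (Marked n (A 3)) + (pivotCount n A (pivot n A) (Marked n (A 3)) +
        pivotCount n A (pivot n A) (Marked n (A 3))) at h3
    rw [pivotCount_eq, pivotCount_eq] at h3
    simp only [and_true] at h3
    have hL : ∀ u < n, pivotRound n A 5 u = if A 5 u ≠ 0 then A 5 u else
        if u = pivot n A ∨ Flipped n A (pivot n A) u then pivot n A + 1 else 0 :=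
      fun u hu => pivotRound_label (by omega)
    refine ⟨h.step hr h1 h2 (by omega) hL, ?_⟩
    refine Nat.le_sub_one_of_lt (card_lt_card ?_)
    rw [ssubset_iff_of_subset]
    · refine ⟨pivot n A, by simp [h1, h2], ?_⟩
      simp [hL _ h1, h2]
    · intro u hu
      simp only [mem_filter, mem_range] at hu ⊢
      refine ⟨hu.1, ?_⟩
      by_contra h0
      rw [hL u hu.1, if_pos h0] at hu
      exact h0 hu.2

/-- The clustering found by the pivot algorithm. -/
theorem pivots_spec {n : ℕ} {A : Arr} (hr : ∀ u v, Flipped n A u v → Flipped n A v u)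
    (hD : ∀ x y z, Bad (Flipped n A) x y z →
      Marked n (A 3) x y ∨ Marked n (A 3) x z ∨ Marked n (A 3) y z) (h5 : ∀ u < n, A 5 u = 0) :
    let B := iter (fun _ => pivotRound n) (2 * n + 1) A
    (∀ b, b ≠ 5 → b ≠ 6 → b ≠ 13 → B b = A b) ∧ (∀ u < n, B 5 u ≤ n) ∧
      #(disagree n (Flipped n A) (SameLabel (B 5))) ≤ 3 * #(markedPairs n A) := by
  intro B
  have hB := iter_induction (F := fun _ => pivotRound n) (m := 2 * n + 1) (A := A)
    (fun i C => (∀ b, b ≠ 5 → b ≠ 6 → b ≠ 13 → C b = A b) ∧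
      PivotState n (Flipped n A) (Marked n (A 3)) (C 5) ∧ #{x ∈ range n | C 5 x = 0} ≤ n - i)
    (by
      rintro i - C ⟨h1, h2, h3⟩
      have e1 := h1 1 (by decide) (by decide) (by decide)
      have e3 := h1 3 (by decide) (by decide) (by decide)
      have hF : Flipped n C = Flipped n A := by
        funext x y
        rw [Flipped, Flipped, e1, e3]
      obtain ⟨h4, h6⟩ := pivotRound_spec (A := C) (by rwa [hF]) (by rwa [hF, e3]) (by rwa [hF, e3])
      rw [hF, e3] at h4
      exact ⟨fun b h5 h6 h7 => (pivotRound_of_ne h5 h6 h7).trans (h1 b h5 h6 h7), h4, by omega⟩)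
    (by
      refine ⟨fun _ _ _ _ => rfl, ⟨fun x hx h0 => absurd (h5 x hx) h0, ?_⟩,
        (card_filter_le _ _).trans (card_range n).le⟩
      refine le_of_eq_of_le (card_eq_zero.mpr (filter_eq_empty_iff.mpr fun q hq hq' => ?_))
        (Nat.zero_le _)
      simp only [mem_product, mem_range] at hq
      exact hq'.2.2 ⟨h5 _ hq.1, h5 _ hq.2⟩)
  obtain ⟨h1, h2, h3⟩ := hB
  have h0 : ∀ u < n, B 5 u ≠ 0 := by
    intro u hu h0
    have : 0 < #{x ∈ range n | B 5 x = 0} := card_pos.mpr ⟨u, by simp [hu, h0]⟩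
    change #{x ∈ range n | B 5 x = 0} ≤ _ at h3
    omega
  refine ⟨h1, fun u hu => ?_, h2.card_disagree_le h0⟩
  obtain ⟨p, hp, h4, -⟩ := h2.label u hu (h0 u hu)
  change B 5 u = p + 1 at h4
  omega

theorem distributeRound_of_ne {n j b : ℕ} {A : Arr} (h10 : b ≠ 10) (h11 : b ≠ 11) (h12 : b ≠ 12) :
    distributeRound n j A b = A b := by
  simp only [distributeRound]
  rw [fillMatrix_of_ne h10, fillMatrix_of_ne h11, fill_of_ne h12]

theorem distributeRound_matrix {n j m b : ℕ} {A : Arr} (hm : m < 2 * n + 1) (hb : b < 2 * n + 1) :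
    matrix n (distributeRound n j A 10) m b =
      if b = j then bestSplit (2 * n + 1) (matrix n (A 7)) j (matrix n (A 10)) m
      else matrix n (A 10)
        (m - bestSplit (2 * n + 1) (matrix n (A 7)) j (matrix n (A 10)) m) b := by
  simp only [distributeRound]
  rw [matrix, fillMatrix_self hm hb, matrix, fillMatrix_self hm hb, fill_self hm,
    fill_of_ne (by decide)]

/-- The sizes found by dynamic programming are optimal. -/
theorem distribute_spec {n : ℕ} {A : Arr} (h10 : A 10 = fun _ => 0) :
    let B := iter (distributeRound n) (2 * n + 1) A
    (∀ b, b ≠ 10 → b ≠ 11 → b ≠ 12 → B b = A b) ∧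
      Distribution (2 * n + 1) n (matrix n (A 7)) (2 * n + 1) (matrix n (B 10)) := by
  refine iter_induction (F := distributeRound n) (m := 2 * n + 1) (A := A)
    (fun j C => (∀ b, b ≠ 10 → b ≠ 11 → b ≠ 12 → C b = A b) ∧
      Distribution (2 * n + 1) n (matrix n (A 7)) j (matrix n (C 10))) ?_ ?_
  · rintro j hj C ⟨h1, h2⟩
    refine ⟨fun b hb hb' hb'' => (distributeRound_of_ne hb hb' hb'').trans (h1 b hb hb' hb''),
      h2.step (by omega) hj fun m hm b hb => ?_⟩
    rw [distributeRound_matrix (by omega) hb, h1 7 (by decide) (by decide) (by decide)]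
  · refine ⟨fun _ _ _ _ => rfl, ?_⟩
    rw [h10]
    exact distribution_zero _ _ _

/-- The program computes a fair clustering, optimal up to a constant factor. -/
theorem fairClustering_spec {n : ℕ} {A : Arr}
    (hs : ∀ u v, Plus n (A 1) u v → Plus n (A 1) v u) (hi : ∀ u, ¬ Plus n (A 1) u u)
    (h0 : ∀ b, 2 ≤ b → A b = fun _ => 0) :
    ∃ L : ℕ → ℕ, (∀ v < n, fairClustering n A 2 v = L v) ∧ FairLabel n (A 0) L ∧
      ∀ M : ℕ → ℕ, FairLabel n (A 0) M → (∀ v < n, M v < n) →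
        #(disagree n (Plus n (A 1)) (SameLabel L)) ≤
          116 * #(disagree n (Plus n (A 1)) (SameLabel M)) := by
  obtain ⟨p1, p2, p3⟩ := packing_spec hs hi (A := A) fun u v h => h.2 (by rw [h0 3 (by decide)])
  set A1 := packing n A with hA1
  have e1 : A1 1 = A 1 := p2.1 1 (by decide)
  have hs1 : ∀ u v, Plus n (A1 1) u v → Plus n (A1 1) v u := by rwa [e1]
  obtain ⟨q1, q2, q3⟩ := pivots_spec (flipped_symm hs1 p1) (fun x y z => marked_of_bad hs1 p1 p3)
    (fun u _ => by rw [p2.1 5 (by decide), h0 5 (by decide)])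
  set A2 := iter (fun _ => pivotRound n) (2 * n + 1) A1 with hA2
  set A3 := weights n A2 with hA3
  have w7 : ∀ b < 2 * n + 1, ∀ s < 2 * n + 1,
      matrix n (A3 7) b s = weight n (A 0) (A2 5) b s := by
    intro b hb s hsn
    rw [hA3, weights, matrix, fillMatrix_self hb hsn, min_eq_left hsn.le,
      q1 0 (by decide) (by decide) (by decide), p2.1 0 (by decide)]
  have w0 : ∀ b, b ≠ 7 → A3 b = A2 b := fun b hb => fillMatrix_of_ne hb _ _ _
  have hfinal : fairClustering n A = fill 2 (2 * n + 1)
      (newLabel n (iter (distributeRound n) (2 * n + 1) A3 0)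
        (iter (distributeRound n) (2 * n + 1) A3 5)
        (sizes n (iter (distributeRound n) (2 * n + 1) A3)))
      (iter (distributeRound n) (2 * n + 1) A3) := rfl
  obtain ⟨d1, d2⟩ := distribute_spec (n := n) (A := A3) (by
    rw [w0 10 (by decide), q1 10 (by decide) (by decide) (by decide), p2.1 10 (by decide),
      h0 10 (by decide)])
  set A4 := iter (distributeRound n) (2 * n + 1) A3 with hA4
  have c0 : A4 0 = A 0 := by
    rw [d1 0 (by decide) (by decide) (by decide), w0 0 (by decide),
      q1 0 (by decide) (by decide) (by decide), p2.1 0 (by decide)]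
  have c5 : A4 5 = A2 5 := by
    rw [d1 5 (by decide) (by decide) (by decide), w0 5 (by decide)]
  rw [c0, c5] at hfinal
  have hN : (2 * n + 1 = 0 → n = 0) := fun h => by omega
  have hsum := d2.sum n le_rfl hN
  have hle : ∀ f : ℕ → ℕ, ∑ b ∈ range (2 * n + 1), f b = n → ∀ b ∈ range (2 * n + 1), f b ≤ n := by
    intro f hf b hb
    conv_rhs => rw [← hf]
    exact single_le_sum (f := f) (fun _ _ => Nat.zero_le _) hb
  have hsz : ∀ b ∈ range (2 * n + 1), sizes n A4 b = matrix n (A4 10) n b := by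
    intro b hb
    have := hle _ hsum b hb
    rw [sizes, matrix] at *
    omega
  have hsum' : ∑ b ∈ range (2 * n + 1), sizes n A4 b = n := (sum_congr rfl hsz).trans hsum
  have hw : ∀ f : ℕ → ℕ, ∑ b ∈ range (2 * n + 1), f b = n →
      ∑ b ∈ range (2 * n + 1), matrix n (A3 7) b (f b) =
        ∑ b ∈ range (2 * n + 1), weight n (A 0) (A2 5) b (f b) := by
    intro f hf
    refine sum_congr rfl fun b hb => w7 b (mem_range.mp hb) _ ?_
    have := hle f hf b hb
    omega
  obtain ⟨r1, r2⟩ := newLabel_spec (n := n) (χ := A 0) (L := A2 5) (sz := sizes n A4) q2 hsum'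
    fun sz' hsz' => by
      rw [← hw _ hsum', ← hw _ hsz', sum_congr rfl fun b hb => by rw [hsz b hb]]
      exact d2.opt n le_rfl hN sz' (fun b hb hb' => by omega) hsz'
  refine ⟨newLabel n (A 0) (A2 5) (sizes n A4), fun v hv => ?_, r1, fun M hM hMn => ?_⟩
  · rw [hfinal, fill_self (by omega)]
  -- Pivot clustering: 3 + 1 times the marked pairs, hence 12 times the optimum. Its distance to `M`
  -- is at most 13 times the optimum, and 8 · 13 + 12 = 116.
  · have t1 := r2 M hM hMn
    have t2 := card_disagree_triangle n (Plus n (A 1)) (SameLabel (A2 5))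
      (SameLabel (newLabel n (A 0) (A2 5) (sizes n A4)))
    have t3 := card_disagree_triangle n (SameLabel (A2 5)) (Plus n (A 1)) (SameLabel M)
    rw [disagree_comm n (SameLabel (A2 5)) (Plus n (A 1))] at t3
    have t4 := card_disagree_triangle n (Plus n (A 1)) (Flipped n A1) (SameLabel (A2 5))
    have t5 : #(disagree n (Plus n (A 1)) (Flipped n A1)) ≤ #(markedPairs n A1) := by
      refine card_le_card fun q hq => ?_
      rw [mem_markedPairs]
      rw [mem_disagree, Flipped, e1] at hq
      tauto
    have t6 := (p1.card_le M).trans (Nat.mul_le_mul_left 3 (card_le_card inter_subset_right))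
    rw [e1] at t6
    omega

end FairCC

namespace FairCC

open Finset
open scoped Classical

/-! ### Labels and clusterings -/

section Labels

variable {n : ℕ}

/-- Two points have the same label exactly if they are in the same cluster. -/
def Represents (L : ℕ → ℕ) (P : Clustering (Fin n)) : Prop :=
  ∀ u v : Fin n, L u = L v ↔ ∃ C ∈ P.parts, u ∈ C ∧ v ∈ C

theorem exists_clustering (n : ℕ) (L : ℕ → ℕ) : ∃ P : Clustering (Fin n), Represents L P := by
  refine ⟨Finpartition.ofSetoid (Setoid.ker fun v : Fin n => L v), fun u v => ?_⟩
  rw [← Finpartition.mem_part_iff_exists, Finpartition.mem_part_ofSetoid_iff_rel, Setoid.ker_def,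
    eq_comm]

/-- Labelling each cluster by its least point keeps the labels below `n`, as the comparison with
fair clusterings demands. -/
theorem exists_label (P : Clustering (Fin n)) :
    ∃ M : ℕ → ℕ, (∀ v < n, M v < n) ∧ Represents M P := by
  have hne : ∀ v : Fin n, (P.part v).Nonempty := fun v => P.part_nonempty.mpr (mem_univ v)
  refine ⟨fun v => if h : v < n then ((P.part ⟨v, h⟩).min' (hne _) : ℕ) else 0, fun v hv => ?_,
    fun u v => ?_⟩
  · simp only [dif_pos hv]
    exact Fin.is_lt _
  · simp only [Fin.is_lt, dif_pos, Fin.eta, ← Finpartition.mem_part_iff_exists]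
    rw [P.mem_part_iff_part_eq_part (mem_univ u) (mem_univ v)]
    constructor
    · intro h
      have h' := Fin.ext h
      have h1 := min'_mem (P.part u) (hne u)
      have h2 := min'_mem (P.part v) (hne v)
      rw [← h'] at h2
      have hu := P.part_mem.mpr (mem_univ u)
      have hv := P.part_mem.mpr (mem_univ v)
      exact (P.part_eq_of_mem hu h1).symm.trans (P.part_eq_of_mem hv h2)
    · intro h
      simp only [h]

/-- The graph of the disagreements between a graph and a clustering. -/
def mistakes (G : SimpleGraph (Fin n)) (P : Clustering (Fin n)) : SimpleGraph (Fin n) where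
  Adj u v := u ≠ v ∧ ¬ (G.Adj u v ↔ ∃ C ∈ P.parts, u ∈ C ∧ v ∈ C)
  symm := ⟨fun u v h => by simpa only [G.adj_comm v u, and_comm (a := v ∈ _), ne_comm] using h⟩
  loopless := ⟨fun u h => h.1 rfl⟩

theorem cost_eq_card_mistakes (G : SimpleGraph (Fin n)) (P : Clustering (Fin n)) :
    cost G P = #(mistakes G P).edgeFinset := by
  rw [cost, ← Set.ncard_union_eq _ (Set.toFinite _) (Set.toFinite _),
    ← Set.ncard_coe_finset, SimpleGraph.coe_edgeFinset]
  · congr 1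
    ext e
    induction e using Sym2.ind with
    | _ u v =>
      simp only [interEdges, intraEdges, mistakes, Set.mem_union, Set.mem_inter_iff,
        Set.mem_ofPred_eq, SimpleGraph.mem_edgeSet, SimpleGraph.compl_adj, Sym2.mk_isDiag_iff,
        Sym2.mem_iff, forall_eq_or_imp, forall_eq, ne_eq]
      generalize (∃ C ∈ P.parts, u ∈ C ∧ v ∈ C) = E
      by_cases hE : E <;> by_cases hG : G.Adj u v <;> by_cases huv : u = v <;>
        simp [hE, hG, huv]
  · rw [Set.disjoint_left]
    intro e h1 h2
    exact h1.1.2 h2.1.2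

/-- Ordered disagreeing pairs are the degree sum of the graph of mistakes, twice its number of
edges. -/
theorem two_mul_cost {G : SimpleGraph (Fin n)} {P : Clustering (Fin n)} {r : ℕ → ℕ → Prop}
    {L : ℕ → ℕ} (hr : ∀ u v : Fin n, r u v ↔ G.Adj u v) (hL : Represents L P) :
    2 * cost G P = #(disagree n r (SameLabel L)) := by
  rw [cost_eq_card_mistakes, ← SimpleGraph.sum_degrees_eq_twice_card_edges, disagree,
    card_filter_product _ _ fun u v => u ≠ v ∧ ¬ (r u v ↔ SameLabel L u v), sum_range]
  refine sum_congr rfl fun u _ => ?_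
  rw [← SimpleGraph.card_neighborFinset_eq_degree, SimpleGraph.neighborFinset_eq_filter,
    card_filter, card_filter, sum_range]
  refine sum_congr rfl fun v _ => ?_
  simp only [mistakes, SameLabel, hr, hL u v, ne_eq, Fin.val_inj]
  congr

theorem card_range_filter (n : ℕ) (P : ℕ → Prop) [DecidablePred P] :
    #{v ∈ range n | P v} = #{v : Fin n | P v} := by
  rw [card_filter, card_filter, sum_range]

variable {k : ℕ} {χ : Fin n → Fin k} {χ' : ℕ → ℕ} {L : ℕ → ℕ} {P : Clustering (Fin n)}

theorem colorSize_eq (hχ : ∀ v : Fin n, χ' v = χ v) (v : Fin n) :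
    colorSize n χ' v = colorCount χ (χ v) univ := by
  rw [colorSize, card_range_filter, colorCount]
  simp only [hχ, Fin.val_inj]

theorem label_eq_iff_mem (hL : Represents L P) {C : Finset (Fin n)} (hC : C ∈ P.parts)
    {u : Fin n} (hu : u ∈ C) (v : Fin n) : L v = L u ↔ v ∈ C := by
  rw [hL]
  constructor
  · rintro ⟨D, hD, hv, hu'⟩
    rwa [P.eq_of_mem_parts hC hD hu hu']
  · exact fun hv => ⟨C, hC, hv, hu⟩

theorem clusterSize_eq (hL : Represents L P) {C : Finset (Fin n)} (hC : C ∈ P.parts)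
    {u : Fin n} (hu : u ∈ C) : clusterSize n L (L u) = #C := by
  rw [clusterSize, card_range_filter]
  simp only [label_eq_iff_mem hL hC hu]
  congr 1
  ext v
  simp

theorem colorInCluster_eq (hχ : ∀ v : Fin n, χ' v = χ v) (hL : Represents L P)
    {C : Finset (Fin n)} (hC : C ∈ P.parts) {u : Fin n} (hu : u ∈ C) (v : Fin n) :
    colorInCluster n χ' L (L u) v = colorCount χ (χ v) C := by
  rw [colorInCluster, card_range_filter, colorCount]
  simp only [label_eq_iff_mem hL hC hu, hχ, Fin.val_inj]
  congr 1
  ext w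
  simp

theorem sum_colorCount (χ : Fin n → Fin k) (C : Finset (Fin n)) :
    ∑ i, colorCount χ i C = #C :=
  (card_eq_sum_card_fiberwise fun _ _ => mem_coe.mpr (mem_univ _)).symm

/-- Summing the pairwise proportions over the second color turns them into proportions to the
cluster size and `n`. Conversely, multiply the pairwise equation by `n`, which is positive as
clusters are nonempty; unused colors give zero on both sides. -/
theorem isFair_iff_fairLabel (hχ : ∀ v : Fin n, χ' v = χ v) (hL : Represents L P) :
    IsFair χ P ↔ FairLabel n χ' L := by
  constructor
  · intro h b v hv
    by_cases hb : ∃ u : Fin n, L u = b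
    · obtain ⟨u, rfl⟩ := hb
      have hC := P.part_mem.mpr (mem_univ u)
      have hu := P.mem_part_self.mpr (mem_univ u)
      have e1 := colorInCluster_eq hχ hL hC hu ⟨v, hv⟩
      have e2 := colorSize_eq hχ ⟨v, hv⟩
      simp only at e1 e2
      have hn : n = ∑ j, colorCount χ j univ := by
        rw [sum_colorCount, card_univ, Fintype.card_fin]
      rw [e1, e2, clusterSize_eq hL hC hu, ← sum_colorCount χ (P.part u), sum_mul]
      refine (congrArg _ hn).trans ?_
      rw [mul_sum]
      exact sum_congr rfl fun j _ => h _ hC _ _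
    · push Not at hb
      have h1 : clusterSize n L b = 0 := card_eq_zero.mpr <| filter_eq_empty_iff.mpr fun u hu =>
        hb ⟨u, mem_range.mp hu⟩
      have h2 : colorInCluster n χ' L b v = 0 := card_eq_zero.mpr <|
        filter_eq_empty_iff.mpr fun u hu hu' => hb ⟨u, mem_range.mp hu⟩ hu'.1
      rw [h1, h2, zero_mul, zero_mul]
  · intro h C hC i j
    obtain ⟨u, hu⟩ := P.nonempty_of_mem_parts hC
    have hn : 0 < n := u.pos
    have key : ∀ i, colorCount χ i C * n = #C * colorCount χ i univ := by
      intro i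
      by_cases hi : ∃ v, χ v = i
      · obtain ⟨v, rfl⟩ := hi
        rw [← colorInCluster_eq hχ hL hC hu, ← colorSize_eq hχ, ← clusterSize_eq hL hC hu]
        exact h _ _ v.is_lt
      · push Not at hi
        have h0 : ∀ S : Finset (Fin n), colorCount χ i S = 0 := fun S =>
          card_eq_zero.mpr <| filter_eq_empty_iff.mpr fun v _ => hi v
        rw [h0, h0, zero_mul, mul_zero]
    refine Nat.eq_of_mul_eq_mul_right hn ?_
    rw [mul_right_comm, key i, mul_right_comm (colorCount χ j C), key j, mul_right_comm]

end Labels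

theorem plus_inputState {n k : ℕ} (G : SimpleGraph (Fin n)) (χ : Fin n → Fin k) (u v : ℕ) :
    Plus n ((inputState n k G χ).arr 1) u v ↔ ∃ (hu : u < n) (hv : v < n), G.Adj ⟨u, hu⟩ ⟨v, hv⟩ := by
  simp only [Plus, inputState, one_ne_zero, if_false, if_true, ne_eq, ite_eq_right_iff,
    Classical.not_imp, not_false_eq_true, and_true]
  constructor
  · rintro ⟨⟨hu, hv⟩, u', v', h, he⟩
    obtain ⟨rfl, rfl⟩ := (entry_inj hv v'.is_lt).mp he
    exact ⟨hu, hv, h⟩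
  · rintro ⟨hu, hv, h⟩
    exact ⟨⟨hu, hv⟩, ⟨u, hu⟩, ⟨v, hv⟩, h, rfl⟩

/-- A program that computes a fair clustering in polynomial time, with a cost that is at most a
constant times the optimum. -/
theorem exists_program : ∃ (A : Prog) (T : Polynomial ℕ), ∀ (n k : ℕ) (G : SimpleGraph (Fin n))
    (χ : Fin n → Fin k), ∃ (t : ℕ) (s : State) (F : Clustering (Fin n)),
      Exec A (inputState n k G χ) t s ∧ t ≤ T.eval n ∧ Outputs s F ∧ IsFair χ F ∧
        ∀ Q : Clustering (Fin n), IsFair χ Q → cost G F ≤ 116 * cost G Q := by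
  obtain ⟨A, T, hA⟩ := executes_fairClustering 1 (fun r => r 0) ⟨one_pos, fun _ => rfl⟩
  refine ⟨A, T, fun n k G χ => ?_⟩
  obtain ⟨t, s, hex, ht, hs, -⟩ := hA (inputState n k G χ)
  have hplus := plus_inputState G χ
  have h0 : (inputState n k G χ).reg 0 = n := rfl
  have hχ : ∀ v : Fin n, (inputState n k G χ).arr 0 v = χ v := fun v => by
    simp [inputState]
  obtain ⟨L, h1, h2, h3⟩ := fairClustering_spec (n := n) (A := (inputState n k G χ).arr)
    (fun u v h => by
      rw [hplus] at h ⊢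
      obtain ⟨hu, hv, h⟩ := h
      exact ⟨hv, hu, h.symm⟩)
    (fun u h => by
      rw [hplus] at h
      obtain ⟨_, _, h⟩ := h
      exact G.irrefl h)
    (fun b hb => by
      funext m
      simp only [inputState]
      rw [if_neg (by omega), if_neg (by omega)])
  obtain ⟨F, hF⟩ := exists_clustering n L
  have hr : ∀ u v : Fin n, Plus n ((inputState n k G χ).arr 1) u v ↔ G.Adj u v := fun u v => by
    rw [hplus]
    exact ⟨fun ⟨_, _, h⟩ => h, fun h => ⟨u.is_lt, v.is_lt, h⟩⟩
  refine ⟨t, s, F, hex, by rwa [h0] at ht, fun u v => ?_, (isFair_iff_fairLabel hχ hF).mpr h2,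
    fun Q hQ => ?_⟩
  · rw [hs, h0, h1 u u.is_lt, h1 v v.is_lt]
    exact hF u v
  · obtain ⟨M, hM, hMQ⟩ := exists_label Q
    have h4 := h3 M ((isFair_iff_fairLabel hχ hMQ).mp hQ) hM
    rw [← two_mul_cost hr hF, ← two_mul_cost hr hMQ] at h4
    omega

theorem cost_eq_zero (G : SimpleGraph (Fin 0)) (P : Clustering (Fin 0)) : cost G P = 0 := by
  simp [cost, Set.eq_empty_of_isEmpty]

end FairCC

/-! ### The approximation factors in terms of the number of colors -/

theorem mainTheorem4 :
    ∃ (A : FairCC.Prog) (T : Polynomial ℕ) (c : ℝ),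
      ∀ (n k : ℕ) (G : SimpleGraph (Fin n)) (χ : Fin n → Fin k),
        ∃ (t : ℕ) (s : FairCC.State) (F : FairCC.Clustering (Fin n)),
          FairCC.Exec A (FairCC.inputState n k G χ) t s ∧
          t ≤ T.eval n ∧
          FairCC.Outputs s F ∧
          FairCC.IsApproxFair (c * (k : ℝ) ^ (3.81 : ℝ)) G χ F ∧
          (2 ≤ k → FairCC.EqualGroups χ →
            FairCC.IsApproxFair
              (c * ((k : ℝ) ^ (1.6 : ℝ) * Real.logb 2 (k : ℝ) ^ (2.81 : ℝ))) G χ F) := by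
  obtain ⟨A, T, hA⟩ := FairCC.exists_program
  refine ⟨A, T, 116, fun n k G χ => ?_⟩
  obtain ⟨t, s, F, h1, h2, h3, h4, h5⟩ := hA n k G χ
  have key : ∀ x : ℝ, 1 ≤ x → FairCC.IsApproxFair (116 * x) G χ F := by
    intro x hx
    refine ⟨h4, fun Q hQ => ?_⟩
    calc (FairCC.cost G F : ℝ) ≤ 116 * (FairCC.cost G Q : ℝ) := by exact_mod_cast h5 Q hQ
      _ ≤ 116 * x * (FairCC.cost G Q : ℝ) :=
        mul_le_mul_of_nonneg_right (by linarith) (Nat.cast_nonneg _)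
  refine ⟨t, s, F, h1, h2, h3, ?_, fun hk _ => key _ ?_⟩
  -- Without colors the factor is 0, but then there are no points and every cost vanishes.
  · rcases Nat.eq_zero_or_pos k with rfl | hk
    · obtain rfl : n = 0 := by
        by_contra hn
        exact (χ ⟨0, Nat.pos_of_ne_zero hn⟩).elim0
      exact ⟨h4, fun Q _ => by simp [FairCC.cost_eq_zero]⟩
    · exact key _ (Real.one_le_rpow (by exact_mod_cast hk) (by norm_num))
  · have hk' : (2 : ℝ) ≤ k := by exact_mod_cast hk
    -- Two colors are what makes the logarithm, and so the whole factor, at least 1.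
    have hlog : 1 ≤ Real.logb 2 (k : ℝ) := by
      rw [Real.le_logb_iff_rpow_le (by norm_num) (by linarith)]
      simpa using hk'
    exact one_le_mul_of_one_le_of_one_le (Real.one_le_rpow (by linarith) (by norm_num))
      (Real.one_le_rpow hlog (by norm_num))
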